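/- Conventions. Graphs are simple and undirected. For a graph $G$ of bounded valency and an integer $k\ge 0$, the Følner function is $$Fol_G(k)=\min\{|U| : U\subset V(G)\text{ finite and non-empty},\ k\,|\partial_G U|\le |U|\},$$ where $\partial_G U$ is the set of pairs $(x,y)$ of adjacent vertices with $x\in U$, $y\notin U$. $p^G_n(x,y)$ denotes the $n$-step transition probability of the lazy simple random walk on $G$, which jumps uniformly to one of the $\nu(x)+1$ points formed by the current vertex $x$ and its $\nu(x)$ neighbours. For real sequences, $a\preceq b$ means that there are constants $c_1,c_2>0$ with $a_n\le c_1 b_{\lfloor c_2 n\rfloor}$ for all $n\ge 0$, and $a\approx b$ means $a\preceq b$ and $b\preceq a$. Let $A$ be a graph, $\varphi:V(A)\to L$ a map to a set $L$ of lamps, and $(B_z)_{z\in L}$ graphs with a chosen rest vertex in each. The generalized wreath product has as vertices the pairs $(a,f)$ with $a\in V(A)$ and $f$ a choice of a vertex $f(z)\in B_z$ for every $z\in L$, equal to the rest vertex for all but finitely many $z$; $(a,f)$ and $(b,g)$ are adjacent if either $f=g$ and $a,b$ are adjacent in $A$, or $a=b$, $f$ and $g$ agree off $\varphi(a)$, and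 $f(\varphi(a)),g(\varphi(a))$ are adjacent in $B_{\varphi(a)}$. (So lamps are identified along the partition of $V(A)$ into the fibres of $\varphi$.) For $L=V(A)$ and $\varphi=\mathrm{id}$ this is the wreath product $A\wr B_z$. Below, $\mathbb Z$ and $\mathbb Z/2\mathbb Z$ stand for their Cayley graphs with generator $1$. Theorem. Let $\alpha\in[0,1)$, $\beta=\frac{2\alpha}{1-\alpha}$ and $F(x)=\exp(x^{\beta})$. There are an infinite graph $D_F$ of bounded valency, connected if $\alpha>0$, and a vertex $d_0$ of $D_F$ such that $Fol_{D_F}$ is finite for every $k$, and (i) $Fol_{D_F}(k)\approx F(k)$; (ii) $p^{D_F}_n(d_0,d_0)\approx e^{-n^{\alpha}}$. Moreover: (a) If $\alpha\ge 1/3$, then $D_F$ can be taken to be a wreath product of $\mathbb Z$ with fibres $(B_z)_{z\in\mathbb Z}$, where $B_z$ is a finite connected graph with exactly $\lfloor F(|z|+1)/F(|z|)\rfloor$ vertices and the valencies of all the $B_z$ are bounded by one constant; and $d_0=(0,\text{all lamps at rest})$. (b) If $0<\alpha\le 1/3$, then $D_F$ can be taken to be a generalized wreath product of $\mathbb Z$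 by $\mathbb Z/2\mathbb Z$ along a surjective map $\varphi:\mathbb Z\to\mathbb Z$ for which there are constants $c,C>0$ with $c\,m^{\beta}\le |\varphi(\{k,k+1,\dots,k+m\})|\le C\,m^{\beta}$ for all $k\in\mathbb Z$ and all integers $m\ge 1$; and $d_0=(0,\text{all lamps at rest})$. -/

import Mathlib

/-- The number `ν(x)` of neighbours of the vertex `x` in the graph `G`. -/
noncomputable def valency {V : Type} (G : SimpleGraph V) (x : V) : ℕ :=
  (G.neighborSet x).ncard

/-- Bounded valency: the neighbourhoods are finite, of uniformly bounded size. -/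
def BoundedValency {V : Type} (G : SimpleGraph V) : Prop :=
  ∃ D : ℕ, ∀ x : V, (G.neighborSet x).encard ≤ (D : ℕ∞)

/-- The edge boundary `∂_G U = {(x, y) ∈ E(G) ; x ∈ U, y ∉ U}`. -/
def edgeBoundary {V : Type} (G : SimpleGraph V) (U : Finset V) : Set (V × V) :=
  {e | G.Adj e.1 e.2 ∧ e.1 ∈ U ∧ e.2 ∉ U}

/-- The non-empty finite sets `U` of vertices with `|∂_G U| / |U| ≤ 1 / k`
(no condition other than non-emptiness for `k = 0`). -/
def folnerSets {V : Type} (G : SimpleGraph V) (k : ℕ) : Set (Finset V) :=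
  {U | U.Nonempty ∧ k * (edgeBoundary G U).ncard ≤ U.card}

/-- The Følner function `Fol_G(k) = min {|U| ; U ∈ folnerSets G k}`. (It is used together with
the requirement that `folnerSets G k` is non-empty for every `k`.) -/
noncomputable def folner {V : Type} (G : SimpleGraph V) (k : ℕ) : ℕ :=
  sInf (Finset.card '' folnerSets G k)

open Classical in
/-- One step of the lazy simple random walk: from `x` the walk jumps uniformly on the set formed by
`x` and its neighbours. -/
noncomputable def walkStep {V : Type} (G : SimpleGraph V) (x y : V) : ℝ :=
  if x = y ∨ G.Adj x y then 1 / ((valency G x : ℝ) + 1) else 0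

open Classical in
/-- The `n`-step transition probabilities `p_n(x, y)` of the lazy simple random walk
(the `n`-th power of the one-step matrix; on a graph of bounded valency all sums are finite). -/
noncomputable def transProb {V : Type} (G : SimpleGraph V) : ℕ → V → V → ℝ
  | 0, x, y => if x = y then 1 else 0
  | n + 1, x, y => ∑' z, walkStep G x z * transProb G n z y

/-- `a ≼ b`: there are constants `c₁, c₂ > 0` with `a_n ≤ c₁ b_{c₂ n}` for all `n ≥ 0`
(the index `c₂ n` being rounded down to an integer). -/
def Dominated (a b : ℕ → ℝ) : Prop :=
  ∃ c₁ : ℝ, 0 < c₁ ∧ ∃ c₂ : ℝ, 0 < c₂ ∧ ∀ n : ℕ, a n ≤ c₁ * b ⌊c₂ * (n : ℝ)⌋₊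

/-- `a ≈ b`: both `a ≼ b` and `b ≼ a`. -/
def Comparable (a b : ℕ → ℝ) : Prop :=
  Dominated a b ∧ Dominated b a

/-- `F(x) = exp(x ^ (2α / (1 - α)))`. -/
noncomputable def profileF (α x : ℝ) : ℝ :=
  Real.exp (x ^ (2 * α / (1 - α)))

/-- `G` has bounded valency, its Følner function is finite and `≈ F`, and the return probability
of the lazy simple random walk at `d₀` is `≈ exp(-n ^ α)`. -/
def HasExpectedDecay {V : Type} (α : ℝ) (G : SimpleGraph V) (d₀ : V) : Prop :=
  BoundedValency G ∧
  (∀ k : ℕ, (folnerSets G k).Nonempty) ∧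
  Comparable (fun k => (folner G k : ℝ)) (fun k => profileF α (k : ℝ)) ∧
  Comparable (fun n => transProb G n d₀ d₀) (fun n => Real.exp (-((n : ℝ) ^ α)))

/-- Lamp configurations: `f z ∈ W z` for every `z`, and `f z` is the rest state `o z` for all but
finitely many `z`. -/
def LampConfig {L : Type} (W : L → Type) (o : ∀ z, W z) : Type :=
  {f : ∀ z, W z // {z | f z ≠ o z}.Finite}

/-- The configuration in which every lamp is at rest. -/
def LampConfig.rest {L : Type} (W : L → Type) (o : ∀ z, W z) : LampConfig W o :=
  ⟨o, by simp⟩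

/-- The generalized wreath product of the base graph `A` by the fibres `B z` along the lamp map `φ`:
a vertex is a position `a` of the walker in `A` and a configuration of the lamps; an edge either
moves the walker along an edge of `A`, or changes the state of the single lamp `φ a` along an
edge of the fibre of that lamp. Positions with the same image under `φ` share one lamp, so the
lamps are identified along the partition of the base into the sets `φ⁻¹ {i}`. -/
def generalizedWreath {V L : Type} (A : SimpleGraph V) (φ : V → L) (W : L → Type)
    (B : ∀ z, SimpleGraph (W z)) (o : ∀ z, W z) : SimpleGraph (V × LampConfig W o) where
  Adj u v :=
    (A.Adj u.1 v.1 ∧ u.2 = v.2) ∨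
    (u.1 = v.1 ∧ (∀ x, x ≠ φ u.1 → u.2.1 x = v.2.1 x) ∧
      (B (φ u.1)).Adj (u.2.1 (φ u.1)) (v.2.1 (φ u.1)))
  symm := ⟨by
    rintro u v (⟨h, h'⟩ | ⟨h, h', h''⟩)
    · exact Or.inl ⟨h.symm, h'.symm⟩
    · refine Or.inr ⟨h.symm, ?_, ?_⟩
      · intro x hx
        exact (h' x (by rw [h]; exact hx)).symm
      · rw [← h]
        exact h''.symm⟩
  loopless := ⟨by
    rintro u (⟨h, _⟩ | ⟨_, _, h⟩)
    · exact A.loopless.irrefl _ h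
    · exact (B (φ u.1)).loopless.irrefl _ h⟩

/-- The wreath product `A ≀ B_z`: one lamp, with fibre `B z`, at each vertex `z` of `A`. -/
def wreath {V : Type} (A : SimpleGraph V) (W : V → Type)
    (B : ∀ z, SimpleGraph (W z)) (o : ∀ z, W z) : SimpleGraph (V × LampConfig W o) :=
  generalizedWreath A id W B o

/-- The Cayley graph of `ℤ` with generator `1`. -/
def intGraph : SimpleGraph ℤ := SimpleGraph.circulantGraph {1}

/-- The Cayley graph of `ℤ / 2ℤ` with generator `1`. -/
def zmodTwoGraph : SimpleGraph (ZMod 2) := SimpleGraph.circulantGraph {1}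

/-- The fibre size `l(z) = F(|z| + 1) / F(|z|)`, rounded down to an integer. -/
noncomputable def fibreSize (α : ℝ) (z : ℤ) : ℕ :=
  ⌊profileF α (|(z : ℝ)| + 1) / profileF α |(z : ℝ)|⌋₊

/-! Write β = 2α/(1-α), so that F(k) = exp(k^β). All four estimates are proved for a generalized
wreath product of ℤ with finite fibres (`hasExpectedDecay_wreath`). The only inputs are bounded
valency, a product bound exp(C(m+1)^β) on the sizes of the lamps met in [-m, m], a lower bound ≈ k^β
on the entropy of the lamps met by any positive proportion of a window of length k
(`WindowEntropy`), and expansion of sets that are small compared to a power of the fibre size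
(`SmallSetExpansion`).

Test sets. The tube over [-m, m], with all lamps there free, is left only through its two ends. It
is therefore a Følner set, and a cosine in the base coordinate is a test function with eigenvalue at
least 1 - O(1/m²). This gives p_n ≥ exp(-C(n/m² + m^β)) up to constants. The terms balance at m ≈
n^((1-α)/2), where both are n^α because β(1-α)/2 = α.

Isoperimetry. Let k|∂U| ≤ |U|, with k large, and cut ℤ into windows of length k. Horizontal boundary
edges bound the number of pairs (window, configuration) that meet U by 2|U|/k. Vertical boundary
edges show that at half of the points of U the slice along the current lamp has relatively small
boundary, hence at least a power of the fibre size many states. Some window then carries a set of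
configurations that has large slices in many directions. Subadditivity of entropy
(`sum_log_card_slices_le`) forces this set, hence U, to have at least exp(ck^β) elements. Cheeger's
inequality applied to truncations of the heat kernel converts this into the upper bound for p_n
(`heat_le_of_isoperimetry`), again with k ≈ n^((1-α)/2).

Ingredients. For α ≥ 1/3, i.e. β ≥ 1, the prescribed fibre sizes telescope to F, and a union bound
over four permutations yields the expanding fibres. For 0 < α ≤ 1/3, i.e. β ≤ 1, the lamp map keeps
a proportion β of the binary digits of the position, so that a window of length k sees ≈ k^β lamps,
about equally often. For α = 0 all the functions are constant and an edgeless graph serves. -/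

/-! ### The lazy walk as a reversible Markov operator; return probabilities from isoperimetry -/

section Markov

/-- A finite set which contains the closed neighbourhood of the support of `u`. -/
def NhdIn {V : Type} (G : SimpleGraph V) (T : Finset V) (u : V → ℝ) : Prop :=
  ∀ x, u x ≠ 0 → x ∈ T ∧ ∀ y, G.Adj x y → y ∈ T

theorem NhdIn.eq_zero {V : Type} {G : SimpleGraph V} {T : Finset V} {u : V → ℝ} (h : NhdIn G T u) {x : V} (hx : x ∉ T) :
    u x = 0 := by
  by_contra h0
  exact hx (h x h0).1

theorem NhdIn.mono {V : Type} {G : SimpleGraph V} {T T' : Finset V} {u : V → ℝ} (h : NhdIn G T u) (hT : T ⊆ T') :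
    NhdIn G T' u :=
  fun x hx => ⟨hT (h x hx).1, fun y hy => hT ((h x hx).2 y hy)⟩

variable {V : Type} (G : SimpleGraph V) [G.LocallyFinite]

/-- The Markov operator of the lazy simple random walk. -/
noncomputable def markov (f : V → ℝ) (x : V) : ℝ :=
  (f x + ∑ y ∈ G.neighborFinset x, f y) / ((G.degree x : ℝ) + 1)

open Classical in
/-- The functions `x ↦ p_n(x, x₀)`. -/
noncomputable def heat (x₀ : V) (n : ℕ) : V → ℝ :=
  (markov G)^[n] (fun z => if z = x₀ then 1 else 0)

variable {G}

theorem degree_add_one_pos (x : V) : (0 : ℝ) < (G.degree x : ℝ) + 1 := by positivity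

theorem valency_eq_degree (x : V) : valency G x = G.degree x := by
  rw [valency, Set.ncard_eq_toFinset_card', ← SimpleGraph.card_neighborFinset_eq_degree]
  rfl

theorem degree_mul_markov (f : V → ℝ) (x : V) :
    ((G.degree x : ℝ) + 1) * markov G f x = f x + ∑ y ∈ G.neighborFinset x, f y := by
  rw [markov, mul_div_cancel₀ _ (degree_add_one_pos x).ne']

theorem heat_succ (x₀ : V) (n : ℕ) : heat G x₀ (n + 1) = markov G (heat G x₀ n) := by
  rw [heat, heat, Function.iterate_succ_apply']

theorem transProb_eq_heat (n : ℕ) (x y : V) : transProb G n x y = heat G y n x := by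
  classical
  induction n generalizing x with
  | zero => simp [transProb, heat]
  | succ n ih =>
    rw [heat_succ, transProb, tsum_eq_sum (s := insert x (G.neighborFinset x)),
      Finset.sum_insert (by simp), markov, add_div, Finset.sum_div]
    · congr 1
      · simp [walkStep, ih, valency_eq_degree]
        ring
      · refine Finset.sum_congr rfl fun z hz => ?_
        rw [SimpleGraph.mem_neighborFinset] at hz
        simp [walkStep, ih, valency_eq_degree, hz]
        ring
    · intro z hz
      simp only [Finset.mem_insert, SimpleGraph.mem_neighborFinset, not_or] at hz
      rw [walkStep, if_neg, zero_mul]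
      rintro (h | h)
      · exact hz.1 h.symm
      · exact hz.2 h

theorem heat_nonneg (x₀ : V) (n : ℕ) (x : V) : 0 ≤ heat G x₀ n x := by
  classical
  induction n generalizing x with
  | zero => simp only [heat, Function.iterate_zero, id]; split_ifs <;> norm_num
  | succ n ih =>
    rw [heat_succ, markov]
    exact div_nonneg (add_nonneg (ih x) (Finset.sum_nonneg fun y _ => ih y))
      (degree_add_one_pos x).le

theorem NhdIn.markov {T : Finset V} {u : V → ℝ} (h : NhdIn G T u) {x : V} (hx : x ∉ T) :
    markov G u x = 0 := by
  have h1 : ∑ y ∈ G.neighborFinset x, u y = 0 := by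
    refine Finset.sum_eq_zero fun y hy => ?_
    by_contra h0
    exact hx ((h y h0).2 x ((SimpleGraph.mem_neighborFinset _ _ _).1 hy).symm)
  rw [_root_.markov, h1, h.eq_zero hx]
  simp

theorem exists_nhdIn_of_zero_off (S : Finset V) : ∃ T : Finset V, S ⊆ T ∧
    ∀ u : V → ℝ, (∀ x ∉ S, u x = 0) → NhdIn G T u := by
  classical
  refine ⟨S ∪ S.biUnion fun x => G.neighborFinset x, Finset.subset_union_left, fun u hu x hx => ?_⟩
  have hxS : x ∈ S := by
    by_contra h
    exact hx (hu x h)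
  refine ⟨Finset.mem_union_left _ hxS, fun y hy => Finset.mem_union_right _ ?_⟩
  exact Finset.mem_biUnion.2 ⟨x, hxS, (SimpleGraph.mem_neighborFinset _ _ _).2 hy⟩

/-- Finite propagation: up to time N, one finite set can replace V in every sum. -/
theorem exists_nhdIn_heat (x₀ : V) (N : ℕ) :
    ∃ T : Finset V, x₀ ∈ T ∧ ∀ n ≤ N, NhdIn G T (heat G x₀ n) := by
  classical
  induction N with
  | zero =>
    obtain ⟨T, hT, h⟩ := exists_nhdIn_of_zero_off (G := G) {x₀}
    refine ⟨T, hT (by simp), fun n hn => ?_⟩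
    obtain rfl : n = 0 := by omega
    exact h _ fun x hx => by simp at hx; simp [heat, hx]
  | succ N ih =>
    obtain ⟨S, hS, h⟩ := ih
    obtain ⟨T, hT, h'⟩ := exists_nhdIn_of_zero_off (G := G) S
    refine ⟨T, hT hS, fun n hn => ?_⟩
    rcases Nat.lt_or_ge N n with hn' | hn'
    · obtain rfl : n = N + 1 := by omega
      refine h' _ fun x hx => ?_
      rw [heat_succ]
      exact (h N le_rfl).markov hx
    · exact (h n hn').mono hT

theorem sum_neighbor_eq {T : Finset V} (F : V → V → ℝ)
    (hF : ∀ x ∈ T, ∀ y, G.Adj x y → y ∉ T → F x y = 0) [DecidableRel G.Adj] :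
    ∑ x ∈ T, ∑ y ∈ G.neighborFinset x, F x y =
      ∑ x ∈ T, ∑ y ∈ T, if G.Adj x y then F x y else 0 := by
  classical
  refine Finset.sum_congr rfl fun x hx => ?_
  rw [← Finset.sum_filter]
  symm
  refine Finset.sum_subset (fun y hy => ?_) fun y hy hy' => ?_
  · simpa using (Finset.mem_filter.1 hy).2
  · rw [SimpleGraph.mem_neighborFinset] at hy
    exact hF x hx y hy fun h => hy' (Finset.mem_filter.2 ⟨h, hy⟩)

/-- Edges that leave T contribute nothing on either side, so both are sums over ordered adjacent
pairs inside T. -/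
theorem sum_neighbor_swap {T : Finset V} (F : V → V → ℝ)
    (hF : ∀ x ∈ T, ∀ y, G.Adj x y → y ∉ T → F x y = 0)
    (hF' : ∀ x ∈ T, ∀ y, G.Adj x y → y ∉ T → F y x = 0) :
    ∑ x ∈ T, ∑ y ∈ G.neighborFinset x, F x y =
      ∑ x ∈ T, ∑ y ∈ G.neighborFinset x, F y x := by
  classical
  rw [sum_neighbor_eq F hF, sum_neighbor_eq (fun x y => F y x) hF', Finset.sum_comm]
  simp only [G.adj_comm]

/-- Reversibility: the walk is self-adjoint for the measure m(x) = deg x + 1. -/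
theorem sum_markov_mul {T : Finset V} {f g : V → ℝ} (hf : ∀ x ∉ T, f x = 0)
    (hg : ∀ x ∉ T, g x = 0) :
    ∑ x ∈ T, ((G.degree x : ℝ) + 1) * (markov G f x * g x) =
      ∑ x ∈ T, ((G.degree x : ℝ) + 1) * (f x * markov G g x) := by
  have h1 : ∀ x, ((G.degree x : ℝ) + 1) * (markov G f x * g x) =
      f x * g x + ∑ y ∈ G.neighborFinset x, f y * g x := fun x => by
    rw [← mul_assoc, degree_mul_markov, add_mul, Finset.sum_mul]
  have h2 : ∀ x, ((G.degree x : ℝ) + 1) * (f x * markov G g x) =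
      f x * g x + ∑ y ∈ G.neighborFinset x, f x * g y := fun x => by
    rw [mul_left_comm, degree_mul_markov, mul_add, Finset.mul_sum]
  simp only [h1, h2, Finset.sum_add_distrib]
  congr 1
  refine sum_neighbor_swap (fun x y => f y * g x) (fun x _ y _ hy => ?_) (fun x _ y _ hy => ?_)
  · simp [hf y hy]
  · simp [hg y hy]

/-- `∑ m h_a h_b = m(x₀) p_{a+b}(x₀, x₀)`. -/
theorem sum_heat_mul_heat (x₀ : V) {N : ℕ} {T : Finset V} (hx₀ : x₀ ∈ T)
    (hT : ∀ n ≤ N, NhdIn G T (heat G x₀ n)) (a b : ℕ) (hab : a + b ≤ N) :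
    ∑ x ∈ T, ((G.degree x : ℝ) + 1) * (heat G x₀ a x * heat G x₀ b x) =
      ((G.degree x₀ : ℝ) + 1) * heat G x₀ (a + b) x₀ := by
  classical
  induction a generalizing b with
  | zero =>
    rw [Finset.sum_eq_single_of_mem x₀ hx₀ fun x _ hx => by simp [heat, hx]]
    simp [heat]
  | succ a ih =>
    rw [heat_succ, sum_markov_mul (fun x hx => (hT a (by omega)).eq_zero hx)
      (fun x hx => (hT b (by omega)).eq_zero hx), ← heat_succ, ih (b + 1) (by omega)]
    congr 2
    omega

/-- Conservation of mass: the measure m is invariant. -/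
theorem sum_degree_mul_heat (x₀ : V) {N : ℕ} {T : Finset V} (hx₀ : x₀ ∈ T)
    (hT : ∀ n ≤ N, NhdIn G T (heat G x₀ n)) (n : ℕ) (hn : n ≤ N) :
    ∑ x ∈ T, ((G.degree x : ℝ) + 1) * heat G x₀ n x = (G.degree x₀ : ℝ) + 1 := by
  classical
  induction n with
  | zero =>
    rw [Finset.sum_eq_single_of_mem x₀ hx₀ fun x _ hx => by simp [heat, hx]]
    simp [heat]
  | succ n ih =>
    rw [← ih (by omega), heat_succ]
    have hz : ∀ x ∈ T, ∀ y, G.Adj x y → y ∉ T → heat G x₀ n x = 0 := fun x _ y hxy hy => by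
      by_contra h0
      exact hy ((hT n (by omega) x h0).2 y hxy)
    have := sum_neighbor_swap (G := G) (T := T) (fun x y => heat G x₀ n x) hz
      (fun x _ y _ hy => (hT n (by omega)).eq_zero hy)
    simp only [degree_mul_markov]
    rw [Finset.sum_add_distrib, ← this, ← Finset.sum_add_distrib]
    refine Finset.sum_congr rfl fun x _ => ?_
    simp
    ring

/-- One step of the walk dissipates the energy. -/
theorem dissipation {D : ℕ} (hD : ∀ x, G.degree x ≤ D) (hD1 : 1 ≤ D) {T : Finset V} {u : V → ℝ}
    (hT : NhdIn G T u) :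
    ∑ x ∈ T, ∑ y ∈ G.neighborFinset x, (u x - u y) ^ 2 ≤ 2 * D *
      (∑ x ∈ T, ((G.degree x : ℝ) + 1) * u x ^ 2 -
        ∑ x ∈ T, ((G.degree x : ℝ) + 1) * markov G u x ^ 2) := by
  have hz : ∀ x ∈ T, ∀ y, G.Adj x y → y ∉ T → u x = 0 := fun x _ y hxy hy => by
    by_contra h0
    exact hy ((hT x h0).2 y hxy)
  have hsw := sum_neighbor_swap (G := G) (T := T) (fun x _ => u x ^ 2)
    (fun x hx y hxy hy => by simp [hz x hx y hxy hy]) (fun x _ y _ hy => by simp [hT.eq_zero hy])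
  have h1 : ∑ x ∈ T, ((G.degree x : ℝ) + 1) * u x ^ 2 =
      ∑ x ∈ T, (u x ^ 2 + ∑ y ∈ G.neighborFinset x, u y ^ 2) := by
    rw [Finset.sum_add_distrib, ← hsw, ← Finset.sum_add_distrib]
    refine Finset.sum_congr rfl fun x _ => ?_
    simp; ring
  rw [h1, ← Finset.sum_sub_distrib, Finset.mul_sum]
  refine Finset.sum_le_sum fun x _ => ?_
  set μ := markov G u x with hμ
  have h2 := degree_mul_markov (G := G) u x
  rw [← hμ] at h2
  -- μ is the mean of u on the closed neighbourhood of x, so the local loss of energy is a variance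
  -- there, which controls the differences u x - u y.
  have hvar : u x ^ 2 + ∑ y ∈ G.neighborFinset x, u y ^ 2 - ((G.degree x : ℝ) + 1) * μ ^ 2 =
      (u x - μ) ^ 2 + ∑ y ∈ G.neighborFinset x, (u y - μ) ^ 2 := by
    have : ∀ y, (u y - μ) ^ 2 = u y ^ 2 - 2 * μ * u y + μ ^ 2 := fun y => by ring
    simp only [this, Finset.sum_add_distrib, Finset.sum_sub_distrib, ← Finset.mul_sum,
      Finset.sum_const, SimpleGraph.card_neighborFinset_eq_degree, nsmul_eq_mul]
    linear_combination (-2 * μ) * h2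
  rw [hvar]
  have hdeg : (G.degree x : ℝ) ≤ D := by exact_mod_cast hD x
  have hD1' : (1 : ℝ) ≤ D := by exact_mod_cast hD1
  calc ∑ y ∈ G.neighborFinset x, (u x - u y) ^ 2
      ≤ ∑ y ∈ G.neighborFinset x, (2 * (u x - μ) ^ 2 + 2 * (u y - μ) ^ 2) :=
        Finset.sum_le_sum fun y _ => by nlinarith [sq_nonneg (u x - μ + (u y - μ))]
    _ = 2 * ((G.degree x : ℝ) * (u x - μ) ^ 2) + 2 * ∑ y ∈ G.neighborFinset x, (u y - μ) ^ 2 := by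
        simp [Finset.sum_add_distrib, Finset.mul_sum]; ring
    _ ≤ 2 * D * ((u x - μ) ^ 2 + ∑ y ∈ G.neighborFinset x, (u y - μ) ^ 2) := by
        have h3 : 0 ≤ ∑ y ∈ G.neighborFinset x, (u y - μ) ^ 2 :=
          Finset.sum_nonneg fun y _ => sq_nonneg _
        nlinarith [mul_le_mul_of_nonneg_right hdeg (sq_nonneg (u x - μ)),
          mul_le_mul_of_nonneg_right hD1' h3]

open Classical in
/-- The size of the edge boundary, as a finite sum. -/
theorem ncard_edgeBoundary (U : Finset V) :
    (edgeBoundary G U).ncard = ∑ x ∈ U, ((G.neighborFinset x).filter (· ∉ U)).card := by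
  have : edgeBoundary G U =
      ((U.sigma fun x => (G.neighborFinset x).filter (· ∉ U)).image fun p => (p.1, p.2) :) := by
    ext ⟨x, y⟩
    simp [edgeBoundary]
    tauto
  rw [this, Set.ncard_coe_finset, Finset.card_image_of_injective, Finset.card_sigma]
  rintro ⟨a, b⟩ ⟨c, d⟩ h
  simp_all

/-- Peel off the lowest level: subtracting the minimum g x₀ on S lowers the left sum by g x₀ · |S|
and the right one by g x₀ · |∂S|, which the hypothesis for S compares. Afterwards x₀ has left the
support. -/
theorem coarea (K : ℝ) (S : Finset V) :
    (∀ U ⊆ S, (U.card : ℝ) ≤ K * (edgeBoundary G U).ncard) →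
    ∀ g : V → ℝ, (∀ x, 0 ≤ g x) → (∀ x ∉ S, g x = 0) →
    ∑ x ∈ S, g x ≤ K * ∑ x ∈ S, ∑ y ∈ G.neighborFinset x, max (g x - g y) 0 := by
  classical
  induction S using Finset.strongInduction with
  | H S ih =>
    intro hS g hg hgS
    rcases S.eq_empty_or_nonempty with rfl | hne
    · simp
    obtain ⟨x₀, hx₀, hmin⟩ := S.exists_min_image g hne
    set g' : V → ℝ := fun x => if x ∈ S then g x - g x₀ else 0 with hg'
    have hgx : g' x₀ = 0 := by simp [g']
    have h0 := ih (S.erase x₀) (Finset.erase_ssubset hx₀)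
      (fun U hU => hS U (hU.trans (Finset.erase_subset _ _))) g'
      (fun x => by
        simp only [g']; split_ifs with h
        · linarith [hmin x h]
        · rfl)
      (fun x hx => by
        by_cases h : x = x₀
        · rw [h, hgx]
        · have : x ∉ S := fun h' => hx (Finset.mem_erase.2 ⟨h, h'⟩)
          simp [g', this])
    rw [Finset.sum_erase _ hgx, Finset.sum_erase _ (by
      refine Finset.sum_eq_zero fun y _ => ?_
      rw [hgx]
      apply max_eq_right
      simp only [g']; split_ifs with h
      · linarith [hmin y h]
      · simp)] at h0
    have h1 : ∑ x ∈ S, g x = ∑ x ∈ S, g' x + g x₀ * S.card := by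
      rw [Finset.sum_congr rfl fun x hx => show g x = g' x + g x₀ by simp [g', hx]]
      simp [Finset.sum_add_distrib, mul_comm]
    have h2 : ∑ x ∈ S, ∑ y ∈ G.neighborFinset x, max (g x - g y) 0 =
        ∑ x ∈ S, ∑ y ∈ G.neighborFinset x, max (g' x - g' y) 0 +
          g x₀ * (edgeBoundary G S).ncard := by
      rw [ncard_edgeBoundary]
      push_cast
      rw [Finset.mul_sum, ← Finset.sum_add_distrib]
      refine Finset.sum_congr rfl fun x hx => ?_
      rw [Finset.card_filter]
      push_cast
      rw [Finset.mul_sum, ← Finset.sum_add_distrib]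
      refine Finset.sum_congr rfl fun y _ => ?_
      by_cases hy : y ∈ S
      · simp [g', hx, hy]
      · have := hmin x hx
        simp [g', hx, hy, hgS y hy, hg x, this]
    rw [h1, h2, mul_add]
    have h3 := mul_le_mul_of_nonneg_left (hS S subset_rfl) (hg x₀)
    linarith

/-- Cheeger's inequality for functions supported in a finite set. -/
theorem cheeger {D : ℕ} (hD : ∀ x, G.degree x ≤ D) {K : ℝ} (hK : 0 ≤ K) {S T : Finset V}
    (hST : S ⊆ T)
    (hS : ∀ U ⊆ S, (U.card : ℝ) ≤ K * (edgeBoundary G U).ncard) {v : V → ℝ}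
    (hv : ∀ x, 0 ≤ v x) (hvS : ∀ x ∉ S, v x = 0) (hvT : NhdIn G T v) :
    ∑ x ∈ T, v x ^ 2 ≤ 4 * D * K ^ 2 * ∑ x ∈ T, ∑ y ∈ G.neighborFinset x, (v x - v y) ^ 2 := by
  classical
  set N := ∑ x ∈ T, v x ^ 2 with hN
  set E := ∑ x ∈ T, ∑ y ∈ G.neighborFinset x, (v x - v y) ^ 2 with hE
  have hN0 : 0 ≤ N := Finset.sum_nonneg fun x _ => sq_nonneg _
  have hE0 : 0 ≤ E := Finset.sum_nonneg fun x _ => Finset.sum_nonneg fun y _ => sq_nonneg _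
  have h1 := coarea K S hS (fun x => v x ^ 2) (fun x => sq_nonneg _)
    (fun x hx => by simp [hvS x hx])
  have h2 : N = ∑ x ∈ S, v x ^ 2 := (Finset.sum_subset hST fun x _ hx => by simp [hvS x hx]).symm
  rw [← h2] at h1
  have h3 : ∑ x ∈ S, ∑ y ∈ G.neighborFinset x, max (v x ^ 2 - v y ^ 2) 0 ≤
      ∑ p ∈ T.sigma fun x => G.neighborFinset x, |v p.1 - v p.2| * (v p.1 + v p.2) := by
    rw [Finset.sum_sigma]
    refine (Finset.sum_le_sum_of_subset_of_nonneg hST fun x _ _ =>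
      Finset.sum_nonneg fun y _ => le_max_right _ _).trans ?_
    refine Finset.sum_le_sum fun x _ => Finset.sum_le_sum fun y _ => max_le ?_ ?_
    · rw [show v x ^ 2 - v y ^ 2 = (v x - v y) * (v x + v y) by ring]
      exact mul_le_mul_of_nonneg_right (le_abs_self _) (add_nonneg (hv x) (hv y))
    · exact mul_nonneg (abs_nonneg _) (add_nonneg (hv x) (hv y))
  -- Cauchy–Schwarz separates the two factors of v x² - v y²: the differences give E, the sums at
  -- most 4DN.
  have h4 := Finset.sum_mul_sq_le_sq_mul_sq (T.sigma fun x => G.neighborFinset x)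
    (fun p => |v p.1 - v p.2|) (fun p => v p.1 + v p.2)
  have h5 : ∑ p ∈ T.sigma fun x => G.neighborFinset x, |v p.1 - v p.2| ^ 2 = E := by
    rw [Finset.sum_sigma]
    simp [hE, sq_abs]
  have h6 : ∑ p ∈ T.sigma fun x => G.neighborFinset x, (v p.1 + v p.2) ^ 2 ≤ 4 * D * N := by
    rw [Finset.sum_sigma]
    have hz : ∀ x ∈ T, ∀ y, G.Adj x y → y ∉ T → v x = 0 := fun x _ y hxy hy => by
      by_contra h0
      exact hy ((hvT x h0).2 y hxy)
    have hsw := sum_neighbor_swap (G := G) (T := T) (fun x _ => v x ^ 2)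
      (fun x hx y hxy hy => by simp [hz x hx y hxy hy])
      (fun x _ y _ hy => by simp [hvT.eq_zero hy])
    calc _ ≤ ∑ x ∈ T, ∑ y ∈ G.neighborFinset x, (2 * v x ^ 2 + 2 * v y ^ 2) :=
          Finset.sum_le_sum fun x _ => Finset.sum_le_sum fun y _ => by
            nlinarith [sq_nonneg (v x - v y)]
      _ = 4 * ∑ x ∈ T, (G.degree x : ℝ) * v x ^ 2 := by
          simp only [Finset.sum_add_distrib, ← Finset.mul_sum]
          rw [← hsw]
          simp
          ring
      _ ≤ 4 * (D * N) := by
          rw [hN, Finset.mul_sum T _ (D : ℝ)]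
          refine mul_le_mul_of_nonneg_left (Finset.sum_le_sum fun x _ => ?_) (by norm_num)
          exact mul_le_mul_of_nonneg_right (by exact_mod_cast hD x) (sq_nonneg _)
      _ = _ := by ring
  set X := ∑ p ∈ T.sigma fun x => G.neighborFinset x, |v p.1 - v p.2| * (v p.1 + v p.2)
  have h7 : N ≤ K * X := h1.trans (mul_le_mul_of_nonneg_left h3 hK)
  rw [h5] at h4
  have h8 : N ^ 2 ≤ K ^ 2 * (E * (4 * D * N)) := by
    calc N ^ 2 ≤ (K * X) ^ 2 := by gcongr
      _ = K ^ 2 * X ^ 2 := by ring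
      _ ≤ K ^ 2 * (E * (4 * D * N)) := by
        refine mul_le_mul_of_nonneg_left (h4.trans ?_) (sq_nonneg _)
        exact mul_le_mul_of_nonneg_left h6 hE0
  rcases hN0.eq_or_lt with h | h
  · rw [← h]; positivity
  · have : N * N ≤ (4 * D * K ^ 2 * E) * N := by linarith
    exact le_of_mul_le_mul_right this h

/-- As long as it is not too small, the return probability decays exponentially. -/
theorem heat_two_mul_step {D : ℕ} (hD : ∀ x, G.degree x ≤ D) (hD1 : 1 ≤ D) {K A : ℝ} (hK : 0 < K)
    (hA : 0 < A)
    (hiso : ∀ U : Finset V, (U.card : ℝ) < A → (U.card : ℝ) ≤ K * (edgeBoundary G U).ncard)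
    (x₀ : V) {N : ℕ} {T : Finset V} (hx₀ : x₀ ∈ T) (hT : ∀ n ≤ N, NhdIn G T (heat G x₀ n))
    (n : ℕ) (hn : n + 1 ≤ N)
    (hbig : 4 * (D + 1) ^ 2 / A < ∑ x ∈ T, ((G.degree x : ℝ) + 1) * heat G x₀ n x ^ 2) :
    ∑ x ∈ T, ((G.degree x : ℝ) + 1) * heat G x₀ (n + 1) x ^ 2 ≤
      (1 - 1 / (16 * D ^ 2 * (D + 1)) / K ^ 2) *
        ∑ x ∈ T, ((G.degree x : ℝ) + 1) * heat G x₀ n x ^ 2 := by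
  classical
  set u := heat G x₀ n with hu
  set E := ∑ x ∈ T, ((G.degree x : ℝ) + 1) * u x ^ 2 with hE
  set m₀ : ℝ := (G.degree x₀ : ℝ) + 1 with hm₀
  have hm₀1 : 1 ≤ m₀ := by rw [hm₀]; linarith [(Nat.cast_nonneg (G.degree x₀) : (0 : ℝ) ≤ _)]
  have hm₀D : m₀ ≤ D + 1 := by
    rw [hm₀]
    have : (G.degree x₀ : ℝ) ≤ D := by exact_mod_cast hD x₀
    linarith
  have hD0 : (1 : ℝ) ≤ D := by exact_mod_cast hD1
  have hE0 : 0 < E := lt_trans (by positivity) hbig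
  have hmass := sum_degree_mul_heat x₀ hx₀ hT n (by omega)
  rw [← hu, ← hm₀] at hmass
  have hTu := hT n (by omega)
  rw [← hu] at hTu
  have hu0 : ∀ x, 0 ≤ u x := heat_nonneg x₀ n
  -- The total mass is m₀. Truncating at this height loses at most 2tm₀ = E/2 of the energy, while
  -- {u > t} has at most m₀/t = 4m₀²/E < A points, so that isoperimetry applies to its subsets.
  set t : ℝ := E / (4 * m₀) with ht
  have ht0 : 0 < t := by positivity
  set v : V → ℝ := fun x => max (u x - t) 0 with hv
  set S := T.filter fun x => t < u x with hS
  have hScard : (S.card : ℝ) < A := by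
    have h1 : (S.card : ℝ) * t ≤ m₀ := by
      rw [← hmass, ← nsmul_eq_mul]
      calc S.card • t ≤ ∑ x ∈ S, u x :=
            Finset.card_nsmul_le_sum _ _ _ fun x hx => (Finset.mem_filter.1 hx).2.le
        _ ≤ ∑ x ∈ T, u x :=
            Finset.sum_le_sum_of_subset_of_nonneg (Finset.filter_subset _ _) fun x _ _ => hu0 x
        _ ≤ _ := Finset.sum_le_sum fun x _ => by
            have := mul_nonneg (Nat.cast_nonneg (G.degree x) : (0 : ℝ) ≤ _) (hu0 x)
            linarith
    have h2 : (S.card : ℝ) * E ≤ 4 * (D + 1) ^ 2 := by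
      have : (S.card : ℝ) * E = (S.card : ℝ) * t * (4 * m₀) := by
        rw [ht]; field_simp
      rw [this]
      calc (S.card : ℝ) * t * (4 * m₀) ≤ m₀ * (4 * m₀) := by gcongr
        _ = 4 * m₀ ^ 2 := by ring
        _ ≤ _ := by gcongr
    rw [div_lt_iff₀ hA] at hbig
    by_contra hcon
    push Not at hcon
    nlinarith [mul_le_mul_of_nonneg_left hcon hE0.le]
  have hvS : ∀ x ∉ S, v x = 0 := fun x hx => by
    simp only [hv]
    apply max_eq_right
    by_contra hcon
    push Not at hcon
    have h1 : x ∈ T := (hTu x (by linarith)).1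
    exact hx (Finset.mem_filter.2 ⟨h1, by linarith⟩)
  have hvT : NhdIn G T v := fun x hx => hTu x fun h0 => hx (by simp [hv, h0, ht0.le])
  have h3 := cheeger hD hK.le (Finset.filter_subset _ _ : S ⊆ T)
    (fun U hU => hiso U (lt_of_le_of_lt (by exact_mod_cast Finset.card_le_card hU) hScard))
    (fun x => le_max_right _ _) hvS hvT
  have h4 : ∑ x ∈ T, ∑ y ∈ G.neighborFinset x, (v x - v y) ^ 2 ≤
      ∑ x ∈ T, ∑ y ∈ G.neighborFinset x, (u x - u y) ^ 2 :=
    Finset.sum_le_sum fun x _ => Finset.sum_le_sum fun y _ => by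
      rw [sq_le_sq]
      refine (abs_max_sub_max_le_abs _ _ _).trans_eq ?_
      congr 1; ring
  have h5 := dissipation hD hD1 hTu
  rw [← hE] at h5
  have h6 : E ≤ ∑ x ∈ T, ((G.degree x : ℝ) + 1) * v x ^ 2 + E / 2 := by
    have : E / 2 = 2 * t * m₀ := by rw [ht]; field_simp; ring
    rw [this, ← hmass, Finset.mul_sum, ← Finset.sum_add_distrib]
    refine Finset.sum_le_sum fun x _ => ?_
    have h7 : u x ^ 2 ≤ v x ^ 2 + 2 * t * u x := by
      rcases le_total (u x) t with h | h
      · nlinarith [sq_nonneg (v x), hu0 x]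
      · have : v x = u x - t := max_eq_left (by linarith)
        rw [this]; nlinarith
    nlinarith [mul_le_mul_of_nonneg_left h7 (degree_add_one_pos (G := G) x).le]
  have h7 : ∑ x ∈ T, ((G.degree x : ℝ) + 1) * v x ^ 2 ≤ (D + 1) * ∑ x ∈ T, v x ^ 2 := by
    rw [Finset.mul_sum]
    refine Finset.sum_le_sum fun x _ => mul_le_mul_of_nonneg_right ?_ (sq_nonneg _)
    have : (G.degree x : ℝ) ≤ D := by exact_mod_cast hD x
    linarith
  rw [heat_succ, ← hu]
  set E' := ∑ x ∈ T, ((G.degree x : ℝ) + 1) * markov G u x ^ 2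
  have h8 : E / 2 ≤ (D + 1) * (4 * D * K ^ 2 * (2 * D * (E - E'))) := by
    have h9 : ∑ x ∈ T, v x ^ 2 ≤ 4 * D * K ^ 2 * (2 * D * (E - E')) :=
      h3.trans (mul_le_mul_of_nonneg_left (h4.trans h5) (by positivity))
    have := mul_le_mul_of_nonneg_left h9 (by positivity : (0 : ℝ) ≤ D + 1)
    linarith
  have h9 : 1 / (16 * D ^ 2 * (D + 1)) / K ^ 2 * E ≤ E - E' := by
    rw [div_div, one_div_mul_eq_div, div_le_iff₀ (by positivity)]
    nlinarith
  linarith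

theorem sum_markov_sq_le {T : Finset V} {u : V → ℝ} {D : ℕ} (hD : ∀ x, G.degree x ≤ D)
    (hD1 : 1 ≤ D) (hT : NhdIn G T u) :
    ∑ x ∈ T, ((G.degree x : ℝ) + 1) * markov G u x ^ 2 ≤
      ∑ x ∈ T, ((G.degree x : ℝ) + 1) * u x ^ 2 := by
  have h := dissipation hD hD1 hT
  have h0 : 0 ≤ ∑ x ∈ T, ∑ y ∈ G.neighborFinset x, (u x - u y) ^ 2 :=
    Finset.sum_nonneg fun x _ => Finset.sum_nonneg fun y _ => sq_nonneg _
  have hD0 : (0 : ℝ) < 2 * D := by positivity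
  nlinarith [nonneg_of_mul_nonneg_right (h0.trans h) hD0]

/-- Return probabilities decay according to the isoperimetric profile. -/
theorem heat_le_of_isoperimetry {D : ℕ} (hD : ∀ x, G.degree x ≤ D) (hD1 : 1 ≤ D) {K A : ℝ}
    (hK : 1 ≤ K) (hA : 0 < A)
    (hiso : ∀ U : Finset V, (U.card : ℝ) < A → (U.card : ℝ) ≤ K * (edgeBoundary G U).ncard)
    (x₀ : V) (n : ℕ) :
    heat G x₀ n x₀ ≤ max (4 * (D + 1) ^ 2 / A)
      ((D + 1) * Real.exp (-(1 / (16 * D ^ 2 * (D + 1)) / K ^ 2 * (n / 2 : ℕ)))) := by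
  obtain ⟨T, hx₀, hT⟩ := exists_nhdIn_heat (G := G) x₀ (n + 2)
  set c : ℝ := 1 / (16 * D ^ 2 * (D + 1)) / K ^ 2 with hc
  have hD0 : (1 : ℝ) ≤ D := by exact_mod_cast hD1
  have hm₀D : (G.degree x₀ : ℝ) + 1 ≤ D + 1 := by
    have : (G.degree x₀ : ℝ) ≤ D := by exact_mod_cast hD x₀
    linarith
  have hc1 : c ≤ 1 := by
    rw [hc, div_div, div_le_one (by positivity)]
    have : (1 : ℝ) * 1 ≤ (16 * D ^ 2 * (D + 1)) * K ^ 2 := by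
      gcongr
      · nlinarith
      · exact one_le_pow₀ hK
    linarith
  have hc0 : 0 < c := by positivity
  -- The energy never increases. Either it has reached the threshold and stays below it, or it has
  -- shrunk by the factor 1 - c at every step so far.
  have key : ∀ j ≤ n + 1, ∑ x ∈ T, ((G.degree x : ℝ) + 1) * heat G x₀ j x ^ 2 ≤
      max (4 * (D + 1) ^ 2 / A) ((D + 1) * Real.exp (-(c * j))) := by
    intro j
    induction j with
    | zero =>
      intro _
      have := sum_heat_mul_heat x₀ hx₀ hT 0 0 (by omega)
      simp only [← pow_two] at this
      rw [this]
      refine le_max_of_le_right ?_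
      simpa [heat] using hm₀D
    | succ j ih =>
      intro hj
      have hmono := sum_markov_sq_le hD hD1 (hT j (by omega))
      rw [← heat_succ] at hmono
      rcases le_or_gt (∑ x ∈ T, ((G.degree x : ℝ) + 1) * heat G x₀ j x ^ 2)
        (4 * (D + 1) ^ 2 / A) with h | h
      · exact le_max_of_le_left (hmono.trans h)
      · have hstep := heat_two_mul_step hD hD1 (by linarith) hA hiso x₀ hx₀ hT j (by omega) h
        have h1 : ∑ x ∈ T, ((G.degree x : ℝ) + 1) * heat G x₀ j x ^ 2 ≤
            (D + 1) * Real.exp (-(c * j)) := by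
          rcases le_max_iff.1 (ih (by omega)) with h' | h'
          · exact absurd h' (not_le.2 h)
          · exact h'
        refine le_max_of_le_right (hstep.trans ?_)
        have h2 : 1 - c ≤ Real.exp (-c) := by linarith [Real.add_one_le_exp (-c)]
        calc (1 - c) * ∑ x ∈ T, ((G.degree x : ℝ) + 1) * heat G x₀ j x ^ 2
            ≤ Real.exp (-c) * ((D + 1) * Real.exp (-(c * j))) := by
              gcongr
          _ = (D + 1) * Real.exp (-(c * (j + 1 : ℕ))) := by
              rw [mul_left_comm, ← Real.exp_add]
              congr 2
              push_cast
              ring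
  refine le_trans ?_ (key (n / 2) (by omega))
  set j := n / 2 with hj
  have hm₀1 : (1 : ℝ) ≤ (G.degree x₀ : ℝ) + 1 := by
    linarith [(Nat.cast_nonneg (G.degree x₀) : (0 : ℝ) ≤ _)]
  have hstep : heat G x₀ n x₀ ≤ ((G.degree x₀ : ℝ) + 1) * heat G x₀ n x₀ := by
    nlinarith [heat_nonneg (G := G) x₀ n x₀]
  refine hstep.trans ?_
  rcases Nat.even_or_odd' n with ⟨i, hi | hi⟩
  · obtain rfl : i = j := by omega
    have := sum_heat_mul_heat x₀ hx₀ hT j j (by omega)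
    rw [show n = j + j by omega, ← this]
    simp [pow_two]
  · obtain rfl : i = j := by omega
    -- At odd times the return probability is a mixed product, bounded by the mean of the energies
    -- at j and j + 1.
    have := sum_heat_mul_heat x₀ hx₀ hT j (j + 1) (by omega)
    rw [show n = j + (j + 1) by omega, ← this]
    have hmono := sum_markov_sq_le hD hD1 (hT j (by omega))
    rw [← heat_succ] at hmono
    have : ∑ x ∈ T, ((G.degree x : ℝ) + 1) * (heat G x₀ j x * heat G x₀ (j + 1) x) ≤
        ∑ x ∈ T, (((G.degree x : ℝ) + 1) * heat G x₀ j x ^ 2 / 2 +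
          ((G.degree x : ℝ) + 1) * heat G x₀ (j + 1) x ^ 2 / 2) :=
      Finset.sum_le_sum fun x _ => by
        nlinarith [mul_nonneg (degree_add_one_pos (G := G) x).le
          (sq_nonneg (heat G x₀ j x - heat G x₀ (j + 1) x))]
    rw [Finset.sum_add_distrib, ← Finset.sum_div, ← Finset.sum_div] at this
    linarith

end Markov

/-! ### Constants in the relation ≼, and the upper bound on return probabilities -/

section Asymptotics

theorem exists_nat_rpow_ge {β : ℝ} (hβ : 0 < β) (c : ℝ) : ∃ M : ℕ, 0 < M ∧ c ≤ (M : ℝ) ^ β := by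
  have h := ((tendsto_rpow_atTop hβ).comp tendsto_natCast_atTop_atTop).eventually_ge_atTop c
  obtain ⟨M, h1, h2⟩ := (h.and (Filter.eventually_gt_atTop 0)).exists
  exact ⟨M, h2, h1⟩

/-- A constant in the exponent becomes a rescaling of k. An integral scale M makes the floor in
`Dominated` exact. -/
theorem dominated_profileF {α β : ℝ} (hβ : 0 < β) (hαβ : β = 2 * α / (1 - α)) {a : ℕ → ℝ}
    {C c : ℝ} (hC : 0 < C) (h : ∀ k : ℕ, a k ≤ C * Real.exp (c * (k : ℝ) ^ β)) :
    Dominated a fun k => profileF α (k : ℝ) := by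
  obtain ⟨M, hM, hM'⟩ := exists_nat_rpow_ge hβ c
  refine ⟨C, hC, M, by exact_mod_cast hM, fun k => (h k).trans ?_⟩
  have : ⌊(M : ℝ) * (k : ℝ)⌋₊ = M * k := by exact_mod_cast Nat.floor_natCast (M * k)
  beta_reduce
  rw [this, profileF, ← hαβ]
  push_cast
  rw [Real.mul_rpow (by positivity) (by positivity)]
  gcongr

theorem profileF_dominated {α β : ℝ} (hβ : 0 < β) (hαβ : β = 2 * α / (1 - α)) {a : ℕ → ℝ}
    {C c : ℝ} (hC : 0 < C) (hc : 0 < c) (h : ∀ k : ℕ, C * Real.exp (c * (k : ℝ) ^ β) ≤ a k) :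
    Dominated (fun k => profileF α (k : ℝ)) a := by
  obtain ⟨M, hM, hM'⟩ := exists_nat_rpow_ge hβ (1 / c)
  refine ⟨1 / C, by positivity, M, by exact_mod_cast hM, fun k => ?_⟩
  have : ⌊(M : ℝ) * (k : ℝ)⌋₊ = M * k := by exact_mod_cast Nat.floor_natCast (M * k)
  beta_reduce
  rw [this, profileF, ← hαβ, one_div_mul_eq_div, le_div_iff₀ hC]
  refine le_trans ?_ (h (M * k))
  push_cast
  rw [Real.mul_rpow (by positivity) (by positivity), mul_comm, ← mul_assoc]
  rw [div_le_iff₀ hc] at hM'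
  gcongr
  nlinarith [Real.rpow_nonneg (Nat.cast_nonneg k : (0 : ℝ) ≤ k) β]

/-- The comparison function decreases, so rounding the index down only helps and a real scale is
enough. -/
theorem dominated_exp_neg {α : ℝ} (hα : 0 < α) {a : ℕ → ℝ} {C c : ℝ} (hC : 0 < C) (hc : 0 < c)
    (h : ∀ n : ℕ, a n ≤ C * Real.exp (-(c * (n : ℝ) ^ α))) :
    Dominated a fun n => Real.exp (-((n : ℝ) ^ α)) := by
  refine ⟨C, hC, c ^ (1 / α), by positivity, fun n => (h n).trans ?_⟩
  beta_reduce
  gcongr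
  calc ((⌊c ^ (1 / α) * (n : ℝ)⌋₊ : ℕ) : ℝ) ^ α ≤ (c ^ (1 / α) * (n : ℝ)) ^ α := by
        gcongr
        exact Nat.floor_le (by positivity)
    _ = c * (n : ℝ) ^ α := by
        rw [Real.mul_rpow (by positivity) (by positivity), ← Real.rpow_mul hc.le,
          one_div_mul_cancel hα.ne', Real.rpow_one]

theorem exp_neg_dominated {α : ℝ} (hα : 0 < α) {a : ℕ → ℝ} {C c : ℝ} (hC : 0 < C) (hc : 0 < c)
    (h : ∀ n : ℕ, C * Real.exp (-(c * (n : ℝ) ^ α)) ≤ a n) :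
    Dominated (fun n => Real.exp (-((n : ℝ) ^ α))) a := by
  refine ⟨1 / C, by positivity, (1 / c) ^ (1 / α), by positivity, fun n => ?_⟩
  rw [one_div_mul_eq_div, le_div_iff₀ hC, mul_comm]
  refine le_trans ?_ (h _)
  beta_reduce
  gcongr
  calc c * ((⌊(1 / c) ^ (1 / α) * (n : ℝ)⌋₊ : ℕ) : ℝ) ^ α
      ≤ c * ((1 / c) ^ (1 / α) * (n : ℝ)) ^ α := by
        gcongr
        exact Nat.floor_le (by positivity)
    _ = (n : ℝ) ^ α := by
        rw [Real.mul_rpow (by positivity) (by positivity), ← Real.rpow_mul (by positivity),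
          one_div_mul_cancel hα.ne', Real.rpow_one, ← mul_assoc, mul_one_div_cancel hc.ne', one_mul]

/-- The isoperimetric inequality which corresponds to a Følner function `≽ exp (k ^ β)`. -/
def ExpIsoperimetry {V : Type} (G : SimpleGraph V) (β : ℝ) : Prop :=
  ∃ c : ℝ, 0 < c ∧ ∀ (k : ℕ) (U : Finset V), U.Nonempty → k * (edgeBoundary G U).ncard ≤ U.card →
    c * Real.exp (c * (k : ℝ) ^ β) ≤ U.card

theorem ExpIsoperimetry.profileF_dominated_folner {V : Type} {G : SimpleGraph V} {α β : ℝ}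
    (hβ : 0 < β) (hαβ : β = 2 * α / (1 - α)) (h : ExpIsoperimetry G β)
    (hne : ∀ k, (folnerSets G k).Nonempty) :
    Dominated (fun k => profileF α (k : ℝ)) fun k => (folner G k : ℝ) := by
  obtain ⟨c, hc, h⟩ := h
  refine profileF_dominated hβ hαβ hc hc fun k => ?_
  obtain ⟨U, hU, hU'⟩ := Nat.sInf_mem ((hne k).image Finset.card)
  rw [folner, ← hU']
  exact h k U hU.1 hU.2

/-- With k ≈ n^((1-α)/2), both terms of `heat_le_of_isoperimetry` have exponent of order -n^α,
because k^β ≈ n^α and n/k² ≈ n^α. -/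
theorem ExpIsoperimetry.transProb_dominated {V : Type} {G : SimpleGraph V} [G.LocallyFinite]
    {D : ℕ} (hD : ∀ x, G.degree x ≤ D) (hD1 : 1 ≤ D) {α β : ℝ} (hα : 0 < α) (hα1 : α < 1)
    (hαβ : β = 2 * α / (1 - α)) (h : ExpIsoperimetry G β) (x₀ : V) :
    Dominated (fun n => transProb G n x₀ x₀) fun n => Real.exp (-((n : ℝ) ^ α)) := by
  obtain ⟨c, hc, h⟩ := h
  have hα1' : 0 < 1 - α := by linarith
  set d : ℝ := 1 / (16 * D ^ 2 * (D + 1)) with hd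
  have hd0 : 0 < d := by positivity
  have hβ : 0 < β := by rw [hαβ]; positivity
  refine dominated_exp_neg hα (C := max (4 * (D + 1) ^ 2 / c) ((D + 1) * Real.exp d))
    (c := min c (d / 8)) (lt_max_of_lt_left (by positivity)) (by positivity) fun n => ?_
  rw [transProb_eq_heat]
  rcases Nat.eq_zero_or_pos n with rfl | hn
  · simp only [heat, Function.iterate_zero, id, if_true, Nat.cast_zero, Real.zero_rpow hα.ne',
      mul_zero, neg_zero, Real.exp_zero, mul_one]
    refine le_max_of_le_right ?_
    have : 1 ≤ Real.exp d := Real.one_le_exp hd0.le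
    nlinarith [(Nat.cast_nonneg D : (0 : ℝ) ≤ D)]
  have hn1 : (1 : ℝ) ≤ n := by exact_mod_cast hn
  set s : ℝ := (n : ℝ) ^ ((1 - α) / 2) with hs
  have hs1 : 1 ≤ s := Real.one_le_rpow hn1 (by positivity)
  set k : ℕ := ⌈s⌉₊ with hk
  have hk1 : s ≤ k := Nat.le_ceil s
  have hk2 : (k : ℝ) ≤ 2 * s := by linarith [Nat.ceil_lt_add_one (by linarith : 0 ≤ s)]
  have hiso : ∀ U : Finset V, (U.card : ℝ) < c * Real.exp (c * (k : ℝ) ^ β) →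
      (U.card : ℝ) ≤ k * (edgeBoundary G U).ncard := by
    intro U hU
    rcases U.eq_empty_or_nonempty with rfl | hne
    · simpa using mul_nonneg (Nat.cast_nonneg k) (Nat.cast_nonneg _)
    · by_contra hcon
      push Not at hcon
      exact absurd (h k U hne (by exact_mod_cast hcon.le)) (not_le.2 hU)
  have hmain := heat_le_of_isoperimetry hD hD1 (hs1.trans hk1) (by positivity) hiso x₀ n
  refine hmain.trans (max_le ?_ ?_)
  · have h1 : (n : ℝ) ^ α ≤ (k : ℝ) ^ β := by
      calc (n : ℝ) ^ α = s ^ β := by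
            rw [hs, ← Real.rpow_mul (by positivity)]
            congr 1
            rw [hαβ]
            field_simp
        _ ≤ _ := by gcongr
    calc 4 * (D + 1) ^ 2 / (c * Real.exp (c * (k : ℝ) ^ β))
        = 4 * (D + 1) ^ 2 / c * Real.exp (-(c * (k : ℝ) ^ β)) := by
          rw [Real.exp_neg]; field_simp
      _ ≤ _ := by
          gcongr
          · exact le_max_left _ _
          · exact min_le_left _ _
  · have hs2 : s ^ 2 * (n : ℝ) ^ α = n := by
      rw [hs, ← Real.rpow_natCast, ← Real.rpow_mul (by positivity), ← Real.rpow_add (by positivity)]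
      simp
    have h2 : ((n / 2 : ℕ) : ℝ) ≥ n / 2 - 1 / 2 := by
      have : n ≤ 2 * (n / 2) + 1 := by omega
      have : (n : ℝ) ≤ 2 * ((n / 2 : ℕ) : ℝ) + 1 := by exact_mod_cast this
      linarith
    -- The 8 comes from k² ≤ 4s² and from halving n; the term -d pays for rounding n/2 down.
    have h3 : d / 8 * (n : ℝ) ^ α - d ≤ d / (k : ℝ) ^ 2 * (n / 2 : ℕ) := by
      have hk0 : (1 : ℝ) ≤ k := hs1.trans hk1
      have h4 : (k : ℝ) ^ 2 ≤ 4 * s ^ 2 := by nlinarith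
      rw [div_mul_eq_mul_div d ((k : ℝ) ^ 2), le_div_iff₀ (by positivity)]
      have h5 : (n : ℝ) ^ α * (k : ℝ) ^ 2 ≤ 4 * (n : ℝ) := by
        calc (n : ℝ) ^ α * (k : ℝ) ^ 2 ≤ (n : ℝ) ^ α * (4 * s ^ 2) := by gcongr
          _ = 4 * (n : ℝ) := by linear_combination 4 * hs2
      have h6 : (1 : ℝ) ≤ (k : ℝ) ^ 2 := one_le_pow₀ hk0
      have h7 : (n : ℝ) ^ α * (k : ℝ) ^ 2 / 8 - (k : ℝ) ^ 2 ≤ ((n / 2 : ℕ) : ℝ) := by linarith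
      nlinarith [mul_le_mul_of_nonneg_left h7 hd0.le]
    calc (D + 1) * Real.exp (-(d / (k : ℝ) ^ 2 * (n / 2 : ℕ)))
        ≤ (D + 1) * Real.exp (d + -(d / 8 * (n : ℝ) ^ α)) := by
          gcongr
          linarith
      _ = (D + 1) * Real.exp d * Real.exp (-(d / 8 * (n : ℝ) ^ α)) := by
          rw [Real.exp_add, mul_assoc]
      _ ≤ _ := by
          gcongr
          · exact le_max_right _ _
          · exact min_le_right _ _

end Asymptotics

/-! ### Lower bounds on return probabilities from test functions -/

section ReturnLower

variable {V : Type} {G : SimpleGraph V} [G.LocallyFinite]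

/-- By self-adjointness the m-weighted pairing of the heat kernel with ψ decreases by at most the
factor l per step. Cauchy–Schwarz against ∑ mψ² ≤ (D+1)|U| then bounds p_{2j} from below. -/
theorem heat_ge_of_subharmonic {D : ℕ} (hD : ∀ x, G.degree x ≤ D) {U : Finset V} {ψ : V → ℝ}
    {x₀ : V} {l : ℝ} (hl0 : 0 ≤ l) (hl1 : l ≤ 1) (hψ0 : ∀ x, 0 ≤ ψ x) (hψ1 : ∀ x, ψ x ≤ 1)
    (hψU : ∀ x ∉ U, ψ x = 0) (hx₀ : ψ x₀ = 1) (hψ : ∀ x ∈ U, l * ψ x ≤ markov G ψ x) (n : ℕ) :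
    l ^ n / ((D + 1) ^ 2 * U.card) ≤ heat G x₀ n x₀ := by
  classical
  have hpos : ∀ x, 0 ≤ markov G ψ x := fun x =>
    div_nonneg (add_nonneg (hψ0 x) (Finset.sum_nonneg fun y _ => hψ0 y)) (degree_add_one_pos x).le
  have hψ' : ∀ x, l * ψ x ≤ markov G ψ x := fun x => by
    by_cases hx : x ∈ U
    · exact hψ x hx
    · rw [hψU x hx, mul_zero]; exact hpos x
  have hUpos : 0 < U.card := by
    refine Finset.card_pos.2 ⟨x₀, ?_⟩
    by_contra h
    rw [hψU x₀ h] at hx₀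
    norm_num at hx₀
  have hdeg : ∀ x, (G.degree x : ℝ) + 1 ≤ D + 1 := fun x => by
    have : (G.degree x : ℝ) ≤ D := by exact_mod_cast hD x
    linarith
  have hm₀ : (1 : ℝ) ≤ (G.degree x₀ : ℝ) + 1 := by
    linarith [(Nat.cast_nonneg (G.degree x₀) : (0 : ℝ) ≤ _)]
  have hD0 : (0 : ℝ) ≤ D := Nat.cast_nonneg D
  have even : ∀ j, l ^ (2 * j) / ((D + 1) * U.card) ≤ heat G x₀ (2 * j) x₀ := by
    intro j
    obtain ⟨T₀, hx₀T, hT₀⟩ := exists_nhdIn_heat (G := G) x₀ (2 * j)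
    set T := T₀ ∪ U with hTdef
    have hx₀T : x₀ ∈ T := Finset.mem_union_left _ hx₀T
    have hT : ∀ n ≤ 2 * j, NhdIn G T (heat G x₀ n) := fun n hn =>
      (hT₀ n hn).mono Finset.subset_union_left
    have hψT : ∀ x ∉ T, ψ x = 0 := fun x hx => hψU x fun h => hx (Finset.mem_union_right _ h)
    have key : ∀ i ≤ 2 * j, ((G.degree x₀ : ℝ) + 1) * l ^ i ≤
        ∑ x ∈ T, ((G.degree x : ℝ) + 1) * (heat G x₀ i x * ψ x) := by
      intro i
      induction i with
      | zero =>
        intro _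
        rw [Finset.sum_eq_single_of_mem x₀ hx₀T fun x _ hx => by simp [heat, hx]]
        simp [heat, hx₀]
      | succ i ih =>
        intro hi
        rw [heat_succ, sum_markov_mul (fun x hx => (hT i (by omega)).eq_zero hx) hψT]
        calc ((G.degree x₀ : ℝ) + 1) * l ^ (i + 1)
            = l * (((G.degree x₀ : ℝ) + 1) * l ^ i) := by ring
          _ ≤ l * ∑ x ∈ T, ((G.degree x : ℝ) + 1) * (heat G x₀ i x * ψ x) :=
              mul_le_mul_of_nonneg_left (ih (by omega)) hl0
          _ ≤ _ := by
              rw [Finset.mul_sum]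
              refine Finset.sum_le_sum fun x _ => ?_
              have := mul_le_mul_of_nonneg_left (hψ' x)
                (mul_nonneg (degree_add_one_pos (G := G) x).le (heat_nonneg (G := G) x₀ i x))
              linarith
    have h1 := key j (by omega)
    have h2 := Finset.sum_mul_sq_le_sq_mul_sq T
      (fun x => √((G.degree x : ℝ) + 1) * heat G x₀ j x) (fun x => √((G.degree x : ℝ) + 1) * ψ x)
    have h3 : ∀ x, √((G.degree x : ℝ) + 1) ^ 2 = (G.degree x : ℝ) + 1 := fun x =>
      Real.sq_sqrt (degree_add_one_pos x).le
    have h4 : ∀ x, √((G.degree x : ℝ) + 1) * heat G x₀ j x * (√((G.degree x : ℝ) + 1) * ψ x) =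
        ((G.degree x : ℝ) + 1) * (heat G x₀ j x * ψ x) := fun x => by
      rw [show ∀ r : ℝ, r * heat G x₀ j x * (r * ψ x) = r ^ 2 * (heat G x₀ j x * ψ x) from
        fun r => by ring, h3]
    simp only [h4, mul_pow, h3] at h2
    have h5 := sum_heat_mul_heat x₀ hx₀T hT j j (by omega)
    simp only [← pow_two, ← two_mul] at h5
    rw [h5] at h2
    have h6 : ∑ x ∈ T, ((G.degree x : ℝ) + 1) * ψ x ^ 2 ≤ ((D : ℝ) + 1) * U.card := by
      rw [← Finset.sum_subset (Finset.subset_union_right : U ⊆ T)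
        fun x _ hx => by simp [hψU x hx], mul_comm, ← nsmul_eq_mul]
      refine Finset.sum_le_card_nsmul _ _ _ fun x _ => ?_
      calc ((G.degree x : ℝ) + 1) * ψ x ^ 2 ≤ (D + 1) * 1 :=
            mul_le_mul (hdeg x) (pow_le_one₀ (hψ0 x) (hψ1 x)) (sq_nonneg _) (by positivity)
        _ = _ := mul_one _
    have h7 : (((G.degree x₀ : ℝ) + 1) * l ^ j) ^ 2 ≤
        (((G.degree x₀ : ℝ) + 1) * heat G x₀ (2 * j) x₀) * ((D + 1) * U.card) := by
      refine (pow_le_pow_left₀ (by positivity) h1 2).trans (h2.trans ?_)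
      exact mul_le_mul_of_nonneg_left h6 (mul_nonneg (by positivity) (heat_nonneg _ _ _))
    rw [div_le_iff₀ (by positivity)]
    set m₀ := (G.degree x₀ : ℝ) + 1
    have h8 : m₀ * (m₀ * l ^ (2 * j)) ≤ m₀ * (heat G x₀ (2 * j) x₀ * ((D + 1) * U.card)) := by
      calc m₀ * (m₀ * l ^ (2 * j)) = (m₀ * l ^ j) ^ 2 := by rw [pow_mul']; ring
        _ ≤ _ := h7
        _ = _ := by ring
    have h9 := le_of_mul_le_mul_left h8 (by linarith)
    refine le_trans ?_ h9
    exact le_mul_of_one_le_left (by positivity) hm₀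
  have hU1 : (0 : ℝ) < U.card := by exact_mod_cast hUpos
  rcases Nat.even_or_odd' n with ⟨j, rfl | rfl⟩
  · refine le_trans ?_ (even j)
    gcongr
    nlinarith
  -- Laziness: the extra step of an odd time may be spent at x₀.
  · have h1 : heat G x₀ (2 * j) x₀ / (D + 1) ≤ heat G x₀ (2 * j + 1) x₀ := by
      rw [heat_succ, markov]
      gcongr
      · exact add_nonneg (heat_nonneg _ _ _) (Finset.sum_nonneg fun y _ => heat_nonneg _ _ _)
      · exact le_add_of_nonneg_right (Finset.sum_nonneg fun y _ => heat_nonneg _ _ _)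
      · exact hD x₀
    refine le_trans ?_ h1
    rw [le_div_iff₀ (by positivity)]
    refine le_trans ?_ (even j)
    have : l ^ (2 * j + 1) ≤ l ^ (2 * j) := pow_le_pow_of_le_one hl0 hl1 (by omega)
    calc l ^ (2 * j + 1) / ((D + 1) ^ 2 * U.card) * (D + 1)
        = l ^ (2 * j + 1) / ((D + 1) * U.card) := by field_simp
      _ ≤ _ := by gcongr

end ReturnLower

/-! ### Generalized wreath products over ℤ and their tubes -/

section Wreath

theorem intGraph_adj (a b : ℤ) : intGraph.Adj a b ↔ b = a + 1 ∨ b = a - 1 := by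
  simp only [intGraph, SimpleGraph.circulantGraph, SimpleGraph.fromRel_adj, Set.mem_singleton_iff]
  omega

variable {L : Type} {W : L → Type} {o : ∀ z, W z}

theorem LampConfig.ext {f g : LampConfig W o} (h : ∀ x, f.1 x = g.1 x) : f = g :=
  Subtype.ext (funext h)

variable [DecidableEq L]

/-- The configuration `f` with the lamp `x` switched to the state `v`. -/
def LampConfig.switch (f : LampConfig W o) (x : L) (v : W x) : LampConfig W o :=
  ⟨Function.update f.1 x v, by
    refine (f.2.union (Set.finite_singleton x)).subset fun z hz => ?_
    by_cases h : z = x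
    · exact Or.inr h
    · left
      simpa [Function.update_of_ne h] using hz⟩

theorem LampConfig.switch_apply_same (f : LampConfig W o) (x : L) (v : W x) :
    (f.switch x v).1 x = v := by simp [LampConfig.switch]

theorem LampConfig.switch_apply_of_ne (f : LampConfig W o) {x y : L} (h : y ≠ x) (v : W x) :
    (f.switch x v).1 y = f.1 y := by simp [LampConfig.switch, h]

theorem LampConfig.switch_self (f : LampConfig W o) (x : L) : f.switch x (f.1 x) = f :=
  LampConfig.ext fun y => by simp [LampConfig.switch]

theorem LampConfig.switch_switch (f : LampConfig W o) (x : L) (v w : W x) :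
    (f.switch x v).switch x w = f.switch x w :=
  LampConfig.ext fun y => by simp [LampConfig.switch]

theorem LampConfig.eq_switch {f g : LampConfig W o} {x : L} (h : ∀ y, y ≠ x → f.1 y = g.1 y) :
    g = f.switch x (g.1 x) :=
  LampConfig.ext fun y => by
    by_cases hy : y = x
    · subst hy; simp [LampConfig.switch]
    · rw [LampConfig.switch_apply_of_ne _ hy, h y hy]

variable {φ : ℤ → L} {B : ∀ z, SimpleGraph (W z)}

theorem wreath_adj_iff (u v : ℤ × LampConfig W o) :
    (generalizedWreath intGraph φ W B o).Adj u v ↔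
      (v = (u.1 + 1, u.2) ∨ v = (u.1 - 1, u.2)) ∨
      ∃ w, (B (φ u.1)).Adj (u.2.1 (φ u.1)) w ∧ v = (u.1, u.2.switch (φ u.1) w) := by
  obtain ⟨a, f⟩ := u
  obtain ⟨b, g⟩ := v
  simp only [generalizedWreath, intGraph_adj, Prod.mk.injEq]
  refine or_congr ⟨?_, ?_⟩ ⟨?_, ?_⟩
  · rintro ⟨h | h, rfl⟩ <;> simp [h]
  · rintro (⟨h, rfl⟩ | ⟨h, rfl⟩) <;> simp [h]
  · rintro ⟨rfl, h, h'⟩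
    exact ⟨_, h', rfl, LampConfig.eq_switch h⟩
  · rintro ⟨w, h, rfl, rfl⟩
    exact ⟨rfl, fun x hx => (LampConfig.switch_apply_of_ne _ hx _).symm, by
      rwa [LampConfig.switch_apply_same]⟩

theorem wreath_neighborSet_encard_le {M : ℕ} [∀ z, Finite (W z)]
    (hM : ∀ z x, valency (B z) x ≤ M) (u : ℤ × LampConfig W o) :
    ((generalizedWreath intGraph φ W B o).neighborSet u).encard ≤ ((M + 2 : ℕ) : ℕ∞) := by
  have hsub : (generalizedWreath intGraph φ W B o).neighborSet u ⊆
      (fun w => (u.1, u.2.switch (φ u.1) w)) '' (B (φ u.1)).neighborSet (u.2.1 (φ u.1)) ∪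
      {(u.1 + 1, u.2), (u.1 - 1, u.2)} := by
    intro v hv
    rcases (wreath_adj_iff u v).1 hv with h | ⟨w, h, rfl⟩
    · exact Or.inr h
    · exact Or.inl ⟨w, h, rfl⟩
  refine (Set.encard_le_encard hsub).trans ((Set.encard_union_le _ _).trans ?_)
  push_cast
  refine add_le_add ((Set.encard_image_le _ _).trans ?_) (Set.encard_insert_le _ _ |>.trans ?_)
  · rw [← (Set.toFinite ((B (φ u.1)).neighborSet (u.2.1 (φ u.1)))).cast_ncard_eq]
    exact_mod_cast hM (φ u.1) (u.2.1 (φ u.1))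
  · rw [Set.encard_singleton]; norm_num

variable [∀ z, Fintype (W z)]

theorem LampConfig.finite_setOf_eq_rest (o : ∀ z, W z) (Λ : Finset L) :
    {f : LampConfig W o | ∀ x ∉ Λ, f.1 x = o x}.Finite := by
  refine Set.Finite.of_finite_image (f := fun f (x : Λ) => f.1 x) (Set.toFinite _) ?_
  intro f hf g hg h
  refine LampConfig.ext fun x => ?_
  by_cases hx : x ∈ Λ
  · exact congrFun h ⟨x, hx⟩
  · rw [hf x hx, hg x hx]

/-- The configurations which are at rest off `Λ`. -/
noncomputable def restOff (o : ∀ z, W z) (Λ : Finset L) : Finset (LampConfig W o) :=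
  (LampConfig.finite_setOf_eq_rest o Λ).toFinset

theorem mem_restOff {Λ : Finset L} {f : LampConfig W o} :
    f ∈ restOff o Λ ↔ ∀ x ∉ Λ, f.1 x = o x := by
  simp [restOff]

theorem rest_mem_restOff (Λ : Finset L) : LampConfig.rest W o ∈ restOff o Λ :=
  mem_restOff.2 fun _ _ => rfl

theorem switch_mem_restOff {Λ : Finset L} {f : LampConfig W o} {x : L} (hx : x ∈ Λ) (v : W x) :
    f.switch x v ∈ restOff o Λ ↔ f ∈ restOff o Λ := by
  simp only [mem_restOff]
  refine forall₂_congr fun y hy => ?_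
  rw [LampConfig.switch_apply_of_ne]
  rintro rfl
  exact hy hx

theorem card_restOff_le (Λ : Finset L) :
    (restOff o Λ).card ≤ ∏ x ∈ Λ, Fintype.card (W x) := by
  rw [← Finset.prod_coe_sort Λ fun x => Fintype.card (W x), ← Fintype.card_pi, ← Finset.card_univ]
  refine Finset.card_le_card_of_injOn (fun f x => f.1 x) (fun _ _ => Finset.mem_univ _) ?_
  intro f hf g hg h
  refine LampConfig.ext fun x => ?_
  by_cases hx : x ∈ Λ
  · exact congrFun h ⟨x, hx⟩
  · rw [mem_restOff.1 hf x hx, mem_restOff.1 hg x hx]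

/-- The positions in `[-m, m]` with all lamps visited from there in an arbitrary state. -/
noncomputable def tube (φ : ℤ → L) (o : ∀ z, W z) (m : ℕ) : Finset (ℤ × LampConfig W o) :=
  Finset.Icc (-m : ℤ) m ×ˢ restOff o ((Finset.Icc (-m : ℤ) m).image φ)

theorem tube_nonempty (m : ℕ) : (tube φ o m).Nonempty :=
  ⟨(0, LampConfig.rest W o), Finset.mem_product.2 ⟨by simp, rest_mem_restOff _⟩⟩

theorem card_tube (m : ℕ) :
    (tube φ o m).card = (2 * m + 1) * (restOff o ((Finset.Icc (-m : ℤ) m).image φ)).card := by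
  rw [tube, Finset.card_product, Int.card_Icc]
  congr 1
  omega

/-- Every lamp reachable from [-k, k] is free, so switching never leaves the tube. Only the steps
out of ±k do: at most 2|R| boundary edges against (2k+1)|R| vertices. -/
theorem tube_mem_folnerSets (k : ℕ) :
    tube φ o k ∈ folnerSets (generalizedWreath intGraph φ W B o) k := by
  refine ⟨tube_nonempty k, ?_⟩
  set R := restOff o ((Finset.Icc (-k : ℤ) k).image φ)
  have hsub : edgeBoundary (generalizedWreath intGraph φ W B o) (tube φ o k) ⊆
      (fun f => (((k : ℤ), f), ((k : ℤ) + 1, f))) '' (R : Set (LampConfig W o)) ∪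
      (fun f => ((-(k : ℤ), f), (-(k : ℤ) - 1, f))) '' (R : Set (LampConfig W o)) := by
    rintro ⟨⟨a, f⟩, v⟩ ⟨hadj, hu, hv⟩
    rw [tube, Finset.mem_product] at hu hv
    simp only [Finset.mem_Icc] at hu hv
    rw [wreath_adj_iff] at hadj
    dsimp only at hadj
    rcases hadj with (rfl | rfl) | ⟨w, -, rfl⟩
    · left
      refine ⟨f, hu.2, ?_⟩
      have : a = k := by
        by_contra h
        exact hv ⟨⟨by simp; omega, by simp; omega⟩, hu.2⟩
      simp [this]
    · right
      refine ⟨f, hu.2, ?_⟩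
      have : a = -k := by
        by_contra h
        exact hv ⟨⟨by simp; omega, by simp; omega⟩, hu.2⟩
      simp [this]
    · refine absurd ⟨hu.1, ?_⟩ hv
      exact (switch_mem_restOff (Finset.mem_image_of_mem φ (Finset.mem_Icc.2 hu.1)) _).2 hu.2
  have h1 : (edgeBoundary (generalizedWreath intGraph φ W B o) (tube φ o k)).ncard ≤
      R.card + R.card := by
    refine (Set.ncard_le_ncard hsub (Set.toFinite _)).trans ((Set.ncard_union_le _ _).trans ?_)
    gcongr <;>
    · refine (Set.ncard_image_le (Set.toFinite _)).trans ?_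
      rw [Set.ncard_coe_finset]
  rw [card_tube]
  calc k * _ ≤ k * (R.card + R.card) := Nat.mul_le_mul_left _ h1
    _ ≤ _ := by nlinarith

/-- The growth `≼ exp (m ^ β)` of the number of configurations of the tube. -/
def TubeGrowth (φ : ℤ → L) (W : L → Type) [∀ z, Fintype (W z)] (β : ℝ) : Prop :=
  ∃ C c : ℝ, 0 < C ∧ 0 < c ∧ ∀ m : ℕ, ((2 * m + 1) *
    ∏ x ∈ (Finset.Icc (-m : ℤ) m).image φ, (Fintype.card (W x) : ℝ)) ≤
      C * Real.exp (c * (m : ℝ) ^ β)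

theorem card_tube_le (m : ℕ) : ((tube φ o m).card : ℝ) ≤ (2 * m + 1) *
    ∏ x ∈ (Finset.Icc (-m : ℤ) m).image φ, (Fintype.card (W x) : ℝ) := by
  rw [card_tube]
  push_cast
  gcongr
  exact_mod_cast card_restOff_le _

theorem TubeGrowth.folner_dominated {α β : ℝ} (hβ : 0 < β) (hαβ : β = 2 * α / (1 - α))
    (h : TubeGrowth φ W β) :
    Dominated (fun k => (folner (generalizedWreath intGraph φ W B o) k : ℝ))
      fun k => profileF α (k : ℝ) := by
  obtain ⟨C, c, hC, -, h⟩ := h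
  refine dominated_profileF hβ hαβ hC fun k => le_trans ?_ (h k)
  refine le_trans ?_ (card_tube_le (o := o) k)
  exact_mod_cast Nat.sInf_le (Set.mem_image_of_mem Finset.card (tube_mem_folnerSets k))

/-- The factor 2m + 1 is absorbed: with y = (m+1)^β and N ≥ 1/β, m + 1 ≤ y^N ≤ N! e^y. -/
theorem exists_tubeGrowth {β C : ℝ} (hβ : 0 < β) (hC : 0 < C)
    (h : ∀ m : ℕ, ∏ x ∈ (Finset.Icc (-m : ℤ) m).image φ, (Fintype.card (W x) : ℝ) ≤
      Real.exp (C * ((m : ℝ) + 1) ^ β)) : TubeGrowth φ W β := by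
  obtain ⟨N, hN⟩ := exists_nat_ge (1 / β)
  refine ⟨2 * N.factorial * Real.exp ((1 + C) * 2 ^ β), (1 + C) * 2 ^ β, by positivity,
    by positivity, fun m => ?_⟩
  set y : ℝ := ((m : ℝ) + 1) ^ β with hy
  have hy1 : 1 ≤ y := Real.one_le_rpow (by linarith [(Nat.cast_nonneg m : (0 : ℝ) ≤ m)]) hβ.le
  have h1 : (m : ℝ) + 1 ≤ N.factorial * Real.exp y := by
    have h2 := Real.pow_div_factorial_le_exp y (by linarith) N
    rw [div_le_iff₀ (by positivity)] at h2
    calc (m : ℝ) + 1 = y ^ (1 / β) := by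
          rw [hy, ← Real.rpow_mul (by positivity), mul_one_div_cancel hβ.ne', Real.rpow_one]
      _ ≤ y ^ (N : ℝ) := Real.rpow_le_rpow_of_exponent_le hy1 hN
      _ = y ^ N := Real.rpow_natCast _ _
      _ ≤ _ := by linarith
  -- The additive constant is there for m = 0, where m^β vanishes.
  have h3 : y ≤ 2 ^ β * (m : ℝ) ^ β + 2 ^ β := by
    rcases Nat.eq_zero_or_pos m with rfl | hm
    · have : (1 : ℝ) ≤ 2 ^ β := Real.one_le_rpow (by norm_num) hβ.le
      simp [hy, Real.zero_rpow hβ.ne', this]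
    · have hm1 : (1 : ℝ) ≤ m := by exact_mod_cast hm
      have : y ≤ 2 ^ β * (m : ℝ) ^ β := by
        rw [hy, ← Real.mul_rpow (by norm_num) (by positivity)]
        gcongr
        linarith
      have : (0 : ℝ) ≤ 2 ^ β := by positivity
      linarith
  calc _ ≤ (2 * (N.factorial * Real.exp y)) * Real.exp (C * y) := by
        gcongr
        · linarith
        · exact h m
    _ = 2 * N.factorial * Real.exp ((1 + C) * y) := by
        rw [add_mul, Real.exp_add, one_mul]; ring
    _ ≤ 2 * N.factorial * Real.exp ((1 + C) * (2 ^ β * (m : ℝ) ^ β + 2 ^ β)) := by gcongr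
    _ = _ := by
        rw [mul_assoc _ (Real.exp _), ← Real.exp_add]
        congr 2
        ring

end Wreath

/-! ### The cosine test function on the tube -/

section WreathReturn

variable {L : Type} [DecidableEq L] {W : L → Type} {o : ∀ z, W z} {φ : ℤ → L}
  {B : ∀ z, SimpleGraph (W z)} [∀ z, Fintype (W z)]

open Classical in
/-- The cosine profile on the tube. -/
noncomputable def tubeCos (φ : ℤ → L) (o : ∀ z, W z) (m : ℕ) (x : ℤ × LampConfig W o) : ℝ :=
  if x ∈ tube φ o m then Real.cos (Real.pi / (2 * (m + 1)) * x.1) else 0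

theorem mem_tube {m : ℕ} {a : ℤ} {f : LampConfig W o} :
    (a, f) ∈ tube φ o m ↔ (-(m : ℤ) ≤ a ∧ a ≤ m) ∧
      f ∈ restOff o ((Finset.Icc (-m : ℤ) m).image φ) := by
  rw [tube, Finset.mem_product, Finset.mem_Icc]

theorem cos_nonneg_of_abs_le {m : ℕ} {a : ℤ} (h : |a| ≤ m + 1) :
    0 ≤ Real.cos (Real.pi / (2 * (m + 1)) * a) := by
  have h' : |(a : ℝ)| ≤ (m : ℝ) + 1 := by exact_mod_cast h
  have hm : (0 : ℝ) < (m : ℝ) + 1 := by positivity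
  have h2 : |Real.pi / (2 * ((m : ℝ) + 1)) * a| ≤ Real.pi / 2 := by
    rw [abs_mul, abs_of_pos (by positivity)]
    calc Real.pi / (2 * ((m : ℝ) + 1)) * |(a : ℝ)|
        ≤ Real.pi / (2 * ((m : ℝ) + 1)) * ((m : ℝ) + 1) := by gcongr
      _ = Real.pi / 2 := by field_simp
  exact Real.cos_nonneg_of_mem_Icc (abs_le.1 h2)

theorem tubeCos_nonneg (m : ℕ) (x : ℤ × LampConfig W o) : 0 ≤ tubeCos φ o m x := by
  unfold tubeCos
  split_ifs with h
  · have := (mem_tube.1 h).1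
    exact cos_nonneg_of_abs_le (abs_le.2 ⟨by omega, by omega⟩)
  · exact le_rfl

/-- The cosine vanishes at ±(m+1), so the cut-off is invisible one step beyond the tube and the ends
need no separate treatment. -/
theorem tubeCos_eq {m : ℕ} {a : ℤ} (ha : |a| ≤ m + 1) {f : LampConfig W o}
    (hf : f ∈ restOff o ((Finset.Icc (-m : ℤ) m).image φ)) :
    tubeCos φ o m (a, f) = Real.cos (Real.pi / (2 * (m + 1)) * a) := by
  unfold tubeCos
  split_ifs with h
  · rfl
  · have h1 : |a| = m + 1 := by
      by_contra hne
      refine h (mem_tube.2 ⟨abs_le.1 ?_, hf⟩)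
      omega
    have h2 : |(a : ℝ)| = (m : ℝ) + 1 := by exact_mod_cast h1
    have hm : (0 : ℝ) < (m : ℝ) + 1 := by positivity
    rw [← Real.cos_abs, abs_mul, abs_of_pos (by positivity), h2,
      show Real.pi / (2 * ((m : ℝ) + 1)) * ((m : ℝ) + 1) = Real.pi / 2 by field_simp,
      Real.cos_pi_div_two]

/-- Lamp moves do not change the function. The two base moves contribute 2(cos θ - 1)ψ ≥ -θ²ψ, and
dividing by degree + 1 only weakens this loss. -/
theorem tubeCos_subharmonic [(generalizedWreath intGraph φ W B o).LocallyFinite] (m : ℕ)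
    (x : ℤ × LampConfig W o) (hx : x ∈ tube φ o m) :
    (1 - (Real.pi / (2 * (m + 1))) ^ 2) * tubeCos φ o m x ≤
      markov (generalizedWreath intGraph φ W B o) (tubeCos φ o m) x := by
  classical
  obtain ⟨a, f⟩ := x
  set θ : ℝ := Real.pi / (2 * (m + 1)) with hθ
  set ψ := tubeCos φ o m with hψ
  obtain ⟨ha, hf⟩ := mem_tube.1 hx
  have e0 : ψ (a, f) = Real.cos (θ * a) := tubeCos_eq (abs_le.2 ⟨by omega, by omega⟩) hf
  have e1 : ψ (a + 1, f) = Real.cos (θ * a + θ) := by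
    rw [hψ, tubeCos_eq (abs_le.2 ⟨by omega, by omega⟩) hf]
    congr 1; push_cast; ring
  have e2 : ψ (a - 1, f) = Real.cos (θ * a - θ) := by
    rw [hψ, tubeCos_eq (abs_le.2 ⟨by omega, by omega⟩) hf]
    congr 1; push_cast; ring
  have hsum : ∑ y ∈ (generalizedWreath intGraph φ W B o).neighborFinset (a, f), (ψ y - ψ (a, f)) =
      (ψ (a + 1, f) - ψ (a, f)) + (ψ (a - 1, f) - ψ (a, f)) := by
    rw [← Finset.sum_pair (f := fun y => ψ y - ψ (a, f)) (a := (a + 1, f)) (b := (a - 1, f))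
      (by simp only [ne_eq, Prod.mk.injEq, and_true]; omega)]
    symm
    refine Finset.sum_subset (fun y hy => ?_) fun y hy hy' => ?_
    · rw [SimpleGraph.mem_neighborFinset, wreath_adj_iff]
      left
      simpa using hy
    · rw [SimpleGraph.mem_neighborFinset, wreath_adj_iff] at hy
      rcases hy with h | ⟨w, -, rfl⟩
      · exact absurd (by simpa using h) hy'
      · dsimp only
        have hf' : f.switch (φ a) w ∈ restOff o ((Finset.Icc (-m : ℤ) m).image φ) :=
          (switch_mem_restOff (Finset.mem_image_of_mem φ (Finset.mem_Icc.2 ha)) _).2 hf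
        rw [e0, hψ, tubeCos_eq (abs_le.2 ⟨by omega, by omega⟩) hf', sub_self]
  have hpos := tubeCos_nonneg m (a, f) (φ := φ)
  rw [← hψ] at hpos
  have hcos := Real.one_sub_sq_div_two_le_cos (x := θ)
  have hge : -(θ ^ 2 * ψ (a, f)) ≤ ∑ y ∈ (generalizedWreath intGraph φ W B o).neighborFinset (a, f), (ψ y - ψ (a, f)) := by
    rw [hsum, e1, e2, Real.cos_add, Real.cos_sub, ← e0]
    nlinarith
  rw [Finset.sum_sub_distrib, Finset.sum_const, SimpleGraph.card_neighborFinset_eq_degree,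
    nsmul_eq_mul] at hge
  rw [markov, le_div_iff₀ (degree_add_one_pos _)]
  have : 0 ≤ θ ^ 2 * ψ (a, f) * ((generalizedWreath intGraph φ W B o).degree (a, f) : ℝ) := by positivity
  linarith

/-- A tube of radius r ≈ n^((1-α)/2) balances the decay (1 - θ²)^n, θ ≈ 1/r, with the size
exp(O(r^β)) of the tube. -/
theorem TubeGrowth.dominated_transProb [(generalizedWreath intGraph φ W B o).LocallyFinite]
    {D : ℕ} (hD : ∀ x, (generalizedWreath intGraph φ W B o).degree x ≤ D) {α β : ℝ} (hα : 0 < α)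
    (hα1 : α < 1) (hαβ : β = 2 * α / (1 - α)) (h : TubeGrowth φ W β) :
    Dominated (fun n => Real.exp (-((n : ℝ) ^ α))) fun n =>
      transProb (generalizedWreath intGraph φ W B o) n (0, LampConfig.rest W o)
        (0, LampConfig.rest W o) := by
  obtain ⟨C, c, hC, hc, h⟩ := h
  have hα1' : 0 < 1 - α := by linarith
  have hβ : 0 < β := by rw [hαβ]; positivity
  refine exp_neg_dominated hα (C := min (1 / ((D + 1) ^ 2 * C)) 1) (c := 10 + c * 2 ^ β)
    (by positivity) (by positivity) fun n => ?_
  rw [transProb_eq_heat]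
  rcases Nat.eq_zero_or_pos n with rfl | hn
  · simp [heat, Real.zero_rpow hα.ne']
  have hn1 : (1 : ℝ) ≤ n := by exact_mod_cast hn
  set s : ℝ := (n : ℝ) ^ ((1 - α) / 2) with hs
  have hs1 : 1 ≤ s := Real.one_le_rpow hn1 (by positivity)
  set r : ℕ := ⌈s⌉₊ with hr
  have hr1 : s ≤ r := Nat.le_ceil s
  have hr2 : (r : ℝ) ≤ 2 * s := by linarith [Nat.ceil_lt_add_one (by linarith : 0 ≤ s)]
  set θ : ℝ := Real.pi / (2 * (r + 1)) with hθ
  have hpi : Real.pi ^ 2 < 10 := by nlinarith [Real.pi_lt_d2, Real.pi_pos]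
  have hθ2 : θ ^ 2 * s ^ 2 ≤ 10 / 4 := by
    rw [hθ, div_pow, div_mul_eq_mul_div, div_le_iff₀ (by positivity)]
    have : s ^ 2 ≤ ((r : ℝ) + 1) ^ 2 := by gcongr; linarith
    nlinarith [sq_nonneg s]
  have hθ1 : θ ^ 2 ≤ 3 / 4 := by
    rw [hθ, div_pow, div_le_iff₀ (by positivity)]
    have : (2 : ℝ) ^ 2 ≤ ((r : ℝ) + 1) ^ 2 := by gcongr; linarith
    nlinarith
  -- For 0 ≤ x ≤ 3/4, (1 - x)(1 + 4x) ≥ 1 and e^(4x) ≥ 1 + 4x; here x = θ².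
  have hl : Real.exp (-(4 * θ ^ 2)) ≤ 1 - θ ^ 2 := by
    have h1 : 0 < 1 - θ ^ 2 := by linarith
    have h2 := Real.add_one_le_exp (4 * θ ^ 2)
    rw [Real.exp_neg, inv_le_comm₀ (Real.exp_pos _) h1]
    refine le_trans ?_ h2
    rw [inv_le_iff_one_le_mul₀ h1]
    nlinarith [sq_nonneg θ]
  have hmain := heat_ge_of_subharmonic hD (U := tube φ o r) (ψ := tubeCos φ o r)
    (x₀ := (0, LampConfig.rest W o)) (l := 1 - θ ^ 2) (by linarith) (by nlinarith [sq_nonneg θ])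
    (tubeCos_nonneg r) (fun x => by
      unfold tubeCos
      split_ifs
      · exact Real.cos_le_one _
      · norm_num)
    (fun x hx => if_neg hx)
    (by rw [tubeCos_eq (by simp; omega) (rest_mem_restOff _)]; simp)
    (tubeCos_subharmonic r) n
  refine le_trans ?_ hmain
  have hcard : ((tube φ o r).card : ℝ) ≤ C * Real.exp (c * 2 ^ β * (n : ℝ) ^ α) := by
    refine (card_tube_le (o := o) r).trans ((h r).trans ?_)
    have h1 : (r : ℝ) ^ β ≤ 2 ^ β * (n : ℝ) ^ α := by
      calc (r : ℝ) ^ β ≤ (2 * s) ^ β := by gcongr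
        _ = 2 ^ β * (n : ℝ) ^ α := by
            rw [Real.mul_rpow (by norm_num) (by positivity), hs, ← Real.rpow_mul (by positivity)]
            congr 2
            rw [hαβ]
            field_simp
    rw [mul_assoc c]
    gcongr
  have hs2 : s ^ 2 * (n : ℝ) ^ α = n := by
    rw [hs, ← Real.rpow_natCast, ← Real.rpow_mul (by positivity), ← Real.rpow_add (by positivity)]
    simp
  have hpow : Real.exp (-(10 * (n : ℝ) ^ α)) ≤ (1 - θ ^ 2) ^ n := by
    refine le_trans ?_ (pow_le_pow_left₀ (Real.exp_pos _).le hl n)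
    rw [← Real.exp_nat_mul]
    gcongr
    have h0 : 0 ≤ (n : ℝ) ^ α := by positivity
    have : (n : ℝ) * θ ^ 2 = θ ^ 2 * s ^ 2 * (n : ℝ) ^ α := by rw [mul_assoc, hs2, mul_comm]
    nlinarith
  have hcard0 : (0 : ℝ) < (tube φ o r).card := by
    exact_mod_cast Finset.card_pos.2 (tube_nonempty r)
  calc min (1 / (((D : ℝ) + 1) ^ 2 * C)) 1 * Real.exp (-((10 + c * 2 ^ β) * (n : ℝ) ^ α))
      ≤ 1 / (((D : ℝ) + 1) ^ 2 * C) * Real.exp (-((10 + c * 2 ^ β) * (n : ℝ) ^ α)) := by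
        gcongr
        exact min_le_left _ _
    _ = Real.exp (-(10 * (n : ℝ) ^ α)) /
          (((D : ℝ) + 1) ^ 2 * (C * Real.exp (c * 2 ^ β * (n : ℝ) ^ α))) := by
        rw [add_mul, neg_add, Real.exp_add, Real.exp_neg (c * 2 ^ β * (n : ℝ) ^ α)]
        field_simp
    _ ≤ _ := by
        gcongr
        exact pow_nonneg (by linarith) n

end WreathReturn

/-! ### Entropy inequalities for slices -/

section Entropy

-- Subadditivity of entropy, H(p, q) ≤ H(p) + H(q), for a uniform element of F, which p and q
-- together determine. A triple (f, g, h) with p g = p f and q h = q f is determined by (g, h), so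
-- the products of the fibre sizes sum to at most |F|². Then log t ≤ t - 1 is applied with t =
-- (product)/|F|.
open Classical in
theorem sum_log_card_fibers_le {ι A A' : Type*} (F : Finset ι) (p : ι → A) (q : ι → A')
    (hpq : ∀ x ∈ F, ∀ y ∈ F, p x = p y → q x = q y → x = y) :
    ∑ f ∈ F, (Real.log (F.filter fun g => p g = p f).card +
      Real.log (F.filter fun g => q g = q f).card) ≤ F.card * Real.log F.card := by
  rcases F.eq_empty_or_nonempty with rfl | hne
  · simp
  set n : ℝ := ((F.card : ℕ) : ℝ) with hn
  have hn0 : 0 < n := by rw [hn]; exact_mod_cast hne.card_pos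
  have hcount : ∑ f ∈ F, (((F.filter fun g => p g = p f).card : ℝ) *
      (F.filter fun g => q g = q f).card) ≤ n * n := by
    have : (F.sigma fun f => (F.filter fun g => p g = p f) ×ˢ (F.filter fun g => q g = q f)).card ≤
        (F ×ˢ F).card := by
      refine Finset.card_le_card_of_injOn (fun t => t.2) (fun t ht => ?_) ?_
      · simp only [Finset.coe_sigma, Set.mem_sigma_iff, Finset.mem_coe, Finset.mem_product,
          Finset.mem_filter] at ht ⊢
        exact ⟨ht.2.1.1, ht.2.2.1⟩
      · rintro ⟨f, g, h⟩ ht ⟨f', g', h'⟩ ht' heq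
        simp only [Finset.coe_sigma, Set.mem_sigma_iff, Finset.mem_coe, Finset.mem_product,
          Finset.mem_filter] at ht ht'
        simp only [Prod.mk.injEq] at heq
        obtain ⟨rfl, rfl⟩ := heq
        obtain rfl := hpq f ht.1 f' ht'.1 (ht.2.1.2.symm.trans ht'.2.1.2)
          (ht.2.2.2.symm.trans ht'.2.2.2)
        rfl
    rw [Finset.card_sigma, Finset.card_product] at this
    simp only [Finset.card_product] at this
    rw [hn]
    exact_mod_cast this
  have hterm : ∀ f ∈ F, Real.log (F.filter fun g => p g = p f).card +
      Real.log (F.filter fun g => q g = q f).card ≤ Real.log n - 1 +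
        ((F.filter fun g => p g = p f).card : ℝ) * (F.filter fun g => q g = q f).card / n := by
    intro f hf
    have h1 : (0 : ℝ) < (F.filter fun g => p g = p f).card := by
      exact_mod_cast Finset.card_pos.2 ⟨f, by simp [hf]⟩
    have h2 : (0 : ℝ) < (F.filter fun g => q g = q f).card := by
      exact_mod_cast Finset.card_pos.2 ⟨f, by simp [hf]⟩
    have h3 := Real.log_le_sub_one_of_pos (div_pos (mul_pos h1 h2) hn0)
    rw [Real.log_div (mul_pos h1 h2).ne' hn0.ne', Real.log_mul h1.ne' h2.ne'] at h3
    linarith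
  refine (Finset.sum_le_sum hterm).trans ?_
  rw [Finset.sum_add_distrib, ← Finset.sum_div, Finset.sum_const, nsmul_eq_mul, ← hn]
  have : (∑ f ∈ F, (((F.filter fun g => p g = p f).card : ℝ) *
      (F.filter fun g => q g = q f).card)) / n ≤ n := by
    rw [div_le_iff₀ hn0]; exact hcount
  linarith

open Classical in
/-- The entropy form of the edge isoperimetric inequality in a product. -/
theorem sum_log_card_slices_le {L : Type} {W : L → Type} (Λ : Finset L) (F : Finset (∀ z, W z)) :
    ∑ f ∈ F, ∑ x ∈ Λ, Real.log (F.filter fun g => ∀ y, y ≠ x → g y = f y).card ≤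
      F.card * Real.log F.card := by
  induction Λ using Finset.induction_on generalizing F with
  | empty =>
    simp only [Finset.sum_empty, Finset.sum_const_zero]
    positivity
  | insert x Λ hx ih =>
    have h1 := sum_log_card_fibers_le F (fun f => f x) (fun f (y : {y // y ≠ x}) => f y.1)
      (fun f _ g _ hp hq => funext fun y => by
        by_cases h : y = x
        · subst h; exact hp
        · exact congrFun hq ⟨y, h⟩)
    refine le_trans ?_ h1
    rw [Finset.sum_add_distrib]
    simp only [Finset.sum_insert hx]
    rw [Finset.sum_add_distrib, add_comm]
    refine add_le_add ?_ (le_of_eq ?_)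
    -- Split F by the state at x. A slice in a direction y ≠ x stays within its part, so the
    -- induction hypothesis applies to each part.
    · rw [← Finset.sum_fiberwise_of_maps_to (t := F.image fun f => f x) (g := fun f => f x)
        fun f hf => Finset.mem_image_of_mem _ hf,
        ← Finset.sum_fiberwise_of_maps_to (s := F) (t := F.image fun f => f x) (g := fun f => f x)
        fun f hf => Finset.mem_image_of_mem _ hf]
      refine Finset.sum_le_sum fun v _ => ?_
      have h2 := ih (F.filter fun f => f x = v)
      have h3 : ∑ f ∈ F.filter (fun f => f x = v),
          Real.log (F.filter fun g => g x = f x).card =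
          (F.filter fun f => f x = v).card * Real.log (F.filter fun f => f x = v).card := by
        rw [← nsmul_eq_mul]
        refine Finset.sum_eq_card_nsmul fun f hf => ?_
        rw [(Finset.mem_filter.1 hf).2]
      rw [h3]
      refine le_trans (le_of_eq ?_) h2
      refine Finset.sum_congr rfl fun f hf => Finset.sum_congr rfl fun y hy => ?_
      congr 3
      ext g
      simp only [Finset.mem_filter]
      constructor
      · rintro ⟨h, h'⟩
        have hxy : x ≠ y := fun h => hx (h ▸ hy)
        exact ⟨⟨h, (h' x hxy).trans (Finset.mem_filter.1 hf).2⟩, h'⟩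
      · rintro ⟨⟨h, -⟩, h'⟩
        exact ⟨h, h'⟩
    · refine Finset.sum_congr rfl fun f _ => ?_
      congr 3
      ext g
      simp [funext_iff]

end Entropy

/-! ### Horizontal and vertical boundary of a set in the wreath product -/

section Isoperimetry

theorem exists_step_up {S : ℤ → Prop} {a b : ℤ} (hab : a ≤ b) (ha : S a) (hb : ¬S b) :
    ∃ c, a ≤ c ∧ c < b ∧ S c ∧ ¬S (c + 1) := by
  by_contra hcon
  push Not at hcon
  refine hb (Int.leInduction (m := a) (motive := fun n _ => n ≤ b → S n) (fun _ => ha)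
    (fun n hn ih hn' => ?_) b hab le_rfl)
  exact hcon n hn (by omega) (ih (by omega))

theorem exists_step {S : ℤ → Prop} {a b : ℤ} (ha : S a) (hb : ¬S b) :
    ∃ c d, (min a b ≤ c ∧ c ≤ max a b) ∧ (d = c + 1 ∨ d = c - 1) ∧ S c ∧ ¬S d := by
  rcases le_total a b with h | h
  · obtain ⟨c, h1, h2, h3, h4⟩ := exists_step_up h ha hb
    exact ⟨c, c + 1, by omega, Or.inl rfl, h3, h4⟩
  · obtain ⟨c, h1, h2, h3, h4⟩ := exists_step_up (S := fun n => S (-n)) (neg_le_neg h)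
      (by simpa using ha) (by simpa using hb)
    exact ⟨-c, -(c + 1), by omega, by omega, h3, h4⟩

variable {L : Type} [DecidableEq L] {W : L → Type} {o : ∀ z, W z} {φ : ℤ → L}
  {B : ∀ z, SimpleGraph (W z)}

open Classical in
/-- The pairs (window of length `k`, configuration) met by `U`. -/
noncomputable def windowTrace (U : Finset (ℤ × LampConfig W o)) (k : ℕ) :
    Finset (ℤ × LampConfig W o) :=
  U.image fun u => (u.1 / (k : ℤ), u.2)

/-- A pair whose window lies entirely in U accounts for k points of U. Any other pair has, inside
its window, the start of a boundary edge of base type, and different pairs have different edges. -/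
theorem mul_card_windowTrace_le (U : Finset (ℤ × LampConfig W o)) {k : ℕ} (hk : 1 ≤ k)
    (hfin : (edgeBoundary (generalizedWreath intGraph φ W B o) U).Finite) :
    k * (windowTrace U k).card ≤
      U.card + k * (edgeBoundary (generalizedWreath intGraph φ W B o) U).ncard := by
  classical
  set E := hfin.toFinset
  rw [Set.ncard_eq_toFinset_card _ hfin]
  have hk0 : (0 : ℤ) < k := by exact_mod_cast hk
  set Q := windowTrace U k with hQ
  set Q₁ := Q.filter fun q => ∀ a : ℤ, a / k = q.1 → (a, q.2) ∈ U with hQ₁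
  set Q₂ := Q.filter fun q => ¬∀ a : ℤ, a / k = q.1 → (a, q.2) ∈ U with hQ₂
  have hcard : Q₁.card + Q₂.card = Q.card := Finset.card_filter_add_card_filter_not _
  have h1 : k * Q₁.card ≤ U.card := by
    rw [Finset.card_eq_sum_card_fiberwise (s := U) (f := fun u => (u.1 / (k : ℤ), u.2)) (t := Q)
      (fun u hu => Finset.mem_image_of_mem _ hu), mul_comm, ← smul_eq_mul]
    refine le_trans ?_ (Finset.sum_le_sum_of_subset (Finset.filter_subset _ _ : Q₁ ⊆ Q))
    refine Finset.card_nsmul_le_sum _ _ _ fun q hq => ?_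
    have hq' := (Finset.mem_filter.1 hq).2
    have hIco : (Finset.Ico (q.1 * k) (q.1 * k + k)).card = k := by simp
    rw [← hIco]
    refine Finset.card_le_card_of_injOn (fun a => (a, q.2)) (fun a ha => ?_)
      (fun a _ b _ h => (Prod.mk.inj h).1)
    simp only [Finset.coe_Ico, Set.mem_Ico] at ha
    have ha' : a / k = q.1 := by
      rw [Int.ediv_eq_iff_of_pos hk0]
      constructor <;> nlinarith [ha.1, ha.2]
    simp [hq' a ha', ha']
  have h2 : Q₂.card ≤ E.card := by
    refine Finset.card_le_card_of_surjOn (fun e => (e.1.1 / (k : ℤ), e.1.2)) ?_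
    rintro ⟨j, f⟩ hq
    obtain ⟨hqQ, hq'⟩ := Finset.mem_filter.1 hq
    push Not at hq'
    obtain ⟨b, hb, hbU⟩ := hq'
    obtain ⟨⟨a, g⟩, haU, haq⟩ := Finset.mem_image.1 hqQ
    obtain ⟨ha, rfl⟩ := Prod.mk.inj haq
    dsimp only at ha hb hbU
    obtain ⟨c, d, hc, hd, hcU, hdU⟩ := exists_step (S := fun a => (a, g) ∈ U) haU hbU
    refine ⟨((c, g), (d, g)), ?_, ?_⟩
    · simp only [E, Set.Finite.coe_toFinset]
      refine ⟨(wreath_adj_iff _ _).2 (Or.inl ?_), hcU, hdU⟩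
      rcases hd with rfl | rfl <;> simp
    · have h3 : c / k = j := by
        refine le_antisymm ?_ ?_
        · rcases le_total a b with h | h
          · rw [← hb]; exact Int.ediv_le_ediv hk0 (by omega)
          · rw [← ha]; exact Int.ediv_le_ediv hk0 (by omega)
        · rcases le_total a b with h | h
          · rw [← ha]; exact Int.ediv_le_ediv hk0 (by omega)
          · rw [← hb]; exact Int.ediv_le_ediv hk0 (by omega)
      simp [h3]
  rw [← hcard, mul_add]
  exact add_le_add h1 (Nat.mul_le_mul_left _ h2)

variable [∀ z, Fintype (W z)]

open Classical in
/-- The states of the lamp at `u` for which the configuration remains in `U`. -/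
noncomputable def lampSlice (φ : ℤ → L) (U : Finset (ℤ × LampConfig W o))
    (u : ℤ × LampConfig W o) : Finset (W (φ u.1)) :=
  Finset.univ.filter fun v => (u.1, u.2.switch (φ u.1) v) ∈ U

theorem mem_lampSlice {U : Finset (ℤ × LampConfig W o)} {u : ℤ × LampConfig W o}
    {v : W (φ u.1)} : v ∈ lampSlice φ U u ↔ (u.1, u.2.switch (φ u.1) v) ∈ U := by
  simp [lampSlice]

open Classical in
/-- The points of `U` at which the slice in the direction of the lamp has a large boundary. -/
noncomputable def badPoints (φ : ℤ → L) (B : ∀ z, SimpleGraph (W z)) (h : ℝ)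
    (U : Finset (ℤ × LampConfig W o)) : Finset (ℤ × LampConfig W o) :=
  U.filter fun u => h * (lampSlice φ U u).card ≤
    (edgeBoundary (B (φ u.1)) (lampSlice φ U u)).ncard

/-- Points that differ only in the state of the walker's lamp share one slice, and the map `cl`
labels these classes. The fibre boundary of a bad slice embeds in ∂U, and different classes use
disjoint sets of edges. -/
theorem mul_card_badPoints_le {h : ℝ} (hh : 0 ≤ h) (U : Finset (ℤ × LampConfig W o))
    (hfin : (edgeBoundary (generalizedWreath intGraph φ W B o) U).Finite) :
    h * (badPoints φ B h U).card ≤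
      (edgeBoundary (generalizedWreath intGraph φ W B o) U).ncard := by
  classical
  set E := hfin.toFinset
  rw [Set.ncard_eq_toFinset_card _ hfin]
  set cl : ℤ × LampConfig W o → ℤ × LampConfig W o :=
    fun u => (u.1, u.2.switch (φ u.1) (o (φ u.1))) with hcl
  set bad := badPoints φ B h U
  have h1 : bad.card = ∑ q ∈ bad.image cl, (bad.filter fun u => cl u = q).card :=
    Finset.card_eq_sum_card_fiberwise fun u hu => Finset.mem_image_of_mem _ hu
  have h2 : ∑ q ∈ bad.image cl, (E.filter fun e => cl e.1 = q).card ≤ E.card := by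
    rw [← Finset.card_biUnion]
    · refine Finset.card_le_card fun e he => ?_
      obtain ⟨q, -, hq⟩ := Finset.mem_biUnion.1 he
      exact (Finset.mem_filter.1 hq).1
    · intro q _ q' _ hne
      refine Finset.disjoint_left.2 fun e he he' => hne ?_
      rw [← (Finset.mem_filter.1 he).2, (Finset.mem_filter.1 he').2]
  have h3 : ∀ q ∈ bad.image cl, h * ((bad.filter fun u => cl u = q).card : ℝ) ≤
      ((E.filter fun e => cl e.1 = q).card : ℝ) := by
    intro q hq
    obtain ⟨⟨a, f⟩, hu₀, rfl⟩ := Finset.mem_image.1 hq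
    obtain ⟨hu₀U, hu₀b⟩ := Finset.mem_filter.1 hu₀
    have h4 : (bad.filter fun u => cl u = cl (a, f)).card ≤ (lampSlice φ U (a, f)).card := by
      refine Finset.card_le_card_of_surjOn (fun v => (a, f.switch (φ a) v)) ?_
      rintro ⟨b, g⟩ hg
      obtain ⟨hgb, hgc⟩ := Finset.mem_filter.1 hg
      obtain ⟨rfl, hgc⟩ := Prod.mk.inj hgc
      dsimp only at hgc
      have h5 : g = f.switch (φ b) (g.1 (φ b)) := LampConfig.eq_switch fun y hy => by
        have : (g.switch (φ b) (o (φ b))).1 y = (f.switch (φ b) (o (φ b))).1 y := by rw [hgc]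
        rwa [LampConfig.switch_apply_of_ne _ hy, LampConfig.switch_apply_of_ne _ hy,
          eq_comm] at this
      refine ⟨g.1 (φ b), ?_, ?_⟩
      · rw [Finset.mem_coe, mem_lampSlice]
        dsimp only
        rw [← h5]
        exact (Finset.mem_filter.1 hgb).1
      · dsimp only
        rw [← h5]
    have h6 : (edgeBoundary (B (φ a)) (lampSlice φ U (a, f))).ncard ≤
        (E.filter fun e => cl e.1 = cl (a, f)).card := by
      rw [← Set.ncard_coe_finset]
      refine Set.ncard_le_ncard_of_injOn
        (fun p => ((a, f.switch (φ a) p.1), (a, f.switch (φ a) p.2))) ?_ ?_ (Set.toFinite _)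
      · rintro ⟨v, w⟩ ⟨hvw, hv, hw⟩
        dsimp only at hvw hv hw
        rw [mem_lampSlice] at hv hw
        rw [Finset.mem_coe, Finset.mem_filter]
        refine ⟨?_, ?_⟩
        · simp only [E, Set.Finite.mem_toFinset]
          refine ⟨(wreath_adj_iff _ _).2 (Or.inr ⟨w, ?_, ?_⟩), hv, hw⟩
          · simpa only [LampConfig.switch_apply_same] using hvw
          · simp only [LampConfig.switch_switch]
        · simp only [hcl, LampConfig.switch_switch]
      · rintro ⟨v, w⟩ - ⟨v', w'⟩ - heq
        simp only [Prod.mk.injEq, true_and] at heq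
        have e1 : (f.switch (φ a) v).1 (φ a) = (f.switch (φ a) v').1 (φ a) := by rw [heq.1]
        have e2 : (f.switch (φ a) w).1 (φ a) = (f.switch (φ a) w').1 (φ a) := by rw [heq.2]
        rw [LampConfig.switch_apply_same, LampConfig.switch_apply_same] at e1 e2
        rw [e1, e2]
    calc h * ((bad.filter fun u => cl u = cl (a, f)).card : ℝ)
        ≤ h * ((lampSlice φ U (a, f)).card : ℝ) := by gcongr
      _ ≤ _ := hu₀b
      _ ≤ _ := by exact_mod_cast h6
  calc h * (bad.card : ℝ) = ∑ q ∈ bad.image cl, h * ((bad.filter fun u => cl u = q).card : ℝ) := by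
        rw [h1]; push_cast; rw [Finset.mul_sum]
    _ ≤ ∑ q ∈ bad.image cl, ((E.filter fun e => cl e.1 = q).card : ℝ) := Finset.sum_le_sum h3
    _ ≤ E.card := by exact_mod_cast h2

end Isoperimetry

/-! ### Exponential isoperimetry and decay for wreath products -/

section WreathIsoperimetry

variable {L : Type} {W : L → Type} {o : ∀ z, W z}

-- Pigeonhole over windows. Non-emptiness is part of the claim because an untouched window satisfies
-- the inequality trivially.
open Classical in
theorem exists_window {U : Finset (ℤ × LampConfig W o)} {k : ℕ} {Γ : Finset (ℤ × LampConfig W o)}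
    (hU : U.Nonempty) (hΓ : k * (windowTrace U k).card ≤ 4 * Γ.card) (hΓU : Γ ⊆ U) :
    ∃ j : ℤ, ((windowTrace U k).filter fun q => q.1 = j).Nonempty ∧
      k * ((windowTrace U k).filter fun q => q.1 = j).card ≤
        4 * (Γ.filter fun u => u.1 / (k : ℤ) = j).card := by
  set Q := windowTrace U k
  have hQ : Q.Nonempty := hU.image _
  by_contra hcon
  push Not at hcon
  have h1 : Q.card = ∑ j ∈ Q.image Prod.fst, (Q.filter fun q => q.1 = j).card :=
    Finset.card_eq_sum_card_fiberwise fun q hq => Finset.mem_image_of_mem _ hq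
  have h2 : Γ.card = ∑ j ∈ Q.image Prod.fst, (Γ.filter fun u => u.1 / (k : ℤ) = j).card :=
    Finset.card_eq_sum_card_fiberwise fun u hu =>
      Finset.mem_image.2 ⟨(u.1 / (k : ℤ), u.2), Finset.mem_image_of_mem _ (hΓU hu), rfl⟩
  have h3 : 4 * Γ.card < k * Q.card := by
    rw [h1, h2, Finset.mul_sum, Finset.mul_sum]
    refine Finset.sum_lt_sum_of_nonempty (hQ.image _) fun j hj => hcon j ?_
    obtain ⟨q, hq, rfl⟩ := Finset.mem_image.1 hj
    exact ⟨q, Finset.mem_filter.2 ⟨hq, rfl⟩⟩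
  omega

variable [DecidableEq L] {φ : ℤ → L} {B : ∀ z, SimpleGraph (W z)} [∀ z, Fintype (W z)]

/-- Sets with a small boundary in the fibre `B z` have size at least a power of `|B z|`. -/
def SmallSetExpansion (B : ∀ z, SimpleGraph (W z)) (h κ : ℝ) : Prop :=
  ∀ (z : L) (T : Finset (W z)), T.Nonempty → ((edgeBoundary (B z) T).ncard : ℝ) < h * T.card →
    κ * Real.log (Fintype.card (W z)) ≤ Real.log T.card

/-- A positive proportion of a window of length `k` sees lamps of total entropy `≽ k ^ β`. -/
def WindowEntropy (φ : ℤ → L) (W : L → Type) [∀ z, Fintype (W z)] (β c : ℝ) : Prop :=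
  ∀ (k : ℕ), 1 ≤ k → ∀ (j : ℤ) (S : Finset ℤ), (∀ a ∈ S, a / (k : ℤ) = j) → k ≤ 8 * S.card →
    c * (k : ℝ) ^ β ≤ ∑ x ∈ S.image φ, Real.log (Fintype.card (W x))

/-- A window in which most configurations have many good points has many configurations. -/
theorem log_card_ge_of_window {h κ β c : ℝ} (hκ : 0 < κ) (hB : SmallSetExpansion B h κ)
    (hφ : WindowEntropy φ W β c) {U : Finset (ℤ × LampConfig W o)} {k : ℕ} (hk : 1 ≤ k)
    (j : ℤ) (F : Finset (LampConfig W o)) (hF : F.Nonempty)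
    (hFU : ∀ a f, (a, f) ∈ U → a / (k : ℤ) = j → f ∈ F) (g : LampConfig W o → Finset ℤ)
    (hg : ∀ f ∈ F, ∀ a ∈ g f, a / (k : ℤ) = j ∧ (a, f) ∈ U ∧ (a, f) ∉ badPoints φ B h U)
    (hmany : k * F.card ≤ 4 * ∑ f ∈ F, (g f).card) :
    κ * c * (k : ℝ) ^ β / 8 ≤ Real.log F.card := by
  classical
  have hk0 : (0 : ℤ) < k := by exact_mod_cast hk
  have hinj : Function.Injective fun f : LampConfig W o => f.1 := fun f g h => Subtype.ext h
  set F' : Finset (∀ z, W z) := F.image fun f => f.1 with hF'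
  have hF'card : F'.card = F.card := Finset.card_image_of_injective _ hinj
  have hgk : ∀ f ∈ F, (g f).card ≤ k := by
    intro f hf
    have hIco : (Finset.Ico (j * k) (j * k + k)).card = k := by simp
    rw [← hIco]
    refine Finset.card_le_card fun a ha => ?_
    have := (Int.ediv_eq_iff_of_pos hk0).1 (hg f hf a ha).1
    rw [Finset.mem_Ico]
    constructor <;> nlinarith [this.1, this.2]
  -- The sets g f have at most k elements and on average at least k/4, so at least an eighth of the
  -- configurations have k/8 good positions.
  set R := F.filter fun f => k ≤ 8 * (g f).card with hR
  have hRcard : F.card ≤ 8 * R.card := by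
    have h1 : ∑ f ∈ F, 8 * (g f).card ≤ ∑ f ∈ F, (k + if k ≤ 8 * (g f).card then 8 * k else 0) := by
      refine Finset.sum_le_sum fun f hf => ?_
      have := hgk f hf
      split_ifs <;> omega
    rw [Finset.sum_add_distrib, ← Finset.sum_filter, ← Finset.mul_sum] at h1
    simp only [Finset.sum_const, smul_eq_mul] at h1
    rw [← hR] at h1
    have h2 : k * F.card ≤ k * (8 * R.card) := by nlinarith
    exact Nat.le_of_mul_le_mul_left h2 hk
  set Λ : Finset L := F.biUnion fun f => (g f).image φ with hΛ
  have hhan := sum_log_card_slices_le Λ F'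
  rw [hF'card] at hhan
  obtain ⟨Φ, hΦ⟩ : ∃ Φ : (∀ z, W z) → ℝ, ∀ f, Φ f =
    ∑ x ∈ Λ, Real.log (F'.filter fun g => ∀ y, y ≠ x → g y = f y).card := ⟨_, fun _ => rfl⟩
  have hΦ0 : ∀ f, 0 ≤ Φ f := fun f => by
    rw [hΦ]
    exact Finset.sum_nonneg fun x _ => Real.log_natCast_nonneg _
  simp only [← hΦ] at hhan
  rw [hF', Finset.sum_image hinj.injOn] at hhan
  -- At a good position the lamp slice is large by expansion. It embeds in the slice of F along that
  -- lamp, because F contains every configuration that U has over the window.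
  have hrich : ∀ f ∈ R, κ * (c * (k : ℝ) ^ β) ≤ Φ f.1 := by
    intro f hf
    rw [hΦ]
    obtain ⟨hfF, hfk⟩ := Finset.mem_filter.1 hf
    have h1 := hφ k hk j (g f) (fun a ha => (hg f hfF a ha).1) hfk
    have h2 : (g f).image φ ⊆ Λ := Finset.subset_biUnion_of_mem (fun f => (g f).image φ) hfF
    calc κ * (c * (k : ℝ) ^ β)
        ≤ κ * ∑ x ∈ (g f).image φ, Real.log (Fintype.card (W x)) := by gcongr
      _ ≤ ∑ x ∈ (g f).image φ, Real.log (F'.filter fun g => ∀ y, y ≠ x → g y = f.1 y).card := by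
          rw [Finset.mul_sum]
          refine Finset.sum_le_sum fun x hx => ?_
          obtain ⟨a, ha, rfl⟩ := Finset.mem_image.1 hx
          obtain ⟨haj, haU, hab⟩ := hg f hfF a ha
          have hne : (lampSlice φ U (a, f)).Nonempty :=
            ⟨f.1 (φ a), mem_lampSlice.2 (by dsimp only; rwa [LampConfig.switch_self])⟩
          have hlt : ((edgeBoundary (B (φ a)) (lampSlice φ U (a, f))).ncard : ℝ) <
              h * (lampSlice φ U (a, f)).card := by
            by_contra hcon
            exact hab (Finset.mem_filter.2 ⟨haU, not_lt.1 hcon⟩)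
          refine (hB (φ a) _ hne hlt).trans ?_
          refine Real.log_le_log (by exact_mod_cast hne.card_pos) ?_
          norm_cast
          refine Finset.card_le_card_of_injOn (fun v => Function.update f.1 (φ a) v) ?_ ?_
          · intro v hv
            rw [Finset.mem_coe, Finset.mem_filter]
            refine ⟨Finset.mem_image.2 ⟨f.switch (φ a) v, hFU a _ ?_ haj, rfl⟩, fun y hy => ?_⟩
            · exact mem_lampSlice.1 hv
            · exact Function.update_of_ne hy _ _
          · intro v _ w _ hvw
            exact Function.update_injective f.1 (φ a) hvw
      _ ≤ _ := Finset.sum_le_sum_of_subset_of_nonneg h2 fun x _ _ => Real.log_natCast_nonneg _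
  have hsum : (R.card : ℝ) * (κ * (c * (k : ℝ) ^ β)) ≤ F.card * Real.log F.card := by
    rw [← nsmul_eq_mul]
    refine (Finset.card_nsmul_le_sum _ _ _ hrich).trans (le_trans ?_ hhan)
    exact Finset.sum_le_sum_of_subset_of_nonneg (Finset.filter_subset _ _) fun f _ _ => hΦ0 f.1
  have hF0 : (0 : ℝ) < F.card := by exact_mod_cast hF.card_pos
  rcases le_or_gt (κ * (c * (k : ℝ) ^ β)) 0 with hneg | hpos
  · have := Real.log_natCast_nonneg F.card
    linarith
  · have h1 : (F.card : ℝ) ≤ 8 * R.card := by exact_mod_cast hRcard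
    have h2 : (F.card : ℝ) * (κ * c * (k : ℝ) ^ β / 8) ≤ F.card * Real.log F.card := by
      nlinarith
    exact le_of_mul_le_mul_left h2 hF0

/-- If kh ≥ 2, at most half of U is bad. Hence k|Q| ≤ 2|U| ≤ 4|Γ| for the window trace Q and the
good points Γ, and some window is rich enough for `log_card_ge_of_window`. -/
theorem expIsoperimetry_wreath {h κ β c : ℝ} (hh : 0 < h) (hκ : 0 < κ) (hc : 0 < c) (hβ : 0 < β)
    (hB : SmallSetExpansion B h κ) (hφ : WindowEntropy φ W β c)
    (hfin : ∀ U, (edgeBoundary (generalizedWreath intGraph φ W B o) U).Finite) :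
    ExpIsoperimetry (generalizedWreath intGraph φ W B o) β := by
  classical
  obtain ⟨k₀, hk₀⟩ := exists_nat_ge (2 / h)
  set c' : ℝ := κ * c / 8 with hc'
  have hc'0 : 0 < c' := by positivity
  -- The last term makes the bound at most 1 for k ≤ k₀, where |U| ≥ 1 suffices.
  refine ⟨min (min c' 1) (Real.exp (-(c' * (k₀ : ℝ) ^ β))), by positivity, fun k U hU hk => ?_⟩
  set d := min (min c' 1) (Real.exp (-(c' * (k₀ : ℝ) ^ β))) with hd
  have hd0 : 0 < d := by positivity
  have hd1 : d ≤ c' := (min_le_left _ _).trans (min_le_left _ _)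
  have hd2 : d ≤ 1 := (min_le_left _ _).trans (min_le_right _ _)
  have hd3 : d ≤ Real.exp (-(c' * (k₀ : ℝ) ^ β)) := min_le_right _ _
  have hU1 : (1 : ℝ) ≤ U.card := by exact_mod_cast hU.card_pos
  have hkβ : 0 ≤ (k : ℝ) ^ β := by positivity
  rcases le_or_gt k k₀ with hkk | hkk
  · refine le_trans ?_ hU1
    calc d * Real.exp (d * (k : ℝ) ^ β)
        ≤ Real.exp (-(c' * (k₀ : ℝ) ^ β)) * Real.exp (c' * (k₀ : ℝ) ^ β) := by gcongr
      _ = 1 := by rw [← Real.exp_add]; simp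
  have hk1 : 1 ≤ k := by omega
  set E := (edgeBoundary (generalizedWreath intGraph φ W B o) U).ncard with hE
  set Γ := U \ badPoints φ B h U with hΓ
  have hbadU : badPoints φ B h U ⊆ U := Finset.filter_subset _ _
  have hΓcard : Γ.card + (badPoints φ B h U).card = U.card := Finset.card_sdiff_add_card_eq_card hbadU
  have hbad : 2 * (badPoints φ B h U).card ≤ U.card := by
    have h1 := mul_card_badPoints_le (φ := φ) (B := B) hh.le U (hfin U)
    rw [← hE] at h1
    have h2 : (k : ℝ) * E ≤ U.card := by exact_mod_cast hk
    have h3 : 2 / h ≤ k := hk₀.trans (by exact_mod_cast hkk.le)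
    rw [div_le_iff₀ hh] at h3
    have h4 : (0 : ℝ) ≤ (badPoints φ B h U).card := Nat.cast_nonneg _
    have h5 : (2 : ℝ) * (badPoints φ B h U).card ≤ U.card := by
      calc (2 : ℝ) * (badPoints φ B h U).card ≤ k * h * (badPoints φ B h U).card := by gcongr
        _ = k * (h * (badPoints φ B h U).card) := by ring
        _ ≤ k * E := by gcongr
        _ ≤ _ := h2
    exact_mod_cast h5
  have htrace := mul_card_windowTrace_le U hk1 (hfin U)
  rw [← hE] at htrace
  obtain ⟨j, hjne, hj⟩ := exists_window hU (k := k) (Γ := Γ) (by omega) Finset.sdiff_subset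
  set Qj := (windowTrace U k).filter fun q => q.1 = j with hQj
  set F := Qj.image Prod.snd with hF
  have hFcard : F.card = Qj.card := by
    refine Finset.card_image_of_injOn fun p hp q hq hpq => ?_
    exact Prod.ext ((Finset.mem_filter.1 hp).2.trans (Finset.mem_filter.1 hq).2.symm) hpq
  have hFU : ∀ a f, (a, f) ∈ U → a / (k : ℤ) = j → f ∈ F := fun a f haf haj =>
    Finset.mem_image.2 ⟨(j, f), Finset.mem_filter.2
      ⟨Finset.mem_image.2 ⟨(a, f), haf, by simp [haj]⟩, rfl⟩, rfl⟩
  set g : LampConfig W o → Finset ℤ := fun f =>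
    (Γ.filter fun u => u.1 / (k : ℤ) = j ∧ u.2 = f).image Prod.fst with hg
  have hgsum : (Γ.filter fun u => u.1 / (k : ℤ) = j).card ≤ ∑ f ∈ F, (g f).card := by
    rw [Finset.card_eq_sum_card_fiberwise (f := Prod.snd) (t := F) fun u hu => by
      have := Finset.mem_filter.1 hu
      exact hFU u.1 u.2 (Finset.mem_sdiff.1 this.1).1 this.2]
    refine Finset.sum_le_sum fun f _ => ?_
    rw [Finset.filter_filter]
    refine le_of_eq (Finset.card_image_of_injOn fun p hp q hq hpq => ?_).symm
    exact Prod.ext hpq ((Finset.mem_filter.1 hp).2.2.trans (Finset.mem_filter.1 hq).2.2.symm)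
  have hlog := log_card_ge_of_window hκ hB hφ hk1 j F (hjne.image _) hFU g
    (fun f _ a ha => by
      obtain ⟨⟨a, f⟩, hu, rfl⟩ := Finset.mem_image.1 ha
      obtain ⟨huΓ, huj, rfl⟩ := Finset.mem_filter.1 hu
      exact ⟨huj, Finset.mem_sdiff.1 huΓ⟩)
    (by rw [hFcard]; omega)
  have hF0 : (0 : ℝ) < F.card := by exact_mod_cast (hjne.image _).card_pos
  have hFle : F.card ≤ U.card := by
    rw [hFcard]
    exact (Finset.card_le_card (Finset.filter_subset _ _)).trans Finset.card_image_le
  calc d * Real.exp (d * (k : ℝ) ^ β) ≤ 1 * Real.exp (c' * (k : ℝ) ^ β) := by gcongr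
    _ = Real.exp (κ * c * (k : ℝ) ^ β / 8) := by rw [one_mul, hc']; congr 1; ring
    _ ≤ F.card := by rwa [← Real.le_log_iff_exp_le hF0]
    _ ≤ U.card := by exact_mod_cast hFle

/-- The decay of the wreath product, from the properties of its fibres and of the lamp map. -/
theorem hasExpectedDecay_wreath {α β h κ c C : ℝ} {M : ℕ} (hα : 0 < α) (hα1 : α < 1)
    (hαβ : β = 2 * α / (1 - α)) (hh : 0 < h) (hκ : 0 < κ) (hc : 0 < c) (hC : 0 < C)
    (hM : ∀ z x, valency (B z) x ≤ M) (hB : SmallSetExpansion B h κ)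
    (hφ : WindowEntropy φ W β c)
    (hgrowth : ∀ m : ℕ, ∏ x ∈ (Finset.Icc (-m : ℤ) m).image φ, (Fintype.card (W x) : ℝ) ≤
      Real.exp (C * ((m : ℝ) + 1) ^ β)) :
    HasExpectedDecay α (generalizedWreath intGraph φ W B o) (0, LampConfig.rest W o) := by
  have hβ : 0 < β := by
    rw [hαβ]
    have : 0 < 1 - α := by linarith
    positivity
  have hbd := wreath_neighborSet_encard_le (φ := φ) (o := o) hM
  have hnf : ∀ x, ((generalizedWreath intGraph φ W B o).neighborSet x).Finite := fun x =>
    Set.encard_lt_top_iff.1 (lt_of_le_of_lt (hbd x) (ENat.natCast_lt_top _))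
  have : (generalizedWreath intGraph φ W B o).LocallyFinite := fun x => (hnf x).fintype
  have hD : ∀ x, (generalizedWreath intGraph φ W B o).degree x ≤ M + 2 := fun x => by
    rw [← valency_eq_degree, valency]
    have := hbd x
    rw [← (hnf x).cast_ncard_eq] at this
    exact_mod_cast this
  have hfin : ∀ U, (edgeBoundary (generalizedWreath intGraph φ W B o) U).Finite := fun U => by
    refine Set.Finite.subset (Set.Finite.biUnion U.finite_toSet
      fun x _ => (hnf x).image fun y => (x, y)) ?_
    rintro ⟨x, y⟩ ⟨hxy, hx, -⟩
    exact Set.mem_biUnion hx ⟨y, hxy, rfl⟩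
  have hiso := expIsoperimetry_wreath hh hκ hc hβ hB hφ hfin
  have htube := exists_tubeGrowth hβ hC hgrowth
  have hne : ∀ k, (folnerSets (generalizedWreath intGraph φ W B o) k).Nonempty := fun k =>
    ⟨_, tube_mem_folnerSets k⟩
  exact ⟨⟨M + 2, hbd⟩, hne,
    ⟨htube.folner_dominated hβ hαβ, hiso.profileF_dominated_folner hβ hαβ hne⟩,
    ⟨hiso.transProb_dominated hD (by omega) hα hα1 hαβ _,
      htube.dominated_transProb hD hα hα1 hαβ⟩⟩

end WreathIsoperimetry

/-! ### Finite connected graphs in which small sets expand -/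

section Expander

theorem card_perm_eqOn_le {α : Type*} [Fintype α] [DecidableEq α] (S : Finset α)
    (π₀ : Equiv.Perm α) :
    (Finset.univ.filter fun π : Equiv.Perm α => ∀ x ∈ S, π x = π₀ x).card ≤
      (Fintype.card α - S.card).factorial := by
  have h1 : Fintype.card {σ : Equiv.Perm α // ∀ a, ¬a ∉ S → σ a = a} =
      (Fintype.card α - S.card).factorial := by
    rw [← Fintype.card_congr (Equiv.Perm.subtypeEquivSubtypePerm fun a => a ∉ S),
      Fintype.card_perm]
    congr 1
    rw [Fintype.card_subtype_compl fun a => a ∈ S]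
    simp
  rw [← h1, Fintype.card_subtype]
  refine Finset.card_le_card_of_injOn (fun π => π₀⁻¹ * π) (fun π hπ => ?_)
    (fun π _ π' _ h => mul_left_cancel h)
  simp only [Finset.coe_filter, Finset.mem_univ, true_and, Set.mem_ofPred_eq] at hπ ⊢
  intro a ha
  simp [hπ a (not_not.1 ha)]

/-- There are at most |T|^|S| restrictions to S, and each extends in at most (N - |S|)! ways, N
being the size of the type. -/
theorem card_perm_mapsTo_le {α : Type*} [Fintype α] [DecidableEq α] (S T : Finset α) :
    (Finset.univ.filter fun π : Equiv.Perm α => ∀ x ∈ S, π x ∈ T).card ≤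
      (Fintype.card α - S.card).factorial * T.card ^ S.card := by
  set A := Finset.univ.filter fun π : Equiv.Perm α => ∀ x ∈ S, π x ∈ T
  refine (Finset.card_le_mul_card_image (f := fun (π : Equiv.Perm α) (x : S) => π x) A
    (Fintype.card α - S.card).factorial fun b hb => ?_).trans (Nat.mul_le_mul_left _ ?_)
  · obtain ⟨π₀, -, rfl⟩ := Finset.mem_image.1 hb
    refine (Finset.card_le_card fun π hπ => ?_).trans (card_perm_eqOn_le S π₀)
    have h := (Finset.mem_filter.1 hπ).2
    exact Finset.mem_filter.2 ⟨Finset.mem_univ _, fun x hx => congrFun h ⟨x, hx⟩⟩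
  · have h : (Fintype.piFinset fun _ : S => T).card = T.card ^ S.card := by simp
    rw [← h]
    refine Finset.card_le_card fun b hb => ?_
    obtain ⟨π, hπ, rfl⟩ := Finset.mem_image.1 hb
    exact Fintype.mem_piFinset.2 fun x => (Finset.mem_filter.1 hπ).2 x x.2

/-- The union bound for sets of size s: N^s choices of S, N^(2s) of T, and four permutations mapping
S into T. Four permutations save about N^(4s), which beats N^(3s). The constant is 512 = 16 · 2⁴ ·
2, with 16 from N ≤ 2(N - s); the factor 2^s makes the sum over s converge. -/
theorem factorial_bound {N s : ℕ} (hs : 1 ≤ s) (h : 512 * s ^ 4 ≤ N) :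
    N ^ s * N ^ (2 * s) * ((N - s).factorial * (2 * s) ^ s) ^ 4 * 2 ^ s ≤ N.factorial ^ 4 := by
  have hs4 : s ≤ s ^ 4 := Nat.le_self_pow (by norm_num) s
  have hsN : 2 * s ≤ N := by omega
  have h1 : (N - s).factorial * (N - s) ^ s ≤ N.factorial := by
    have := Nat.factorial_mul_pow_sub_le_factorial (Nat.sub_le N s)
    rwa [show N - (N - s) = s by omega] at this
  have h2 : N ≤ 2 * (N - s) := by omega
  have h3 : N ^ 3 * (2 * s) ^ 4 * 2 ≤ (N - s) ^ 4 := by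
    have h4 : 16 * (N ^ 3 * (2 * s) ^ 4 * 2) ≤ 16 * (N - s) ^ 4 := by
      calc 16 * (N ^ 3 * (2 * s) ^ 4 * 2) = N ^ 3 * (512 * s ^ 4) := by ring
        _ ≤ N ^ 3 * N := Nat.mul_le_mul_left _ h
        _ = N ^ 4 := by ring
        _ ≤ (2 * (N - s)) ^ 4 := Nat.pow_le_pow_left h2 4
        _ = _ := by ring
    omega
  have h5 : ∀ t : ℕ, (N ^ 3 * t ^ 4 * 2) ^ s = N ^ s * N ^ (2 * s) * (t ^ s) ^ 4 * 2 ^ s :=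
    fun t => by rw [mul_pow, mul_pow]; ring
  calc N ^ s * N ^ (2 * s) * ((N - s).factorial * (2 * s) ^ s) ^ 4 * 2 ^ s
      = (N - s).factorial ^ 4 * (N ^ 3 * (2 * s) ^ 4 * 2) ^ s := by rw [h5]; ring
    _ ≤ (N - s).factorial ^ 4 * ((N - s) ^ 4) ^ s :=
        Nat.mul_le_mul_left _ (Nat.pow_le_pow_left h3 s)
    _ = ((N - s).factorial * (N - s) ^ s) ^ 4 := by ring
    _ ≤ _ := Nat.pow_le_pow_left h1 4

/-- Four permutations for which all small sets expand. -/
theorem exists_expanding_perms (N : ℕ) : ∃ π : Fin 4 → Equiv.Perm (Fin N),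
    ∀ S : Finset (Fin N), S.Nonempty → 512 * S.card ^ 4 ≤ N →
      2 * S.card < (S.biUnion fun x => Finset.univ.image fun i => π i x).card := by
  classical
  by_contra hcon
  push Not at hcon
  set bad : Finset (Fin N) → Finset (Fin N) → Finset (Fin 4 → Equiv.Perm (Fin N)) := fun S T =>
    Fintype.piFinset fun _ => Finset.univ.filter fun π : Equiv.Perm (Fin N) => ∀ x ∈ S, π x ∈ T
    with hbad
  set I : Finset ℕ := (Finset.range (N + 1)).filter fun s => 1 ≤ s ∧ 512 * s ^ 4 ≤ N with hI
  have hcover : (Finset.univ : Finset (Fin 4 → Equiv.Perm (Fin N))) ⊆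
      I.biUnion fun s => (Finset.powersetCard s Finset.univ).biUnion fun S =>
        (Finset.powersetCard (2 * s) Finset.univ).biUnion fun T => bad S T := by
    intro π _
    obtain ⟨S, hS, hSN, hcard⟩ := hcon π
    have hs4 : S.card ≤ S.card ^ 4 := Nat.le_self_pow (by norm_num) _
    have h2 : 2 * S.card ≤ (Finset.univ : Finset (Fin N)).card := by
      rw [Finset.card_univ, Fintype.card_fin]; omega
    obtain ⟨T, hT, -, hTcard⟩ := Finset.exists_subsuperset_card_eq
      (Finset.subset_univ (S.biUnion fun x => Finset.univ.image fun i => π i x)) hcard h2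
    refine Finset.mem_biUnion.2 ⟨S.card, Finset.mem_filter.2 ⟨Finset.mem_range.2 (by omega),
      hS.card_pos, hSN⟩, Finset.mem_biUnion.2 ⟨S, by simp,
      Finset.mem_biUnion.2 ⟨T, by simp [hTcard], Fintype.mem_piFinset.2 fun i => ?_⟩⟩⟩
    refine Finset.mem_filter.2 ⟨Finset.mem_univ _, fun x hx => hT ?_⟩
    exact Finset.mem_biUnion.2 ⟨x, hx, Finset.mem_image_of_mem _ (Finset.mem_univ i)⟩
  have hle := Finset.card_le_card hcover
  have htotal : (Finset.univ : Finset (Fin 4 → Equiv.Perm (Fin N))).card = N.factorial ^ 4 := by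
    simp [Fintype.card_perm]
  have hs : ∀ s ∈ I, (((Finset.powersetCard s (Finset.univ : Finset (Fin N))).biUnion fun S =>
        (Finset.powersetCard (2 * s) Finset.univ).biUnion fun T => bad S T).card : ℝ) ≤
        (N.factorial : ℝ) ^ 4 * (1 / 2) ^ s := by
    intro s hs
    obtain ⟨-, hs1, hsN⟩ := Finset.mem_filter.1 hs
    have h1 : ((Finset.powersetCard s (Finset.univ : Finset (Fin N))).biUnion fun S =>
        (Finset.powersetCard (2 * s) Finset.univ).biUnion fun T => bad S T).card ≤
        N ^ s * N ^ (2 * s) * ((N - s).factorial * (2 * s) ^ s) ^ 4 := by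
      rw [mul_assoc]
      refine (Finset.card_biUnion_le_card_mul _ _
        (N ^ (2 * s) * ((N - s).factorial * (2 * s) ^ s) ^ 4) fun S hS => ?_).trans
        (Nat.mul_le_mul_right _ ?_)
      · refine (Finset.card_biUnion_le_card_mul _ _
          (((N - s).factorial * (2 * s) ^ s) ^ 4) fun T hT => ?_).trans (Nat.mul_le_mul_right _ ?_)
        · have h2 := card_perm_mapsTo_le S T
          rw [(Finset.mem_powersetCard.1 hS).2, (Finset.mem_powersetCard.1 hT).2,
            Fintype.card_fin] at h2
          simp only [hbad, Fintype.card_piFinset, Finset.prod_const, Finset.card_univ,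
            Fintype.card_fin]
          convert Nat.pow_le_pow_left h2 4
        · rw [Finset.card_powersetCard, Finset.card_univ, Fintype.card_fin]
          exact Nat.choose_le_pow _ _
      · rw [Finset.card_powersetCard, Finset.card_univ, Fintype.card_fin]
        exact Nat.choose_le_pow _ _
    have h2 := (Nat.mul_le_mul_right (2 ^ s) h1).trans (factorial_bound hs1 hsN)
    rw [one_div, inv_pow, ← div_eq_mul_inv, le_div_iff₀ (by positivity)]
    exact_mod_cast h2
  have hfinal : (N.factorial : ℝ) ^ 4 < (N.factorial : ℝ) ^ 4 := by
    have hI2 : I ⊆ (Finset.range (N + 1)).erase 0 := fun s hs => by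
      obtain ⟨h, h1, -⟩ := Finset.mem_filter.1 hs
      exact Finset.mem_erase.2 ⟨by omega, h⟩
    -- Since s ≥ 1 and s ≤ N, the sum is strictly less than 1, so the bad families do not exhaust
    -- all quadruples.
    have hgeom : ∑ s ∈ I, (1 / 2 : ℝ) ^ s < 1 := by
      refine (Finset.sum_le_sum_of_subset_of_nonneg hI2 fun _ _ _ => by positivity).trans_lt ?_
      have h1 := Finset.add_sum_erase (Finset.range (N + 1)) (fun s => (1 / 2 : ℝ) ^ s)
        (Finset.mem_range.2 (Nat.succ_pos N))
      have h2 := geom_sum_eq (by norm_num : (1 / 2 : ℝ) ≠ 1) (N + 1)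
      have h3 : (0 : ℝ) < (1 / 2) ^ (N + 1) := by positivity
      simp only [pow_zero] at h1
      rw [h2] at h1
      have h4 : ((1 / 2 : ℝ) ^ (N + 1) - 1) / (1 / 2 - 1) = 2 - 2 * (1 / 2) ^ (N + 1) := by
        norm_num; ring
      linarith
    calc (N.factorial : ℝ) ^ 4
        = ((Finset.univ : Finset (Fin 4 → Equiv.Perm (Fin N))).card : ℝ) := by
          rw [htotal]; push_cast; rfl
      _ ≤ ∑ s ∈ I, (((Finset.powersetCard s (Finset.univ : Finset (Fin N))).biUnion fun S =>
            (Finset.powersetCard (2 * s) Finset.univ).biUnion fun T => bad S T).card : ℝ) := by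
          exact_mod_cast hle.trans Finset.card_biUnion_le
      _ ≤ ∑ s ∈ I, (N.factorial : ℝ) ^ 4 * (1 / 2) ^ s := Finset.sum_le_sum hs
      _ = (N.factorial : ℝ) ^ 4 * ∑ s ∈ I, (1 / 2 : ℝ) ^ s := by rw [Finset.mul_sum]
      _ < (N.factorial : ℝ) ^ 4 * 1 := by gcongr
      _ = _ := mul_one _
  exact lt_irrefl _ hfinal

/-- The union of the path with the orbits of four permutations. -/
def permGraph {N : ℕ} (π : Fin 4 → Equiv.Perm (Fin N)) : SimpleGraph (Fin N) :=
  SimpleGraph.fromRel fun x y => (∃ i, π i x = y) ∨ x.val + 1 = y.val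

theorem valency_permGraph_le {N : ℕ} (π : Fin 4 → Equiv.Perm (Fin N)) (x : Fin N) :
    valency (permGraph π) x ≤ 10 := by
  classical
  have hsub : (permGraph π).neighborSet x ⊆
      (((Finset.univ.image fun i => π i x) ∪ (Finset.univ.image fun i => (π i)⁻¹ x) ∪
        ((Finset.univ.filter fun y : Fin N => x.val + 1 = y.val) ∪
          (Finset.univ.filter fun y : Fin N => y.val + 1 = x.val)) : Finset (Fin N)) :
        Set (Fin N)) := by
    intro y hy
    rw [SimpleGraph.mem_neighborSet, permGraph, SimpleGraph.fromRel_adj] at hy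
    simp only [Finset.coe_union, Set.mem_union, Finset.mem_coe, Finset.mem_image, Finset.mem_univ,
      true_and, Finset.mem_filter]
    rcases hy with ⟨-, (⟨i, hi⟩ | h) | (⟨i, hi⟩ | h)⟩
    · exact Or.inl (Or.inl ⟨i, hi⟩)
    · exact Or.inr (Or.inl h)
    · exact Or.inl (Or.inr ⟨i, by rw [← hi]; simp⟩)
    · exact Or.inr (Or.inr h)
  rw [valency]
  refine (Set.ncard_le_ncard hsub (Finset.finite_toSet _)).trans ?_
  rw [Set.ncard_coe_finset]
  have h1 : (Finset.univ.image fun i => π i x).card ≤ 4 := Finset.card_image_le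
  have h2 : (Finset.univ.image fun i => (π i)⁻¹ x).card ≤ 4 := Finset.card_image_le
  have h3 : (Finset.univ.filter fun y : Fin N => x.val + 1 = y.val).card ≤ 1 :=
    Finset.card_le_one.2 fun a ha b hb => by
      simp only [Finset.mem_filter, Finset.mem_univ, true_and] at ha hb
      exact Fin.ext (by omega)
  have h4 : (Finset.univ.filter fun y : Fin N => y.val + 1 = x.val).card ≤ 1 :=
    Finset.card_le_one.2 fun a ha b hb => by
      simp only [Finset.mem_filter, Finset.mem_univ, true_and] at ha hb
      exact Fin.ext (by omega)
  refine (Finset.card_union_le _ _).trans ?_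
  have h5 := Finset.card_union_le (Finset.univ.image fun i => π i x)
    (Finset.univ.image fun i => (π i)⁻¹ x)
  have h6 := Finset.card_union_le (Finset.univ.filter fun y : Fin N => x.val + 1 = y.val)
    (Finset.univ.filter fun y : Fin N => y.val + 1 = x.val)
  omega

theorem permGraph_connected {N : ℕ} (hN : 1 ≤ N) (π : Fin 4 → Equiv.Perm (Fin N)) :
    (permGraph π).Connected := by
  obtain ⟨n, rfl⟩ : ∃ n, N = n + 1 := ⟨N - 1, by omega⟩
  refine (SimpleGraph.pathGraph_connected n).mono fun x y hxy => ?_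
  rw [permGraph, SimpleGraph.fromRel_adj]
  refine ⟨hxy.ne, ?_⟩
  rcases SimpleGraph.pathGraph_adj.1 hxy with h | h
  · exact Or.inl (Or.inr h)
  · exact Or.inr (Or.inr h)

theorem one_le_ncard_edgeBoundary {V : Type} [Finite V] {G : SimpleGraph V} (hG : G.Connected)
    {T : Finset V} (hT : T.Nonempty) {b : V} (hb : b ∉ T) : 1 ≤ (edgeBoundary G T).ncard := by
  obtain ⟨a, ha⟩ := hT
  obtain ⟨p⟩ := hG.preconnected a b
  obtain ⟨d, -, h1, h2⟩ := p.exists_boundary_dart (T : Set V) ha hb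
  exact (Set.ncard_pos (Set.toFinite _)).2 ⟨d.toProd, d.adj, h1, h2⟩

/-- A set with 512|T|⁴ ≤ N has more than |T| images outside T, too many boundary edges. Otherwise N
< 2⁹|T|⁴ ≤ |T|^13 once |T| ≥ 2. A single point with small boundary must be the whole graph, by
connectedness; this is what the path is needed for. -/
theorem permGraph_expansion {N : ℕ} (hN : 1 ≤ N) {π : Fin 4 → Equiv.Perm (Fin N)}
    (hπ : ∀ S : Finset (Fin N), S.Nonempty → 512 * S.card ^ 4 ≤ N →
      2 * S.card < (S.biUnion fun x => Finset.univ.image fun i => π i x).card)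
    (T : Finset (Fin N)) (hT : T.Nonempty)
    (hbd : ((edgeBoundary (permGraph π) T).ncard : ℝ) < 1 / 512 * T.card) :
    1 / 13 * Real.log N ≤ Real.log T.card := by
  classical
  have hT1 : (1 : ℝ) ≤ T.card := by exact_mod_cast hT.card_pos
  rcases le_or_gt (512 * T.card ^ 4) N with hsmall | hlarge
  · exfalso
    have h1 := hπ T hT hsmall
    set Y := T.biUnion fun x => Finset.univ.image fun i => π i x
    have h2 : (Y \ T).card ≤ (edgeBoundary (permGraph π) T).ncard := by
      rw [← Set.ncard_coe_finset]
      refine (Set.ncard_le_ncard (t := Prod.snd '' edgeBoundary (permGraph π) T) ?_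
        (Set.toFinite _)).trans (Set.ncard_image_le (Set.toFinite _))
      intro y hy
      obtain ⟨hyY, hyT⟩ := Finset.mem_sdiff.1 (Finset.mem_coe.1 hy)
      obtain ⟨x, hx, hxy⟩ := Finset.mem_biUnion.1 hyY
      obtain ⟨i, -, rfl⟩ := Finset.mem_image.1 hxy
      refine ⟨(x, π i x), ⟨?_, hx, hyT⟩, rfl⟩
      rw [permGraph, SimpleGraph.fromRel_adj]
      refine ⟨fun h => hyT ?_, Or.inl (Or.inl ⟨i, rfl⟩)⟩
      dsimp only at h
      rwa [← h]
    have h3 := Finset.le_card_sdiff T Y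
    have h4 : T.card ≤ (edgeBoundary (permGraph π) T).ncard := by omega
    have h5 : (T.card : ℝ) ≤ (edgeBoundary (permGraph π) T).ncard := by exact_mod_cast h4
    linarith
  · have hN0 : (0 : ℝ) < N := by exact_mod_cast hN
    rcases Nat.lt_or_ge 1 T.card with h2 | h2
    · have h3 : (2 : ℝ) ≤ T.card := by exact_mod_cast h2
      have h4 : (N : ℝ) ≤ (T.card : ℝ) ^ 13 := by
        have h5 : (N : ℝ) ≤ 512 * (T.card : ℝ) ^ 4 := by exact_mod_cast hlarge.le
        calc (N : ℝ) ≤ 2 ^ 9 * (T.card : ℝ) ^ 4 := by linarith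
          _ ≤ (T.card : ℝ) ^ 9 * (T.card : ℝ) ^ 4 := by gcongr
          _ = _ := by ring
      have h6 := Real.log_le_log hN0 h4
      rw [Real.log_pow] at h6
      push_cast at h6
      linarith
    · have h3 : T.card = 1 := le_antisymm h2 hT.card_pos
      have h4 : T = Finset.univ := by
        by_contra hne
        obtain ⟨b, hb⟩ : ∃ b, b ∉ T := by
          by_contra hcon
          push Not at hcon
          exact hne (Finset.eq_univ_iff_forall.2 hcon)
        have h5 := one_le_ncard_edgeBoundary (permGraph_connected hN π) hT hb
        have h6 : (1 : ℝ) ≤ (edgeBoundary (permGraph π) T).ncard := by exact_mod_cast h5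
        rw [h3] at hbd
        norm_num at hbd
        linarith
      have h5 : N = 1 := by
        rw [h4, Finset.card_univ, Fintype.card_fin] at h3
        exact h3
      rw [h3, h5]
      simp

end Expander

/-! ### The case β ≥ 1: fibres of size F(|z|+1)/F(|z|) -/

section Fibres

theorem rpow_sub_one_le_sub {β x : ℝ} (hβ : 1 ≤ β) (hx : 0 ≤ x) :
    (x + 1) ^ (β - 1) ≤ (x + 1) ^ β - x ^ β := by
  have h1 : (x + 1) ^ β = (x + 1) ^ (β - 1) * (x + 1) := by
    rw [← Real.rpow_add_one (by positivity)]; ring_nf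
  have h2 : x ^ β ≤ (x + 1) ^ (β - 1) * x := by
    rcases hx.eq_or_lt with rfl | hx
    · rw [Real.zero_rpow (by linarith)]; simp
    · calc x ^ β = x ^ (β - 1) * x := by rw [← Real.rpow_add_one hx.ne']; ring_nf
        _ ≤ _ := by
          gcongr
          linarith
  linarith

theorem fibreSize_eq {α β : ℝ} (hαβ : β = 2 * α / (1 - α)) (z : ℤ) :
    fibreSize α z = ⌊Real.exp ((|(z : ℝ)| + 1) ^ β - |(z : ℝ)| ^ β)⌋₊ := by
  rw [fibreSize, profileF, profileF, ← hαβ, Real.exp_sub]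

theorem fibreSize_pos {α β : ℝ} (hαβ : β = 2 * α / (1 - α)) (hβ : 1 ≤ β) (z : ℤ) :
    1 ≤ fibreSize α z := by
  rw [fibreSize_eq hαβ, Nat.one_le_floor_iff]
  refine Real.one_le_exp (le_trans ?_ (rpow_sub_one_le_sub hβ (abs_nonneg _)))
  positivity

theorem fibreSize_le {α β : ℝ} (hαβ : β = 2 * α / (1 - α)) (z : ℤ) :
    (fibreSize α z : ℝ) ≤ Real.exp ((|(z : ℝ)| + 1) ^ β - |(z : ℝ)| ^ β) := by
  rw [fibreSize_eq hαβ]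
  exact Nat.floor_le (Real.exp_pos _).le

/-- Rounding down costs at most a factor 2, because the floor is at least 1. The power is at least
1, so three quarters of it exceed log 2. -/
theorem log_fibreSize_ge {α β : ℝ} (hαβ : β = 2 * α / (1 - α)) (hβ : 1 ≤ β) (z : ℤ) :
    (|(z : ℝ)| + 1) ^ (β - 1) / 4 ≤ Real.log (fibreSize α z) := by
  have h1 := rpow_sub_one_le_sub hβ (abs_nonneg (z : ℝ))
  set d := (|(z : ℝ)| + 1) ^ β - |(z : ℝ)| ^ β with hd
  have h2 : 1 ≤ (|(z : ℝ)| + 1) ^ (β - 1) :=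
    Real.one_le_rpow (by linarith [abs_nonneg (z : ℝ)]) (by linarith)
  have hpos : (1 : ℝ) ≤ fibreSize α z := by exact_mod_cast fibreSize_pos hαβ hβ z
  have h3 : Real.exp d / 2 ≤ fibreSize α z := by
    have := Nat.lt_floor_add_one (Real.exp d)
    rw [hd, ← fibreSize_eq hαβ, ← hd] at this
    linarith
  have h4 := Real.log_le_log (by positivity) h3
  rw [Real.log_div (Real.exp_pos _).ne' (by norm_num), Real.log_exp] at h4
  have := Real.log_two_lt_d9
  linarith

/-- Telescoping on both half-lines; the term at 0, equal to 1, would be counted twice. -/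
theorem sum_rpow_increments {β : ℝ} (hβ : 0 < β) (m : ℕ) :
    ∑ z ∈ Finset.Icc (-m : ℤ) m, ((|(z : ℝ)| + 1) ^ β - |(z : ℝ)| ^ β) =
      2 * ((m : ℝ) + 1) ^ β - 1 := by
  induction m with
  | zero => simp [Real.zero_rpow hβ.ne']; norm_num
  | succ m ih =>
    have h : Finset.Icc (-(m + 1 : ℕ) : ℤ) (m + 1 : ℕ) =
        insert ((m : ℤ) + 1) (insert (-(m : ℤ) - 1) (Finset.Icc (-m : ℤ) m)) := by
      ext z
      simp only [Finset.mem_Icc, Finset.mem_insert]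
      omega
    rw [h, Finset.sum_insert (by simp; omega), Finset.sum_insert (by simp), ih]
    have h1 : |(((m : ℤ) + 1 : ℤ) : ℝ)| = (m : ℝ) + 1 := by
      push_cast; exact abs_of_nonneg (by positivity)
    have h2 : |((-(m : ℤ) - 1 : ℤ) : ℝ)| = (m : ℝ) + 1 := by
      push_cast
      rw [show (-(m : ℝ) - 1) = -((m : ℝ) + 1) by ring, abs_neg]
      exact abs_of_nonneg (by positivity)
    rw [h1, h2]
    push_cast
    ring

theorem prod_fibreSize_le {α β : ℝ} (hαβ : β = 2 * α / (1 - α)) (hβ : 1 ≤ β) (m : ℕ) :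
    ∏ z ∈ (Finset.Icc (-m : ℤ) m).image id, (Fintype.card (Fin (fibreSize α z)) : ℝ) ≤
      Real.exp (2 * ((m : ℝ) + 1) ^ β) := by
  rw [Finset.image_id]
  simp only [Fintype.card_fin]
  refine (Finset.prod_le_prod (fun z _ => Nat.cast_nonneg _) fun z _ => fibreSize_le hαβ z).trans ?_
  rw [← Real.exp_sum, sum_rpow_increments (by linarith)]
  gcongr
  linarith

/-- Of the at least k/8 points of S, at most k/16 satisfy |z| + 1 ≤ k/32. Each of the others has
entropy at least (k/32)^(β-1)/4. -/
theorem windowEntropy_fibreSize {α β : ℝ} (hαβ : β = 2 * α / (1 - α)) (hβ : 1 ≤ β) :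
    WindowEntropy (id : ℤ → ℤ) (fun z => Fin (fibreSize α z)) β
      (1 / 64 * (1 / 32) ^ (β - 1)) := by
  intro k hk j S _ hS
  rw [Finset.image_id]
  simp only [Fintype.card_fin]
  set T := S.filter fun z => (k : ℤ) < 32 * (|z| + 1) with hT
  set T' := S.filter fun z => ¬(k : ℤ) < 32 * (|z| + 1) with hT'
  have hcard : T.card + T'.card = S.card := Finset.card_filter_add_card_filter_not _
  have hT'card : 16 * T'.card ≤ k := by
    have hsub : T' ⊆ Finset.Icc (-((k : ℤ) / 32 - 1)) ((k : ℤ) / 32 - 1) := fun z hz => by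
      have := (Finset.mem_filter.1 hz).2
      rw [Finset.mem_Icc]
      have h1 := le_abs_self z
      have h2 := neg_abs_le z
      omega
    have := Finset.card_le_card hsub
    rw [Int.card_Icc] at this
    omega
  have hTcard : (k : ℝ) ≤ 16 * T.card := by
    have : k ≤ 16 * T.card := by omega
    exact_mod_cast this
  have hk1 : (0 : ℝ) < k := by exact_mod_cast hk
  calc 1 / 64 * (1 / 32) ^ (β - 1) * (k : ℝ) ^ β
      = k / 16 * (((k : ℝ) / 32) ^ (β - 1) / 4) := by
        rw [show (k : ℝ) ^ β = (k : ℝ) ^ (β - 1) * k by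
          rw [← Real.rpow_add_one hk1.ne']; ring_nf, div_eq_mul_one_div (k : ℝ) 32,
          Real.mul_rpow hk1.le (by norm_num)]
        ring
    _ ≤ T.card * (((k : ℝ) / 32) ^ (β - 1) / 4) := by
        gcongr
        linarith
    _ ≤ ∑ z ∈ T, Real.log (fibreSize α z) := by
        rw [← nsmul_eq_mul]
        refine Finset.card_nsmul_le_sum _ _ _ fun z hz => le_trans ?_ (log_fibreSize_ge hαβ hβ z)
        have h1 : (k : ℝ) < 32 * (|(z : ℝ)| + 1) := by exact_mod_cast (Finset.mem_filter.1 hz).2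
        gcongr
        linarith
    _ ≤ _ := Finset.sum_le_sum_of_subset_of_nonneg (Finset.filter_subset _ _)
        fun z _ _ => Real.log_natCast_nonneg _

theorem exists_fibres {α : ℝ} (hα : 1 / 3 ≤ α) (hα1 : α < 1) :
    ∃ (B : ∀ z : ℤ, SimpleGraph (Fin (fibreSize α z))) (o : ∀ z : ℤ, Fin (fibreSize α z)),
      (∀ z, (B z).Connected) ∧
      (∃ M : ℕ, ∀ (z : ℤ) (x : Fin (fibreSize α z)), valency (B z) x ≤ M) ∧
      HasExpectedDecay α (wreath intGraph (fun z => Fin (fibreSize α z)) B o)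
        (0, LampConfig.rest (fun z => Fin (fibreSize α z)) o) := by
  have h1 : 0 < 1 - α := by linarith
  have hβ : 1 ≤ 2 * α / (1 - α) := by rw [le_div_iff₀ h1]; linarith
  have hpos := fun z => fibreSize_pos (rfl : 2 * α / (1 - α) = _) hβ z
  choose π hπ using fun z => exists_expanding_perms (fibreSize α z)
  refine ⟨fun z => permGraph (π z), fun z => ⟨0, hpos z⟩,
    fun z => permGraph_connected (hpos z) _, ⟨10, fun z x => valency_permGraph_le _ x⟩, ?_⟩
  refine hasExpectedDecay_wreath (h := 1 / 512) (κ := 1 / 13) (C := 2) (M := 10)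
    (c := 1 / 64 * (1 / 32) ^ (2 * α / (1 - α) - 1)) (by linarith) hα1 rfl (by norm_num)
    (by norm_num) (by positivity) (by norm_num) (fun z x => valency_permGraph_le _ x) ?_
    (windowEntropy_fibreSize rfl hβ) (prod_fibreSize_le rfl hβ)
  intro z T hT hbd
  rw [Fintype.card_fin]
  exact permGraph_expansion (hpos z) (hπ z) T hT hbd

end Fibres

/-! ### The case β ≤ 1: a lamp map that forgets binary digits -/

section LampMap

/-- The indices of the binary digits which are retained by the lamp map. -/
def Retained (β : ℝ) (i : ℕ) : Prop := ⌊β * i⌋₊ < ⌊β * (i + 1 : ℕ)⌋₊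

open Classical in
/-- The retained binary digits of an integer. -/
noncomputable def retainedDigits (β : ℝ) (n : ℤ) (i : ℕ) : ℤ :=
  if Retained β i then n / 2 ^ i % 2 else 0

-- As β ≤ 1, the sequence ⌊βj⌋ grows by 0 or 1, and digits are retained exactly where it jumps.
open Classical in
theorem card_retained {β : ℝ} (hβ0 : 0 ≤ β) (hβ1 : β ≤ 1) (j : ℕ) :
    ((Finset.range j).filter (Retained β)).card = ⌊β * j⌋₊ := by
  induction j with
  | zero => simp
  | succ j ih =>
    have hmono : ⌊β * j⌋₊ ≤ ⌊β * (j + 1 : ℕ)⌋₊ := by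
      refine Nat.floor_mono ?_
      push_cast
      nlinarith
    have hle : ⌊β * (j + 1 : ℕ)⌋₊ ≤ ⌊β * j⌋₊ + 1 := by
      rw [← Nat.floor_add_one (by positivity)]
      refine Nat.floor_mono ?_
      push_cast
      linarith
    rw [Finset.range_add_one, Finset.filter_insert]
    split_ifs with h
    · rw [Finset.card_insert_of_notMem (by simp), ih]
      have : ⌊β * j⌋₊ < ⌊β * (j + 1 : ℕ)⌋₊ := h
      omega
    · rw [ih]
      have : ¬⌊β * j⌋₊ < ⌊β * (j + 1 : ℕ)⌋₊ := h
      omega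

open Classical in
theorem card_not_retained {β : ℝ} (hβ0 : 0 ≤ β) (hβ1 : β ≤ 1) (j : ℕ) :
    ((Finset.range j).filter fun i => ¬Retained β i).card + ⌊β * j⌋₊ = j := by
  rw [← card_retained hβ0 hβ1, add_comm, Finset.card_filter_add_card_filter_not, Finset.card_range]

theorem ediv_two_pow_succ (a : ℤ) (i : ℕ) : a / 2 ^ (i + 1) = a / 2 ^ i / 2 := by
  rw [pow_succ, Int.ediv_ediv_of_nonneg (by positivity)]

theorem ediv_two_pow_eq_of_le {a b : ℤ} {i j : ℕ} (hij : i ≤ j) (h : a / 2 ^ i = b / 2 ^ i) :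
    a / 2 ^ j = b / 2 ^ j := by
  induction j, hij using Nat.le_induction with
  | base => exact h
  | succ j _ ih => rw [ediv_two_pow_succ, ediv_two_pow_succ, ih]

theorem eq_of_digits_eq {a b : ℤ} {j : ℕ} (h : ∀ i < j, a / 2 ^ i % 2 = b / 2 ^ i % 2)
    (hj : a / 2 ^ j = b / 2 ^ j) : a = b := by
  induction j with
  | zero => simpa using hj
  | succ j ih =>
    refine ih (fun i hi => h i (by omega)) ?_
    have h1 := h j (by omega)
    rw [ediv_two_pow_succ, ediv_two_pow_succ] at hj
    omega

theorem digit_mem (a : ℤ) (i : ℕ) : a / 2 ^ i % 2 ∈ ({0, 1} : Finset ℤ) := by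
  rw [Finset.mem_insert, Finset.mem_singleton]
  omega

-- In a dyadic block of length 2^j only the digits below j vary, and ⌊βj⌋ of them are retained.
open Classical in
theorem card_image_retainedDigits_le_of_block {β : ℝ} (hβ0 : 0 ≤ β) (hβ1 : β ≤ 1) {j : ℕ} {q : ℤ}
    {A : Finset ℤ} (hA : ∀ a ∈ A, a / 2 ^ j = q) :
    (A.image (retainedDigits β)).card ≤ 2 ^ ⌊β * j⌋₊ := by
  have h : (Fintype.piFinset fun _ : (Finset.range j).filter (Retained β) =>
      ({0, 1} : Finset ℤ)).card = 2 ^ ⌊β * j⌋₊ := by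
    rw [Fintype.card_piFinset, Finset.prod_const, Finset.card_univ, Fintype.card_coe,
      card_retained hβ0 hβ1]
    rfl
  rw [← h]
  refine Finset.card_le_card_of_injOn (fun f i => f i) ?_ ?_
  · intro f hf
    obtain ⟨a, -, rfl⟩ := Finset.mem_image.1 hf
    refine Fintype.mem_piFinset.2 fun i => ?_
    beta_reduce
    rw [retainedDigits, if_pos (Finset.mem_filter.1 i.2).2]
    exact digit_mem a i
  · intro f hf g hg hfg
    obtain ⟨a, ha, rfl⟩ := Finset.mem_image.1 hf
    obtain ⟨b, hb, rfl⟩ := Finset.mem_image.1 hg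
    funext i
    by_cases hi : Retained β i
    · rcases Nat.lt_or_ge i j with hij | hij
      · exact congrFun hfg ⟨i, Finset.mem_filter.2 ⟨Finset.mem_range.2 hij, hi⟩⟩
      · rw [retainedDigits, retainedDigits,
          ediv_two_pow_eq_of_le hij ((hA a ha).trans (hA b hb).symm)]
    · rw [retainedDigits, retainedDigits, if_neg hi, if_neg hi]

-- The complementary count: within a block, points with the same retained digits differ only in the
-- j - ⌊βj⌋ forgotten ones.
open Classical in
theorem card_le_of_block {β : ℝ} (hβ0 : 0 ≤ β) (hβ1 : β ≤ 1) {j : ℕ} {q : ℤ}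
    {A : Finset ℤ} (hA : ∀ a ∈ A, a / 2 ^ j = q)
    (hA' : ∀ a ∈ A, ∀ b ∈ A, retainedDigits β a = retainedDigits β b) :
    A.card ≤ 2 ^ (j - ⌊β * j⌋₊) := by
  have h : (Fintype.piFinset fun _ : (Finset.range j).filter fun i => ¬Retained β i =>
      ({0, 1} : Finset ℤ)).card = 2 ^ (j - ⌊β * j⌋₊) := by
    rw [Fintype.card_piFinset, Finset.prod_const, Finset.card_univ, Fintype.card_coe,
      show ((Finset.range j).filter fun i => ¬Retained β i).card = j - ⌊β * j⌋₊ by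
        have := card_not_retained hβ0 hβ1 j; omega]
    rfl
  rw [← h]
  refine Finset.card_le_card_of_injOn (fun a i => a / 2 ^ (i : ℕ) % 2) ?_ ?_
  · intro a _
    exact Fintype.mem_piFinset.2 fun i => digit_mem a i
  · intro a ha b hb hab
    refine eq_of_digits_eq (j := j) (fun i hi => ?_) ((hA a ha).trans (hA b hb).symm)
    by_cases hr : Retained β i
    · have := congrFun (hA' a ha b hb) i
      rwa [retainedDigits, retainedDigits, if_pos hr, if_pos hr] at this
    · exact congrFun hab ⟨i, Finset.mem_filter.2 ⟨Finset.mem_range.2 hi, hr⟩⟩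

theorem exists_two_pow_near {k : ℕ} (hk : 1 ≤ k) : ∃ e : ℕ, k ≤ 2 ^ e ∧ 2 ^ e ≤ 2 * k := by
  refine ⟨Nat.log 2 k + 1, (Nat.lt_pow_succ_log_self (by norm_num) k).le, ?_⟩
  have := Nat.pow_log_le_self 2 (by omega : k ≠ 0)
  rw [pow_succ]
  omega

theorem block_of_interval {k : ℕ} {e : ℕ} (hke : k ≤ 2 ^ e) {a₀ a : ℤ} (h1 : a₀ ≤ a)
    (h2 : a < a₀ + k) : a / 2 ^ e = a₀ / 2 ^ e ∨ a / 2 ^ e = a₀ / 2 ^ e + 1 := by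
  have hpos : (0 : ℤ) < 2 ^ e := by positivity
  have hke' : (k : ℤ) ≤ 2 ^ e := by exact_mod_cast hke
  have h3 := Int.ediv_le_ediv hpos h1
  have h4 := Int.ediv_le_ediv hpos (by omega : a ≤ a₀ + 1 * 2 ^ e)
  rw [Int.add_mul_ediv_right _ _ hpos.ne'] at h4
  omega

open Classical in
theorem card_image_retainedDigits_le {β : ℝ} (hβ0 : 0 < β) (hβ1 : β ≤ 1) {k : ℕ} (hk : 1 ≤ k)
    {a₀ : ℤ} {A : Finset ℤ} (hA : ∀ a ∈ A, a₀ ≤ a ∧ a < a₀ + k) :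
    ((A.image (retainedDigits β)).card : ℝ) ≤ 4 * (k : ℝ) ^ β := by
  obtain ⟨e, he1, he2⟩ := exists_two_pow_near hk
  have hsub : A.image (retainedDigits β) ⊆
      ((A.filter fun a => a / 2 ^ e = a₀ / 2 ^ e).image (retainedDigits β)) ∪
      ((A.filter fun a => a / 2 ^ e = a₀ / 2 ^ e + 1).image (retainedDigits β)) := by
    rw [← Finset.image_union]
    refine Finset.image_subset_image fun a ha => ?_
    rw [← Finset.filter_or]
    exact Finset.mem_filter.2 ⟨ha, block_of_interval he1 (hA a ha).1 (hA a ha).2⟩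
  have h1 : (A.image (retainedDigits β)).card ≤ 2 ^ ⌊β * e⌋₊ + 2 ^ ⌊β * e⌋₊ := by
    refine (Finset.card_le_card hsub).trans ((Finset.card_union_le _ _).trans (add_le_add ?_ ?_))
    · exact card_image_retainedDigits_le_of_block hβ0.le hβ1 fun a ha => (Finset.mem_filter.1 ha).2
    · exact card_image_retainedDigits_le_of_block hβ0.le hβ1 fun a ha => (Finset.mem_filter.1 ha).2
  have h2 : (2 : ℝ) ^ ⌊β * e⌋₊ ≤ 2 * (k : ℝ) ^ β := by
    calc (2 : ℝ) ^ ⌊β * e⌋₊ = (2 : ℝ) ^ ((⌊β * e⌋₊ : ℕ) : ℝ) := (Real.rpow_natCast _ _).symm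
      _ ≤ (2 : ℝ) ^ (e * β) := by
          gcongr
          · norm_num
          · rw [mul_comm]; exact Nat.floor_le (by positivity)
      _ = ((2 : ℝ) ^ e) ^ β := by rw [Real.rpow_mul (by norm_num), Real.rpow_natCast]
      _ ≤ (2 * (k : ℝ)) ^ β := by
          gcongr
          exact_mod_cast he2
      _ = 2 ^ β * (k : ℝ) ^ β := Real.mul_rpow (by norm_num) (by positivity)
      _ ≤ 2 * (k : ℝ) ^ β := by
          gcongr
          calc (2 : ℝ) ^ β ≤ 2 ^ (1 : ℝ) := Real.rpow_le_rpow_of_exponent_le (by norm_num) hβ1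
            _ = 2 := Real.rpow_one 2
  have h3 : ((A.image (retainedDigits β)).card : ℝ) ≤ 2 ^ ⌊β * e⌋₊ + 2 ^ ⌊β * e⌋₊ := by
    exact_mod_cast h1
  linarith

-- Each value is taken at most 2 · 2^(e-⌊βe⌋) times, since the interval meets at most two blocks of
-- length 2^e ≤ 2k. The set A is arbitrary because `WindowEntropy` concerns arbitrary subsets of a
-- window.
open Classical in
theorem card_le_mul_card_image_retainedDigits {β : ℝ} (hβ0 : 0 < β) (hβ1 : β ≤ 1) {k : ℕ}
    (hk : 1 ≤ k) {a₀ : ℤ} {A : Finset ℤ} (hA : ∀ a ∈ A, a₀ ≤ a ∧ a < a₀ + k) :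
    (A.card : ℝ) ≤ 8 * (k : ℝ) ^ (1 - β) * (A.image (retainedDigits β)).card := by
  obtain ⟨e, he1, he2⟩ := exists_two_pow_near hk
  have h1 : A.card ≤ (2 ^ (e - ⌊β * e⌋₊) + 2 ^ (e - ⌊β * e⌋₊)) *
      (A.image (retainedDigits β)).card := by
    refine Finset.card_le_mul_card_image A _ fun b _ => ?_
    have hsub : (A.filter fun a => retainedDigits β a = b) ⊆
        (A.filter fun a => a / 2 ^ e = a₀ / 2 ^ e ∧ retainedDigits β a = b) ∪
        (A.filter fun a => a / 2 ^ e = a₀ / 2 ^ e + 1 ∧ retainedDigits β a = b) := by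
      intro a ha
      obtain ⟨haA, hab⟩ := Finset.mem_filter.1 ha
      rcases block_of_interval he1 (hA a haA).1 (hA a haA).2 with h | h
      · exact Finset.mem_union_left _ (Finset.mem_filter.2 ⟨haA, h, hab⟩)
      · exact Finset.mem_union_right _ (Finset.mem_filter.2 ⟨haA, h, hab⟩)
    refine (Finset.card_le_card hsub).trans ((Finset.card_union_le _ _).trans (add_le_add ?_ ?_))
    · exact card_le_of_block hβ0.le hβ1 (fun a ha => (Finset.mem_filter.1 ha).2.1)
        fun a ha c hc => (Finset.mem_filter.1 ha).2.2.trans (Finset.mem_filter.1 hc).2.2.symm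
    · exact card_le_of_block hβ0.le hβ1 (fun a ha => (Finset.mem_filter.1 ha).2.1)
        fun a ha c hc => (Finset.mem_filter.1 ha).2.2.trans (Finset.mem_filter.1 hc).2.2.symm
  have h2 : (2 : ℝ) ^ (e - ⌊β * e⌋₊) ≤ 4 * (k : ℝ) ^ (1 - β) := by
    have hle : ⌊β * e⌋₊ ≤ e := by
      have := card_not_retained hβ0.le hβ1 e; omega
    have hfl := Nat.lt_floor_add_one (β * e)
    calc (2 : ℝ) ^ (e - ⌊β * e⌋₊) = (2 : ℝ) ^ ((e - ⌊β * e⌋₊ : ℕ) : ℝ) :=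
          (Real.rpow_natCast _ _).symm
      _ ≤ (2 : ℝ) ^ (e * (1 - β) + 1) := by
          gcongr
          · norm_num
          · rw [Nat.cast_sub hle]; linarith
      _ = ((2 : ℝ) ^ e) ^ (1 - β) * 2 := by
          rw [Real.rpow_add_one (by norm_num), Real.rpow_mul (by norm_num), Real.rpow_natCast]
      _ ≤ (2 * (k : ℝ)) ^ (1 - β) * 2 := by
          gcongr
          exact_mod_cast he2
      _ = 2 ^ (1 - β) * (k : ℝ) ^ (1 - β) * 2 := by
          rw [Real.mul_rpow (by norm_num) (by positivity)]
      _ ≤ 2 * (k : ℝ) ^ (1 - β) * 2 := by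
          gcongr
          calc (2 : ℝ) ^ (1 - β) ≤ 2 ^ (1 : ℝ) :=
                Real.rpow_le_rpow_of_exponent_le (by norm_num) (by linarith)
            _ = 2 := Real.rpow_one 2
      _ = _ := by ring
  have h3 : (A.card : ℝ) ≤ (2 ^ (e - ⌊β * e⌋₊) + 2 ^ (e - ⌊β * e⌋₊)) *
      (A.image (retainedDigits β)).card := by exact_mod_cast h1
  refine h3.trans ?_
  gcongr
  linarith

/-- A lamp map which takes `≈ k ^ β` values, about equally often, in an interval of length `k`. -/
theorem exists_lampMap {β : ℝ} (hβ0 : 0 < β) (hβ1 : β ≤ 1) :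
    ∃ φ : ℤ → ℤ, Function.Surjective φ ∧ ∀ (k : ℕ) (a₀ : ℤ) (A : Finset ℤ), 1 ≤ k →
      (∀ a ∈ A, a₀ ≤ a ∧ a < a₀ + k) →
      ((A.image φ).card : ℝ) ≤ 4 * (k : ℝ) ^ β ∧
      (A.card : ℝ) ≤ 8 * (k : ℝ) ^ (1 - β) * (A.image φ).card := by
  classical
  have hinf : Infinite (Set.range (retainedDigits β)) := by
    rw [Set.infinite_coe_iff]
    intro hfin
    obtain ⟨k, hk, hk'⟩ := exists_nat_rpow_ge hβ0 (8 * (hfin.toFinset.card + 1))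
    have h1 := card_le_mul_card_image_retainedDigits hβ0 hβ1 hk (a₀ := 0)
      (A := Finset.Ico 0 (k : ℤ)) fun a ha => by simpa using ha
    have h2 : ((Finset.Ico 0 (k : ℤ)).image (retainedDigits β)).card ≤ hfin.toFinset.card :=
      Finset.card_le_card fun f hf => by
        obtain ⟨a, -, rfl⟩ := Finset.mem_image.1 hf
        simp
    have hk0 : (0 : ℝ) < k := by exact_mod_cast hk
    have h3 : (k : ℝ) ≤ 8 * (k : ℝ) ^ (1 - β) * hfin.toFinset.card := by
      refine le_trans (by simp at h1 ⊢; exact h1) (mul_le_mul_of_nonneg_left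
        (by exact_mod_cast h2 : (((Finset.Ico 0 (k : ℤ)).image (retainedDigits β)).card : ℝ) ≤
          hfin.toFinset.card) (by positivity))
    have h4 : (k : ℝ) = (k : ℝ) ^ (1 - β) * (k : ℝ) ^ β := by
      rw [← Real.rpow_add hk0]; simp
    have h5 : (0 : ℝ) < (k : ℝ) ^ (1 - β) := by positivity
    nlinarith
  have hcount : Countable (Set.range (retainedDigits β)) := (Set.countable_range _).to_subtype
  obtain ⟨hden⟩ := nonempty_denumerable (Set.range (retainedDigits β))
  -- The digit sequences form a countably infinite set; relabelling it by ℤ makes the lamp map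
  -- surjective without changing the sizes of images.
  set E : Set.range (retainedDigits β) ≃ ℤ := Denumerable.equiv₂ _ _
  set φ : ℤ → ℤ := fun n => E ⟨retainedDigits β n, n, rfl⟩ with hφ
  have himage : ∀ A : Finset ℤ, (A.image φ).card = (A.image (retainedDigits β)).card := by
    intro A
    have h : A.image φ = ((A.image (retainedDigits β)).subtype (· ∈ Set.range _)).image E := by
      ext y
      simp only [Finset.mem_image, Finset.mem_subtype, hφ]
      constructor
      · rintro ⟨a, ha, rfl⟩
        exact ⟨⟨retainedDigits β a, a, rfl⟩, ⟨a, ha, rfl⟩, rfl⟩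
      · rintro ⟨⟨x, hx⟩, ⟨a, ha, rfl⟩, rfl⟩
        exact ⟨a, ha, rfl⟩
    rw [h, Finset.card_image_of_injective _ E.injective, Finset.card_subtype,
      Finset.filter_true_of_mem fun x hx => by
        obtain ⟨a, -, rfl⟩ := Finset.mem_image.1 hx
        exact ⟨a, rfl⟩]
  refine ⟨φ, fun y => ?_, fun k a₀ A hk hA => ?_⟩
  · obtain ⟨⟨x, n, rfl⟩, hx⟩ := E.surjective y
    exact ⟨n, hx⟩
  · rw [himage]
    exact ⟨card_image_retainedDigits_le hβ0 hβ1 hk hA,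
      card_le_mul_card_image_retainedDigits hβ0 hβ1 hk hA⟩

end LampMap

/-! ### Two-state lamps along the lamp map -/

section LampGroupTwo

theorem zmodTwoGraph_adj (a b : ZMod 2) : zmodTwoGraph.Adj a b ↔ a ≠ b := by
  simp only [zmodTwoGraph, SimpleGraph.circulantGraph, SimpleGraph.fromRel_adj,
    Set.mem_singleton_iff]
  revert a b
  decide

theorem zmodTwoGraph_connected : zmodTwoGraph.Connected := by
  have : zmodTwoGraph = ⊤ := by
    ext a b
    rw [zmodTwoGraph_adj, SimpleGraph.top_adj]
  rw [this]
  exact SimpleGraph.connected_top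

/-- A singleton has boundary 1, which is not less than its size, so only the full fibre has to be
considered. -/
theorem smallSetExpansion_zmodTwo :
    SmallSetExpansion (fun _ : ℤ => zmodTwoGraph) 1 1 := by
  intro _ T hT hbd
  have huniv : T = Finset.univ := by
    by_contra hne
    obtain ⟨b, hb⟩ : ∃ b, b ∉ T := by
      by_contra hcon
      push Not at hcon
      exact hne (Finset.eq_univ_iff_forall.2 hcon)
    have h1 := one_le_ncard_edgeBoundary zmodTwoGraph_connected hT hb
    have h2 : T.card < 2 := by
      have := Finset.card_lt_univ_of_notMem hb
      rwa [ZMod.card] at this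
    have h3 : (1 : ℝ) ≤ (edgeBoundary zmodTwoGraph T).ncard := by exact_mod_cast h1
    have h4 : (T.card : ℝ) ≤ 1 := by exact_mod_cast Nat.lt_succ_iff.1 h2
    linarith
  rw [huniv, Finset.card_univ, one_mul]

theorem exists_lampMap_hasExpectedDecay {α : ℝ} (hα : 0 < α) (hα1 : α ≤ 1 / 3) :
    ∃ φ : ℤ → ℤ, Function.Surjective φ ∧
      (∃ c C : ℝ, 0 < c ∧ 0 < C ∧ ∀ (k : ℤ) (m : ℕ), 1 ≤ m →
        c * (m : ℝ) ^ (2 * α / (1 - α)) ≤ (((Finset.Icc k (k + m)).image φ).card : ℝ) ∧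
        (((Finset.Icc k (k + m)).image φ).card : ℝ) ≤ C * (m : ℝ) ^ (2 * α / (1 - α))) ∧
      HasExpectedDecay α
        (generalizedWreath intGraph φ (fun _ : ℤ => ZMod 2) (fun _ : ℤ => zmodTwoGraph)
          (fun _ : ℤ => 0))
        (0, LampConfig.rest (fun _ : ℤ => ZMod 2) (fun _ : ℤ => 0)) := by
  have h1 : 0 < 1 - α := by linarith
  set β := 2 * α / (1 - α) with hαβ
  have hβ0 : 0 < β := by positivity
  have hβ1 : β ≤ 1 := by rw [hαβ, div_le_one h1]; linarith
  have hpow : ∀ x : ℝ, 0 ≤ x → (2 * x) ^ β ≤ 2 * x ^ β := fun x hx => by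
    rw [Real.mul_rpow (by norm_num) hx]
    gcongr
    calc (2 : ℝ) ^ β ≤ 2 ^ (1 : ℝ) := Real.rpow_le_rpow_of_exponent_le (by norm_num) hβ1
      _ = 2 := Real.rpow_one 2
  have hlow : ∀ {k : ℕ} {x y : ℝ}, 1 ≤ k → x ≤ 8 * (k : ℝ) ^ (1 - β) * y → (k : ℝ) ≤ 8 * x →
      (k : ℝ) ^ β ≤ 64 * y := by
    intro k x y hk hxy hkx
    have hk0 : (0 : ℝ) < k := by exact_mod_cast hk
    have h2 : (k : ℝ) = (k : ℝ) ^ (1 - β) * (k : ℝ) ^ β := by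
      rw [← Real.rpow_add hk0]; simp
    have h3 : (0 : ℝ) < (k : ℝ) ^ (1 - β) := by positivity
    refine le_of_mul_le_mul_left ?_ h3
    linarith
  obtain ⟨φ, hsurj, hφ⟩ := exists_lampMap hβ0 hβ1
  -- The interval has m + 1 ≤ 2m points, and (2m)^β ≤ 2m^β turns the 4 of `exists_lampMap` into 8.
  -- The constant 1/64 is the one of `hlow`, which allows for an eighth of a window.
  refine ⟨φ, hsurj, ⟨1 / 64, 8, by norm_num, by norm_num, fun k m hm => ?_⟩, ?_⟩
  · obtain ⟨hup, hmult⟩ := hφ (m + 1) k (Finset.Icc k (k + m)) (by omega) fun a ha => by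
      rw [Finset.mem_Icc] at ha
      push_cast
      omega
    have hm1 : (1 : ℝ) ≤ m := by exact_mod_cast hm
    constructor
    · have hcard : ((Finset.Icc k (k + m)).card : ℝ) = (m + 1 : ℕ) := by
        rw [Int.card_Icc]
        congr 1
        omega
      have h2 := hlow (by omega) hmult (by
        rw [hcard]
        have : (0 : ℝ) ≤ (m + 1 : ℕ) := Nat.cast_nonneg _
        linarith)
      have h3 : (m : ℝ) ^ β ≤ ((m + 1 : ℕ) : ℝ) ^ β := by
        gcongr
        omega
      linarith
    · have h2 : ((m + 1 : ℕ) : ℝ) ^ β ≤ (2 * (m : ℝ)) ^ β := by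
        gcongr
        push_cast
        linarith
      have h3 := hpow m (by positivity)
      linarith
  · refine hasExpectedDecay_wreath (h := 1) (κ := 1) (c := Real.log 2 / 64) (C := 8) (M := 2) hα
      (by linarith) hαβ (by norm_num) (by norm_num)
      (div_pos (Real.log_pos (by norm_num)) (by norm_num)) (by norm_num) (fun _ x => ?_)
      smallSetExpansion_zmodTwo ?_ ?_
    · exact (Set.ncard_le_card _).trans_eq (by rw [Nat.card_zmod])
    · intro k hk j S hS hkS
      obtain ⟨-, hmult⟩ := hφ k (j * k) S hk fun a ha => by
        have := (Int.ediv_eq_iff_of_pos (by exact_mod_cast hk)).1 (hS a ha)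
        constructor <;> nlinarith [this.1, this.2]
      have h2 := hlow hk hmult (by exact_mod_cast hkS)
      rw [Finset.sum_const, ZMod.card, nsmul_eq_mul]
      have h3 : 0 < Real.log 2 := Real.log_pos (by norm_num)
      push_cast
      nlinarith
    · intro m
      obtain ⟨hup, -⟩ := hφ (2 * (m + 1)) (-m) (Finset.Icc (-m : ℤ) m) (by omega) fun a ha => by
        rw [Finset.mem_Icc] at ha
        push_cast
        omega
      have h2 := hpow ((m : ℝ) + 1) (by positivity)
      push_cast at hup
      simp only [ZMod.card, Finset.prod_const]
      have h3 : ((2 : ℕ) : ℝ) ≤ Real.exp 1 := by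
        have := Real.add_one_le_exp 1
        push_cast
        linarith
      refine (pow_le_pow_left₀ (Nat.cast_nonneg _) h3 _).trans ?_
      rw [← Real.exp_nat_mul, Real.exp_le_exp, mul_one]
      linarith

end LampGroupTwo

/-! ### Connectedness of the wreath products -/

section Connectivity

variable {L : Type} {W : L → Type} {o : ∀ z, W z}

theorem infinite_wreath : Infinite (ℤ × LampConfig W o) :=
  have : Nonempty (LampConfig W o) := ⟨LampConfig.rest W o⟩
  Prod.infinite_of_left

variable [DecidableEq L] {φ : ℤ → L}
  {B : ∀ z, SimpleGraph (W z)}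

theorem wreath_reachable_base (a : ℤ) (f : LampConfig W o) :
    (generalizedWreath intGraph φ W B o).Reachable (0, f) (a, f) := by
  induction a using Int.induction_on with
  | zero => exact SimpleGraph.Reachable.refl _
  | succ a ih =>
    exact ih.trans (SimpleGraph.Adj.reachable ((wreath_adj_iff _ _).2 (Or.inl (Or.inl rfl))))
  | pred a ih =>
    exact ih.trans (SimpleGraph.Adj.reachable ((wreath_adj_iff _ _).2 (Or.inl (Or.inr rfl))))

theorem wreath_reachable_switch (hB : ∀ z, (B z).Connected) (a : ℤ) (f : LampConfig W o)
    (v : W (φ a)) :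
    (generalizedWreath intGraph φ W B o).Reachable (a, f) (a, f.switch (φ a) v) := by
  let hom : B (φ a) →g generalizedWreath intGraph φ W B o :=
    { toFun := fun w => (a, f.switch (φ a) w)
      map_rel' := fun {w w'} h => (wreath_adj_iff _ _).2 (Or.inr ⟨w', by
        simpa only [LampConfig.switch_apply_same] using h, by
        simp only [LampConfig.switch_switch]⟩) }
  have h := ((hB (φ a)).preconnected (f.1 (φ a)) v).map hom
  have h' : hom (f.1 (φ a)) = (a, f) := by
    change (a, f.switch (φ a) (f.1 (φ a))) = (a, f)
    rw [LampConfig.switch_self]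
  rwa [h'] at h

/-- Lamps are put to rest one at a time: by surjectivity the walker can go to a position controlling
the lamp, reset it along its connected fibre and return to 0. -/
theorem wreath_connected (hφ : Function.Surjective φ) (hB : ∀ z, (B z).Connected) :
    (generalizedWreath intGraph φ W B o).Connected := by
  have key : ∀ (s : Finset L) (f : LampConfig W o), (∀ z ∉ s, f.1 z = o z) →
      (generalizedWreath intGraph φ W B o).Reachable (0, f) (0, LampConfig.rest W o) := by
    intro s
    induction s using Finset.induction_on with
    | empty =>
      intro f hf
      rw [LampConfig.ext (f := f) (g := LampConfig.rest W o) fun z => hf z (by simp)]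
    | insert x s hx ih =>
      intro f hf
      obtain ⟨a, rfl⟩ := hφ x
      refine ((wreath_reachable_base a f).trans
        (wreath_reachable_switch hB a f (o (φ a)))).trans
        ((wreath_reachable_base a _).symm.trans (ih _ fun z hz => ?_))
      by_cases h : z = φ a
      · subst h
        rw [LampConfig.switch_apply_same]
      · rw [LampConfig.switch_apply_of_ne _ h]
        exact hf z (by simp [h, hz])
  have hroot : ∀ u, (generalizedWreath intGraph φ W B o).Reachable u (0, LampConfig.rest W o) := by
    rintro ⟨a, f⟩
    exact (wreath_reachable_base a f).symm.trans
      (key f.2.toFinset f fun z hz => by simpa using hz)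
  have : Nonempty (ℤ × LampConfig W o) := ⟨(0, LampConfig.rest W o)⟩
  exact SimpleGraph.Connected.mk fun u v => (hroot u).trans (hroot v).symm

end Connectivity

/-! ### The degenerate case α = 0 -/

section Edgeless

/-- The Følner function and the return probabilities are 1, while F = e and exp(-n^0) = 1/e, also at
0 because 0^0 = 1. -/
theorem hasExpectedDecay_bot : HasExpectedDecay 0 (⊥ : SimpleGraph ℕ) 0 := by
  have hbd : ∀ U : Finset ℕ, edgeBoundary (⊥ : SimpleGraph ℕ) U = ∅ := fun U => by
    ext e
    simp [edgeBoundary]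
  have hmem : ∀ k, ({0} : Finset ℕ) ∈ folnerSets (⊥ : SimpleGraph ℕ) k := fun k => by
    simp [folnerSets, hbd]
  have hfol : ∀ k, folner (⊥ : SimpleGraph ℕ) k = 1 := fun k => by
    have hne : (folnerSets (⊥ : SimpleGraph ℕ) k).Nonempty := ⟨_, hmem k⟩
    obtain ⟨U, hU, hU'⟩ := Nat.sInf_mem (hne.image Finset.card)
    have h1 : folner (⊥ : SimpleGraph ℕ) k ≤ 1 :=
      Nat.sInf_le ⟨{0}, hmem k, by simp⟩
    have h2 : 0 < folner (⊥ : SimpleGraph ℕ) k := by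
      rw [folner, ← hU']
      exact hU.1.card_pos
    omega
  have hval : ∀ x, valency (⊥ : SimpleGraph ℕ) x = 0 := fun x => by
    have : (⊥ : SimpleGraph ℕ).neighborSet x = ∅ := by
      ext y
      simp
    rw [valency, this, Set.ncard_empty]
  have hp : ∀ n x y, transProb (⊥ : SimpleGraph ℕ) n x y = if x = y then 1 else 0 := by
    intro n
    induction n with
    | zero => intro x y; simp [transProb]
    | succ n ih =>
      intro x y
      rw [transProb, tsum_eq_single x fun z hz => by simp [walkStep, hz.symm], ih]
      simp [walkStep, hval]
  have hF : ∀ x : ℝ, profileF 0 x = Real.exp 1 := fun x => by simp [profileF]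
  refine ⟨⟨0, fun x => ?_⟩, fun k => ⟨_, hmem k⟩, ⟨?_, ?_⟩, ⟨?_, ?_⟩⟩
  · have : (⊥ : SimpleGraph ℕ).neighborSet x = ∅ := by
      ext y
      simp
    rw [this]
    simp
  · refine ⟨1, one_pos, 1, one_pos, fun n => ?_⟩
    simp only [hfol, hF, one_mul, Nat.cast_one]
    exact Real.one_le_exp zero_le_one
  · refine ⟨Real.exp 1, Real.exp_pos 1, 1, one_pos, fun n => ?_⟩
    simp [hfol, hF]
  · refine ⟨Real.exp 1, Real.exp_pos 1, 1, one_pos, fun n => ?_⟩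
    simp [hp, ← Real.exp_add]
  · refine ⟨1, one_pos, 1, one_pos, fun n => ?_⟩
    simp [hp]

end Edgeless

/-! ### The theorem -/

theorem mainTheorem1 (α : ℝ) (hα₀ : 0 ≤ α) (hα₁ : α < 1) :
    (∃ (V : Type) (D : SimpleGraph V) (d₀ : V),
      Infinite V ∧ (0 < α → D.Connected) ∧ HasExpectedDecay α D d₀) ∧
    (1 / 3 ≤ α →
      ∃ (B : ∀ z : ℤ, SimpleGraph (Fin (fibreSize α z))) (o : ∀ z : ℤ, Fin (fibreSize α z)),
        (∀ z, (B z).Connected) ∧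
        (∃ M : ℕ, ∀ (z : ℤ) (x : Fin (fibreSize α z)), valency (B z) x ≤ M) ∧
        HasExpectedDecay α (wreath intGraph (fun z => Fin (fibreSize α z)) B o)
          (0, LampConfig.rest (fun z => Fin (fibreSize α z)) o)) ∧
    (0 < α → α ≤ 1 / 3 →
      ∃ φ : ℤ → ℤ, Function.Surjective φ ∧
        (∃ c C : ℝ, 0 < c ∧ 0 < C ∧ ∀ (k : ℤ) (m : ℕ), 1 ≤ m →
          c * (m : ℝ) ^ (2 * α / (1 - α)) ≤ (((Finset.Icc k (k + m)).image φ).card : ℝ) ∧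
          (((Finset.Icc k (k + m)).image φ).card : ℝ) ≤ C * (m : ℝ) ^ (2 * α / (1 - α))) ∧
        HasExpectedDecay α
          (generalizedWreath intGraph φ (fun _ : ℤ => ZMod 2) (fun _ : ℤ => zmodTwoGraph)
            (fun _ : ℤ => 0))
          (0, LampConfig.rest (fun _ : ℤ => ZMod 2) (fun _ : ℤ => 0))) := by
  have ha : 1 / 3 ≤ α → _ := fun h => exists_fibres h hα₁
  have hb : 0 < α → α ≤ 1 / 3 → _ := fun h h' => exists_lampMap_hasExpectedDecay h h'
  refine ⟨?_, ha, hb⟩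
  rcases hα₀.eq_or_lt with rfl | hα
  · exact ⟨ℕ, ⊥, 0, inferInstance, fun h => absurd h (lt_irrefl _), hasExpectedDecay_bot⟩
  · rcases le_total (1 / 3) α with h | h
    · obtain ⟨B, o, hB, -, hdecay⟩ := ha h
      exact ⟨_, _, _, infinite_wreath,
        fun _ => wreath_connected Function.surjective_id hB, hdecay⟩
    · obtain ⟨φ, hφ, -, hdecay⟩ := hb hα h
      exact ⟨_, _, _, infinite_wreath,
        fun _ => wreath_connected hφ fun _ => zmodTwoGraph_connected, hdecay⟩
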